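/- Let $N_f=2n$ with $n\ge 1$, let $\nu\in\mathbb Z$, and write $M_\nu=N+\nu$ for integers $N\ge 0$. For $z\in\mathbb C$ put $z^{[\nu]}=z^\nu$ if $\nu\ge0$ and $z^{[\nu]}=(z^*)^{|\nu|}$ if $\nu<0$. Let $\mathrm{Pf}(X)=\frac1{2^{k/2}(k/2)!}\sum_\sigma \mathrm{sgn}(\sigma)X_{\sigma(1)\sigma(2)}\cdots X_{\sigma(k-1)\sigma(k)}$ be the Pfaffian of an antisymmetric $k\times k$ matrix ($k$ even), $\Lambda(K)=\begin{pmatrix}0&K\\-K^T&0\end{pmatrix}$ for $K\in\mathbb C^{n\times n}$, and $I=\Lambda(-\mathbb 1_n)$. For a complex antisymmetric $N_f\times N_f$ matrix $X$ define, with normalized Haar measure, $$g_\nu(X)=\int_{\mathrm U(N_f)}dU\,(\det U)^\nu\exp\big[\mathrm{Re}\,\mathrm{tr}(X^\dagger UIU^T)\big],\qquad Z^{\rm eff}_\nu(J_L,J_R)=g_\nu(V_4\Phi J_L^\dagger)\,g_\nu(V_4\Phi J_R)\quad(V_4,\Phi>0).$$ For $N$ with $M_\nu\ge0$ let $dA$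 be Lebesgue measure on the real $N\times M_\nu$ matrices, and for a complex antisymmetric $N_f\times N_f$ matrix $\hat J$ let $$g_\nu^{\rm RMT}(\hat J)=\int dA\,e^{-N\mathrm{tr}(A^TA)}\,\mathrm{Pf}\begin{pmatrix}\hat J^\dagger\otimes\mathbb 1_N&\mathbb 1_{N_f}\otimes A\\ \mathbb 1_{N_f}\otimes(-A^T)&\hat J\otimes\mathbb 1_{M_\nu}\end{pmatrix},\qquad Z_\nu^{\rm RMT}(\hat J_L,\hat J_R)=g_\nu^{\rm RMT}(\hat J_L^\dagger)\,g_\nu^{\rm RMT}(\hat J_R),$$ rows and columns being listed in the usual order of Kronecker products. Let $\epsilon_N=(-1)^{nN(nN+1)/2+nM_\nu(nM_\nu-1)/2}$. Then the following hold. 1. Let $N+\nu\ge0$. The integral defining $g_\nu^{\rm RMT}(\hat J)$ converges absolutely. Every complex antisymmetric $\hat J$ can be written as $\hat J=U\Lambda(\mathrm{diag}(\hat j_1,\dots,\hat j_n))U^T$ with $U\in\mathrm{SU}(N_f)$ and $\hat j_f\in\mathbb C$; and for every such representation with $U\in\mathrm U(N_f)$, $$g_\nu^{\rm RMT}(\hat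 J)=\epsilon_N\,(\det U)^{[\nu]}\int dA\,e^{-N\mathrm{tr}(A^TA)}\prod_{f=1}^{n}\hat j_f^{[\nu]}\det\big(AA^T+|\hat j_f|^2\big),$$ where $AA^T$ is replaced by $A^TA$ if $\nu<0$. The integral on the right equals $Z^{\mu=0}_\nu(\mathrm{diag}(\hat j_1,\dots,\hat j_n))$, where $$Z_\nu^{\mu=0}(\hat M)=\int dA\,e^{-N\mathrm{tr}(A^TA)}\det\begin{pmatrix}\hat M^\dagger\otimes\mathbb 1_N&i\,\mathbb 1_n\otimes A\\ i\,\mathbb 1_n\otimes A^T&\hat M\otimes\mathbb 1_{M_\nu}\end{pmatrix}$$ is the chiral random matrix model of two-colour QCD at $\mu=0$ with $n$ flavours, mass matrix $\hat M\in\mathbb C^{n\times n}$ and no diquark source. Moreover $g_\nu^{\rm RMT}(\Lambda(\hat M))=\epsilon_N\,Z_\nu^{\mu=0}(\hat M)$ for every $\hat M\in\mathbb C^{n\times n}$. 2. There are nonzero real constants $c_N$, depending only on $N$, $N_f$ and $\nu$, such that for every complex antisymmetric $X$ $$\lim_{N\to\infty}c_N\,g_\nu^{\rm RMT}\!\Big(\frac{X}{\sqrt2\,N}\Big)=g_\nu(X),$$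 and for all $V_4,\Phi>0$ and all complex antisymmetric $J_L,J_R$, with $\hat J_i=J_iV_4\Phi/(\sqrt2\,N)$, $$\lim_{N\to\infty}c_N^2\,Z_\nu^{\rm RMT}(\hat J_L,\hat J_R)=Z_\nu^{\rm eff}(J_L,J_R).$$ 3. Let $\hat\xi_k$ be the square roots of the eigenvalues of $A^TA$, let primed products omit the vanishing $\hat\xi_k$, and let $\langle\cdot\rangle_{\nu,N}$ be the average over $A$ with the normalized weight proportional to $e^{-N\mathrm{tr}(A^TA)}\prod_k'\hat\xi_k^{N_f}$. There is a nonzero real constant $\mathcal N$, depending only on $N_f$ and $\nu$, such that for all $V_4,\Phi>0$ and all complex antisymmetric $J$, with $\xi_k$ defined by $\hat\xi_k=\xi_kV_4\Phi/(\sqrt2\,N)$, $$\lim_{N\to\infty}\mathcal N\,\big(\mathrm{Pf}(V_4\Phi J)\big)^{[\nu]}\Big\langle\prod_k{}'\det{}^{1/2}\Big(\mathbb 1+\frac{J^\dagger J}{\xi_k^2}\Big)\Big\rangle_{\nu,N}=g_\nu(V_4\Phi J).$$ -/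

import Mathlib

open Matrix MeasureTheory Filter Topology
open scoped Kronecker Nat

noncomputable section

namespace ChiralRMT

/-- The Pfaffian of a (complex, antisymmetric) matrix of even size `k`:
`Pf X = 1 / (2 ^ (k/2) (k/2)!) ∑_σ sgn σ X_{σ(1)σ(2)} ⋯ X_{σ(k-1)σ(k)}`. -/
def pfaffian {k : ℕ} (X : Matrix (Fin k) (Fin k) ℂ) : ℂ :=
  (1 / ((2 : ℂ) ^ (k / 2) * ((k / 2)! : ℂ))) *
    ∑ σ : Equiv.Perm (Fin k), ((Equiv.Perm.sign σ : ℤ) : ℂ) *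
      ∏ i : Fin (k / 2),
        X (σ ⟨2 * (i : ℕ), by have := i.isLt; omega⟩)
          (σ ⟨2 * (i : ℕ) + 1, by have := i.isLt; omega⟩)

/-- Complex antisymmetric matrices. -/
def IsAntisymm {k : ℕ} (X : Matrix (Fin k) (Fin k) ℂ) : Prop := Xᵀ = -X

/-- The antisymmetric matrix `[[0, K], [-Kᵀ, 0]]` of size `N_f = 2 n`, for an `n × n` matrix `K`. -/
def offDiag {n : ℕ} (K : Matrix (Fin n) (Fin n) ℂ) : Matrix (Fin (n + n)) (Fin (n + n)) ℂ :=
  Matrix.reindex finSumFinEquiv finSumFinEquiv (Matrix.fromBlocks 0 K (-Kᵀ) 0)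

/-- The symplectic form `I = [[0, -1], [1, 0]]` of size `N_f = 2 n`. -/
def symplecticI (n : ℕ) : Matrix (Fin (n + n)) (Fin (n + n)) ℂ :=
  offDiag (-1 : Matrix (Fin n) (Fin n) ℂ)

/-! ### The group integral over `U(k)` -/

instance instCompactUnitary (k : ℕ) : CompactSpace (Matrix.unitaryGroup (Fin k) ℂ) := by
  have hc : IsCompact (Set.univ.pi fun _ : Fin k => Set.univ.pi fun _ : Fin k =>
      Metric.closedBall (0 : ℂ) 1) :=
    isCompact_univ_pi fun _ => isCompact_univ_pi fun _ => isCompact_closedBall _ _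
  have hs : IsClosed ((Matrix.unitaryGroup (Fin k) ℂ : Set (Matrix (Fin k) (Fin k) ℂ))) :=
    isClosed_unitary
  refine isCompact_iff_compactSpace.mp (hc.of_isClosed_subset hs ?_)
  intro U hU i _ j _
  simpa using entry_norm_bound_of_unitary hU i j

instance instMeasurableUnitary (k : ℕ) : MeasurableSpace (Matrix.unitaryGroup (Fin k) ℂ) :=
  borel _

instance instBorelUnitary (k : ℕ) : BorelSpace (Matrix.unitaryGroup (Fin k) ℂ) := ⟨rfl⟩

/-- The normalized Haar measure `dU` of `U(k)`. -/
def haarU (k : ℕ) : Measure (Matrix.unitaryGroup (Fin k) ℂ) :=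
  Measure.haarMeasure ⊤

/-- `g_ν(X) = ∫_{U(N_f)} dU (det U)^ν exp (Re tr (X† U I Uᵀ))`, with `N_f = 2 n`. -/
def gFin (n : ℕ) (ν : ℤ) (X : Matrix (Fin (n + n)) (Fin (n + n)) ℂ) : ℂ :=
  ∫ U : Matrix.unitaryGroup (Fin (n + n)) ℂ,
    (U : Matrix (Fin (n + n)) (Fin (n + n)) ℂ).det ^ ν *
      (Real.exp (Xᴴ * (U : Matrix (Fin (n + n)) (Fin (n + n)) ℂ) * symplecticI n *
        (U : Matrix (Fin (n + n)) (Fin (n + n)) ℂ)ᵀ).trace.re : ℂ)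
    ∂(haarU (n + n))

/-- The finite-volume partition function in the sector of topological charge `ν`,
`Z_ν^eff(J_L, J_R) = g_ν(V₄ Φ J_L†) g_ν(V₄ Φ J_R)`. -/
def zEff (n : ℕ) (ν : ℤ) (V₄ Φ : ℝ) (JL JR : Matrix (Fin (n + n)) (Fin (n + n)) ℂ) : ℂ :=
  gFin n ν (((V₄ * Φ : ℝ) : ℂ) • JLᴴ) * gFin n ν (((V₄ * Φ : ℝ) : ℂ) • JR)

/-! ### The random matrix model -/

/-- The second dimension `N + ν` of the random matrix `A` (used for `0 ≤ N + ν`). -/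
def dimR (N : ℕ) (ν : ℤ) : ℕ := ((N : ℤ) + ν).toNat

/-- The space of real `N × (N + ν)` matrices, with its Lebesgue measure `dA`. -/
abbrev RealMat (N : ℕ) (ν : ℤ) : Type := Fin N → Fin (dimR N ν) → ℝ

/-- The Gaussian weight `exp (-N tr (Aᵀ A))`. -/
def gaussWeight {N : ℕ} {ν : ℤ} (a : RealMat N ν) : ℝ :=
  Real.exp (-(N : ℝ) * ((Matrix.of a)ᵀ * Matrix.of a).trace)

/-- `A`, with complex entries. -/
def cMat {N : ℕ} {ν : ℤ} (a : RealMat N ν) : Matrix (Fin N) (Fin (dimR N ν)) ℂ :=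
  (Matrix.of a).map (fun x : ℝ => (x : ℂ))

/-- The matrix `[[J† ⊗ 1_N, 1 ⊗ A], [1 ⊗ (-Aᵀ), J ⊗ 1_{N+ν}]]`, with rows and columns listed
in the usual order of Kronecker products. -/
def pfBlock {n N : ℕ} {ν : ℤ} (J : Matrix (Fin (n + n)) (Fin (n + n)) ℂ) (a : RealMat N ν) :
    Matrix (Fin ((n + n) * N + (n + n) * dimR N ν)) (Fin ((n + n) * N + (n + n) * dimR N ν)) ℂ :=
  Matrix.reindex
    ((Equiv.sumCongr finProdFinEquiv finProdFinEquiv).trans finSumFinEquiv)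
    ((Equiv.sumCongr finProdFinEquiv finProdFinEquiv).trans finSumFinEquiv)
    (Matrix.fromBlocks
      (Jᴴ ⊗ₖ (1 : Matrix (Fin N) (Fin N) ℂ))
      ((1 : Matrix (Fin (n + n)) (Fin (n + n)) ℂ) ⊗ₖ cMat a)
      ((1 : Matrix (Fin (n + n)) (Fin (n + n)) ℂ) ⊗ₖ (-(cMat a)ᵀ))
      (J ⊗ₖ (1 : Matrix (Fin (dimR N ν)) (Fin (dimR N ν)) ℂ)))

/-- The integrand of the random matrix model. -/
def rmtIntegrand (n N : ℕ) (ν : ℤ) (J : Matrix (Fin (n + n)) (Fin (n + n)) ℂ)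
    (a : RealMat N ν) : ℂ :=
  (gaussWeight a : ℂ) * pfaffian (pfBlock J a)

/-- `g_ν^RMT(J) = ∫ dA exp (-N tr (Aᵀ A)) Pf [[J† ⊗ 1_N, 1 ⊗ A], [1 ⊗ (-Aᵀ), J ⊗ 1_{N+ν}]]`. -/
def gRMT (n N : ℕ) (ν : ℤ) (J : Matrix (Fin (n + n)) (Fin (n + n)) ℂ) : ℂ :=
  ∫ a : RealMat N ν, rmtIntegrand n N ν J a

/-- `Z_ν^RMT(J_L, J_R) = g_ν^RMT(J_L†) g_ν^RMT(J_R)`. -/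
def zRMT (n N : ℕ) (ν : ℤ) (JL JR : Matrix (Fin (n + n)) (Fin (n + n)) ℂ) : ℂ :=
  gRMT n N ν JLᴴ * gRMT n N ν JR

/-- `z ^ ν` for `ν ≥ 0` and `(z*) ^ |ν|` for `ν < 0`. -/
def chiralPow (ν : ℤ) (z : ℂ) : ℂ :=
  if 0 ≤ ν then z ^ ν.natAbs else (starRingEnd ℂ z) ^ ν.natAbs

/-- `det (A Aᵀ + |z|²)` for `ν ≥ 0` and `det (Aᵀ A + |z|²)` for `ν < 0`. -/
def gramDet {N : ℕ} {ν : ℤ} (z : ℂ) (a : RealMat N ν) : ℂ :=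
  if 0 ≤ ν then (cMat a * (cMat a)ᵀ + ((‖z‖ ^ 2 : ℝ) : ℂ) • (1 : Matrix _ _ ℂ)).det
  else ((cMat a)ᵀ * cMat a + ((‖z‖ ^ 2 : ℝ) : ℂ) • (1 : Matrix _ _ ℂ)).det

/-- `∫ dA exp (-N tr (Aᵀ A)) ∏_f j_f ^ ν det (A Aᵀ + |j_f|²)` (with the obvious replacements
for `ν < 0`). -/
def gProduct (n N : ℕ) (ν : ℤ) (j : Fin n → ℂ) : ℂ :=
  ∫ a : RealMat N ν, (gaussWeight a : ℂ) * ∏ f : Fin n, (chiralPow ν (j f) * gramDet (j f) a)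

/-- The massive Dirac operator `[[M† ⊗ 1_N, i 1 ⊗ A], [i 1 ⊗ Aᵀ, M ⊗ 1_{N+ν}]]` of the chiral
random matrix model of two-colour QCD at `μ = 0`, for `n` flavours with mass matrix `M`. -/
def diracBlock {n N : ℕ} {ν : ℤ} (M : Matrix (Fin n) (Fin n) ℂ) (a : RealMat N ν) :
    Matrix ((Fin n × Fin N) ⊕ (Fin n × Fin (dimR N ν)))
      ((Fin n × Fin N) ⊕ (Fin n × Fin (dimR N ν))) ℂ :=
  Matrix.fromBlocks
    (Mᴴ ⊗ₖ (1 : Matrix (Fin N) (Fin N) ℂ))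
    (Complex.I • ((1 : Matrix (Fin n) (Fin n) ℂ) ⊗ₖ cMat a))
    (Complex.I • ((1 : Matrix (Fin n) (Fin n) ℂ) ⊗ₖ (cMat a)ᵀ))
    (M ⊗ₖ (1 : Matrix (Fin (dimR N ν)) (Fin (dimR N ν)) ℂ))

/-- The partition function of the `μ = 0` two-colour chiral random matrix model (real `A`) with
`n` massive flavours and no diquark source. -/
def zMassMuZero (n N : ℕ) (ν : ℤ) (M : Matrix (Fin n) (Fin n) ℂ) : ℂ :=
  ∫ a : RealMat N ν, (gaussWeight a : ℂ) * (diracBlock M a).det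

/-- The sign, independent of the source, that the order of rows produces in the Pfaffian. -/
def orderSign (n N : ℕ) (ν : ℤ) : ℂ :=
  (-1) ^ (n * N * (n * N + 1) / 2 + n * dimR N ν * (n * dimR N ν - 1) / 2)

/-! ### Singular values -/

/-- The square roots `ξ̂_k` of the eigenvalues of `Aᵀ A`. -/
def singVal {N : ℕ} {ν : ℤ} (a : RealMat N ν) : Fin (dimR N ν) → ℝ := fun k =>
  Real.sqrt ((Matrix.isHermitian_conjTranspose_mul_self (Matrix.of a)).eigenvalues k)

/-- The massless weight `exp (-N tr (Aᵀ A)) ∏' ξ̂_k ^ N_f`, zero modes being left out. -/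
def masslessWeight (n : ℕ) {N : ℕ} {ν : ℤ} (a : RealMat N ν) : ℝ :=
  gaussWeight a * ∏ k with singVal a k ≠ 0, singVal a k ^ (n + n)

/-- The average `⟨F⟩_ν` over `A` with the normalized massless weight. -/
def rmtAverage (n N : ℕ) (ν : ℤ) (F : RealMat N ν → ℝ) : ℝ :=
  (∫ a : RealMat N ν, masslessWeight n a * F a) / ∫ a : RealMat N ν, masslessWeight n a

/-- `∏' det^{1/2} (1 + J† J / ξ_k²)`, zero modes being left out, for the singular values in
physical units `ξ_k = √2 N ξ̂_k / (V₄ Φ)`. -/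
def sourceFactor {n N : ℕ} {ν : ℤ} (V₄ Φ : ℝ) (J : Matrix (Fin (n + n)) (Fin (n + n)) ℂ)
    (a : RealMat N ν) : ℝ :=
  ∏ k with singVal a k ≠ 0,
    Real.sqrt (1 + (((Real.sqrt 2 * N * singVal a k / (V₄ * Φ)) ^ 2 : ℝ) : ℂ)⁻¹ •
      (Jᴴ * J)).det.re

end ChiralRMT

end

/-!
The theorem rests on three pictures of one integral. For `ν < 0`, a power `z ^ ν` below stands for
`(z*) ^ |ν|`, as in `chiralPow`.

*Normal form.* A complex antisymmetric matrix is unitarily congruent to `[[0, j], [-j, 0]]` with `j`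
diagonal (`exists_unitary_normalForm`): a pair of unit vectors at which the modulus of the alternating
form is maximal splits off orthogonally, and induction does the rest. A unitary congruence of the
source is a congruence of the block matrix of the model, so that the transformation law
`Pf (B X Bᵀ) = det B · Pf X` (`pfaffian_congr`) produces a power of `det U`; for an off-diagonal source
the Pfaffian is the determinant of the Dirac operator up to the sign of a regrouping of rows
(`pfaffian_pfBlock_offDiag`), and for a diagonal mass matrix this determinant factorizes over flavours
(`pfaffian_pfBlock_normalForm`).

*Duality.* The Pfaffian is a Berezin integral over a Grassmann algebra (`pfaffian_eq_berezin`), whose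
even products are central and hence form a commutative setting for Wick's theorem
(`integral_gauss_linear_pow`). A Gaussian average depends only on the covariance of the linear form in
it. The four-fermion term that the average over `A` generates is also generated by an average over
complex antisymmetric matrices of the size `2 n` of the source, which does not grow with `N`
(`gRMT_eq_dual`). After a shift by the source the dual integrand is the power `N - max (0, -ν)` of the
fixed weight `peakWeight`, times a factor independent of `N` (`gRMT_eq_peak`). By the normal form and
the inequality `t exp (-2 t) ≤ exp (-1) / 2`, the weight is maximal exactly on the orbit of `I` under
`B ↦ U B Uᵀ` (`exists_congrMap_peakPoint`). Everything but the other factor is invariant under the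
unitary group, so this factor may be averaged over the group; its average is constant on the orbit,
where it is the group integral. Laplace's principle then needs no information on the normal
directions of the orbit (`tendsto_integral_pow_mul_div`, `tendsto_dual_ratio`) and gives
`tendsto_rmtScale_mul_gRMT`.

*Singular values.* Almost every `A` has full rank (`ae_gramPoly_ne_zero`), and then the integrand in
normal form is the massless weight times `Pf (X) ^ ν` and the source factor. Hence the model at finite
`N` is a constant times the power of the Pfaffian times the average over the massless ensemble
(`gRMT_eq_rmtAverage`), and only the behaviour of the constant `averageScale` remains to be found. The
source factor at `x X`, `0 ≤ x ≤ 1`, lies between `1` and the chord of a convex function of `x²`. This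
makes the constants a Cauchy sequence, because the rescaled model converges at each source `x I`
(`exists_tendsto_averageScale`). If their limit were zero, the group integral would vanish at zero
source to an order higher than `n |ν|`, the order of `Pf (X) ^ ν`; by polarization the character
`(det U) ^ ν` would be orthogonal to all monomials of degree `n |ν|` in the entries of `U I Uᵀ` and
their conjugates. A combination of these, the conjugate of `Pf (U I Uᵀ) ^ ν`, has the integral `± 1`
against `(det U) ^ ν` (`not_forall_gFin_isLittleO`).
-/

noncomputable section

namespace ChiralRMT

/-! ### Pfaffians -/

/-- A product over `Fin k`, `k` even, taken in consecutive pairs. -/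
lemma prod_pairs {k : ℕ} (hk : Even k) {R : Type*} [CommMonoid R] (g : Fin k → R) :
    ∏ i : Fin (k / 2), (g ⟨2 * (i : ℕ), by have := i.isLt; omega⟩ *
      g ⟨2 * (i : ℕ) + 1, by have := i.isLt; omega⟩) = ∏ j, g j := by
  have h2 : k / 2 * 2 = k := Nat.div_two_mul_two_of_even hk
  rw [← (finProdFinEquiv.trans (finCongr h2)).prod_comp g, Fintype.prod_prod_type]
  refine Finset.prod_congr rfl fun i _ => ?_
  rw [Fin.prod_univ_two]
  congr 2 <;> ext <;> simp [Nat.add_comm]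

/-- Multilinear expansion of the alternating sum that defines the Pfaffian of `B X Bᵀ`: for each
choice `f` of columns of `B`, the sum over permutations assembles a determinant. -/
lemma sum_perm_eq_sum_fun {k : ℕ} (hk : Even k) (B X : Matrix (Fin k) (Fin k) ℂ) :
    ∑ σ : Equiv.Perm (Fin k), ((Equiv.Perm.sign σ : ℤ) : ℂ) *
      ∏ i : Fin (k / 2),
        (B * X * Bᵀ) (σ ⟨2 * (i : ℕ), by have := i.isLt; omega⟩)
          (σ ⟨2 * (i : ℕ) + 1, by have := i.isLt; omega⟩) =
    ∑ f : Fin k → Fin k, (∏ i : Fin (k / 2), X (f ⟨2 * (i : ℕ), by have := i.isLt; omega⟩)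
          (f ⟨2 * (i : ℕ) + 1, by have := i.isLt; omega⟩)) * (B.submatrix id f).det := by
  have h2 : k / 2 * 2 = k := Nat.div_two_mul_two_of_even hk
  have key : ∀ σ : Equiv.Perm (Fin k), ∏ i : Fin (k / 2),
        (B * X * Bᵀ) (σ ⟨2 * (i : ℕ), by have := i.isLt; omega⟩)
          (σ ⟨2 * (i : ℕ) + 1, by have := i.isLt; omega⟩) =
      ∑ f : Fin k → Fin k, (∏ i : Fin (k / 2), X (f ⟨2 * (i : ℕ), by have := i.isLt; omega⟩)
          (f ⟨2 * (i : ℕ) + 1, by have := i.isLt; omega⟩)) * ∏ j, B (σ j) (f j) := by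
    intro σ
    have e1 : ∀ p q : Fin k, (B * X * Bᵀ) p q = ∑ r : Fin k × Fin k, B p r.1 * B q r.2 * X r.1 r.2 := by
      intro p q
      simp only [Matrix.mul_apply, Matrix.transpose_apply, Finset.sum_mul, Fintype.sum_prod_type]
      rw [Finset.sum_comm]
      refine Finset.sum_congr rfl fun _ _ => Finset.sum_congr rfl fun _ _ => by ring
    simp only [e1]
    rw [Finset.prod_univ_sum, Fintype.piFinset_univ]
    -- a choice of a pair of columns for every pair of rows is a choice of a column for every row
    let E : (Fin k → Fin k) ≃ (Fin (k / 2) → Fin k × Fin k) :=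
      (((finProdFinEquiv.trans (finCongr h2)).arrowCongr (Equiv.refl (Fin k))).symm.trans
        (Equiv.curry _ _ _)).trans
        ((Equiv.refl _).arrowCongr (finTwoArrowEquiv (Fin k)))
    refine (Fintype.sum_equiv E _ _ fun f => ?_).symm
    rw [← prod_pairs hk, ← Finset.prod_mul_distrib]
    refine Finset.prod_congr rfl fun i _ => ?_
    have a0 : (E f i).1 = f ⟨2 * (i : ℕ), by have := i.isLt; omega⟩ := by
      simp only [E, Equiv.trans_apply, Equiv.arrowCongr_apply, finTwoArrowEquiv,
        Function.comp, Equiv.arrowCongr_symm, Equiv.curry_apply]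
      simp
      congr 1
      ext
      simp
    have a1 : (E f i).2 = f ⟨2 * (i : ℕ) + 1, by have := i.isLt; omega⟩ := by
      simp only [E, Equiv.trans_apply, Equiv.arrowCongr_apply, finTwoArrowEquiv,
        Function.comp, Equiv.arrowCongr_symm, Equiv.curry_apply]
      simp
      congr 1
      ext
      simp [Nat.add_comm]
    rw [a0, a1]
    ring
  simp only [key, Finset.mul_sum]
  rw [Finset.sum_comm]
  refine Finset.sum_congr rfl fun f _ => ?_
  rw [Matrix.det_apply', Finset.mul_sum]
  refine Finset.sum_congr rfl fun σ _ => ?_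
  simp only [Matrix.submatrix_apply, id]
  ring

lemma det_submatrix_of_not_bijective {k : ℕ} (B : Matrix (Fin k) (Fin k) ℂ) {f : Fin k → Fin k}
    (hf : ¬ Function.Bijective f) : (B.submatrix id f).det = 0 := by
  have : ¬ Function.Injective f := fun h => hf (Finite.injective_iff_bijective.mp h)
  simp only [Function.Injective, not_forall] at this
  obtain ⟨a, b, hab, hne⟩ := this
  exact Matrix.det_zero_of_column_eq hne fun i => by simp [hab]

/-- Only bijective choices of columns contribute, as in the proof of the Cauchy–Binet formula. -/
lemma sum_fun_eq_sum_perm {k : ℕ} (B : Matrix (Fin k) (Fin k) ℂ) (g : (Fin k → Fin k) → ℂ) :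
    ∑ f : Fin k → Fin k, g f * (B.submatrix id f).det =
      B.det * ∑ σ : Equiv.Perm (Fin k), ((Equiv.Perm.sign σ : ℤ) : ℂ) * g σ := by
  rw [Finset.mul_sum]
  symm
  refine Finset.sum_of_injOn (fun σ : Equiv.Perm (Fin k) => (σ : Fin k → Fin k))
    (fun a _ b _ h => DFunLike.coe_injective h) (fun _ _ => by simp) (fun f _ hf => ?_)
    fun σ _ => ?_
  · rw [det_submatrix_of_not_bijective, mul_zero]
    intro hb
    exact hf ⟨Equiv.ofBijective f hb, by simp, rfl⟩
  · rw [Matrix.det_permute']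
    ring

/-- The transformation law of the Pfaffian under congruence, for an arbitrary square matrix `X`. -/
theorem pfaffian_congr {k : ℕ} (hk : Even k) (B X : Matrix (Fin k) (Fin k) ℂ) :
    pfaffian (B * X * Bᵀ) = B.det * pfaffian X := by
  unfold pfaffian
  rw [sum_perm_eq_sum_fun hk, sum_fun_eq_sum_perm]
  ring

lemma pfaffian_reindex_congr {k : ℕ} (hk : Even k) {ι : Type*} [Fintype ι] [DecidableEq ι]
    (e : ι ≃ Fin k) (B X : Matrix ι ι ℂ) :
    pfaffian (Matrix.reindex e e (B * X * Bᵀ)) = B.det * pfaffian (Matrix.reindex e e X) := by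
  rw [← Matrix.det_reindex_self e B, ← pfaffian_congr hk]
  congr 1
  simp [Matrix.reindex_apply, Matrix.submatrix_mul_equiv, Matrix.transpose_submatrix]

lemma pfaffian_smul {k : ℕ} (c : ℂ) (X : Matrix (Fin k) (Fin k) ℂ) :
    pfaffian (c • X) = c ^ (k / 2) * pfaffian X := by
  simp only [pfaffian, Matrix.smul_apply, smul_eq_mul, Finset.prod_mul_distrib, Finset.prod_const,
    Finset.card_univ, Fintype.card_fin]
  simp only [Finset.mul_sum]
  refine Finset.sum_congr rfl fun _ _ => by ring

lemma pfaffian_star {k : ℕ} (X : Matrix (Fin k) (Fin k) ℂ) :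
    pfaffian (X.map (starRingEnd ℂ)) = starRingEnd ℂ (pfaffian X) := by
  simp [pfaffian, map_sum, map_prod, Complex.conj_ofNat]

lemma pfaffian_perm {k : ℕ} (σ : Equiv.Perm (Fin k)) (X : Matrix (Fin k) (Fin k) ℂ) :
    pfaffian (Matrix.reindex σ σ X) = ((Equiv.Perm.sign σ : ℤ) : ℂ) * pfaffian X := by
  unfold pfaffian
  rw [mul_left_comm]
  congr 1
  rw [Finset.mul_sum]
  refine Fintype.sum_equiv (Equiv.mulLeft σ⁻¹) _ _ fun τ => ?_
  rw [← mul_assoc]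
  congr 1
  · simp only [Equiv.coe_mulLeft, Equiv.Perm.sign_mul, Equiv.Perm.sign_inv, Units.val_mul,
      Int.cast_mul, ← mul_assoc]
    have : ((Equiv.Perm.sign σ : ℤ) : ℂ) * ((Equiv.Perm.sign σ : ℤ) : ℂ) = 1 := by
      rw [← Int.cast_mul, ← Units.val_mul, Int.units_mul_self]; simp
    rw [this, one_mul]

lemma pfaffian_finCongr {k l : ℕ} (h : k = l) (X : Matrix (Fin k) (Fin k) ℂ) :
    pfaffian (Matrix.reindex (finCongr h) (finCongr h) X) = pfaffian X := by
  subst h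
  rfl

/-- The standard symplectic form on pairs, `Ω (i, 0) (i, 1) = 1 = - Ω (i, 1) (i, 0)`. -/
def pairForm (m : ℕ) : Matrix (Fin m × Fin 2) (Fin m × Fin 2) ℂ := fun x y =>
  if x.1 = y.1 then (if x.2 = y.2 then 0 else if x.2 = 0 then 1 else -1) else 0

/-- The permutation of pairs that permutes the pairs by `π` and then flips the pair `i` by `s i`. -/
def pairPerm {m : ℕ} (p : Equiv.Perm (Fin m) × (Fin m → Equiv.Perm (Fin 2))) :
    Equiv.Perm (Fin m × Fin 2) :=
  (Equiv.prodCongrLeft fun _ => p.1) * Equiv.prodCongrRight p.2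

lemma pairPerm_apply {m : ℕ} (p : Equiv.Perm (Fin m) × (Fin m → Equiv.Perm (Fin 2)))
    (i : Fin m) (b : Fin 2) : pairPerm p (i, b) = (p.1 i, p.2 i b) := rfl

lemma pairPerm_injective {m : ℕ} : Function.Injective (pairPerm (m := m)) := by
  rintro ⟨π, s⟩ ⟨π', s'⟩ h
  have h' : ∀ i b, (π i, s i b) = (π' i, s' i b) := fun i b => by
    simpa only [pairPerm_apply] using congrArg (fun σ => σ (i, b)) h
  have h1 : π = π' := Equiv.ext fun i => congrArg Prod.fst (h' i 0)
  have h2 : s = s' := funext fun i => Equiv.ext fun b => congrArg Prod.snd (h' i b)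
  rw [h1, h2]

lemma pairPerm_term {m : ℕ} (p : Equiv.Perm (Fin m) × (Fin m → Equiv.Perm (Fin 2))) :
    ((Equiv.Perm.sign (pairPerm p) : ℤ) : ℂ) *
      ∏ i, pairForm m (pairPerm p (i, 0)) (pairPerm p (i, 1)) = 1 := by
  have h1 : Equiv.Perm.sign (pairPerm p) = ∏ i, Equiv.Perm.sign (p.2 i) := by
    rw [pairPerm, Equiv.Perm.sign_mul, Equiv.Perm.sign_prodCongrLeft,
      Equiv.Perm.sign_prodCongrRight]
    simp
  have h2 : ∀ s : Equiv.Perm (Fin 2), ∀ i : Fin m,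
      ((Equiv.Perm.sign s : ℤ) : ℂ) * pairForm m (i, s 0) (i, s 1) = 1 := by
    intro s i
    have hs : s = 1 ∨ s = Equiv.swap 0 1 := by revert s; decide
    rcases hs with rfl | rfl
    · simp [pairForm]
    · simp [pairForm]
  rw [h1]
  push_cast
  rw [← Finset.prod_mul_distrib]
  refine Finset.prod_eq_one fun i _ => ?_
  simpa only [pairPerm_apply] using h2 (p.2 i) (p.1 i)

/-- The permutations that contribute to the Pfaffian of `pairForm` are those that permute the
pairs and flip some of them. -/
lemma exists_pairPerm {m : ℕ} (σ : Equiv.Perm (Fin m × Fin 2))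
    (h : ∀ i, pairForm m (σ (i, 0)) (σ (i, 1)) ≠ 0) : ∃ p, pairPerm p = σ := by
  have h1 : ∀ i, (σ (i, 1)).1 = (σ (i, 0)).1 := fun i => by
    by_contra hc
    exact h i (by simp [pairForm, Ne.symm hc])
  have h2 : ∀ i, (σ (i, 0)).2 ≠ (σ (i, 1)).2 := fun i hc => h i (by simp [pairForm, hc])
  have h1' : ∀ i b, (σ (i, b)).1 = (σ (i, 0)).1 := fun i b => by
    fin_cases b
    · rfl
    · exact h1 i
  have hs : ∀ i, Function.Bijective fun b => (σ (i, b)).2 := fun i =>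
    Finite.injective_iff_bijective.mp fun b c hbc => by
      have : σ (i, b) = σ (i, c) := Prod.ext (by rw [h1' i b, h1' i c]) hbc
      exact congrArg Prod.snd (σ.injective this)
  have hp : Function.Bijective fun i => (σ (i, 0)).1 :=
    Finite.injective_iff_bijective.mp fun i j hij => by
      obtain ⟨b, hb⟩ := (hs i).2 (σ (j, 0)).2
      have : σ (i, b) = σ (j, 0) := Prod.ext (by rw [h1' i b]; exact hij) hb
      exact congrArg Prod.fst (σ.injective this)
  refine ⟨(Equiv.ofBijective _ hp, fun i => Equiv.ofBijective _ (hs i)), Equiv.ext ?_⟩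
  rintro ⟨i, b⟩
  rw [pairPerm_apply]
  exact Prod.ext (h1' i b).symm rfl

lemma sum_pairForm (m : ℕ) : ∑ σ : Equiv.Perm (Fin m × Fin 2), ((Equiv.Perm.sign σ : ℤ) : ℂ) *
    ∏ i, pairForm m (σ (i, 0)) (σ (i, 1)) = 2 ^ m * (m ! : ℂ) := by
  rw [← Finset.sum_of_injOn (s := Finset.univ) pairPerm (pairPerm_injective.injOn)
    (fun _ _ => by simp) (fun σ _ hσ => ?_) (fun p _ => (pairPerm_term p).symm)]
  · simp [Fintype.card_perm, mul_comm]
  · rw [mul_eq_zero]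
    right
    by_contra hc
    obtain ⟨p, hp⟩ := exists_pairPerm σ fun i => Finset.prod_ne_zero_iff.mp hc i (by simp)
    exact hσ ⟨p, by simp, hp⟩

/-- The enumeration of pairs in which the members of a pair are neighbours. -/
def pairNear (m : ℕ) : Fin m × Fin 2 ≃ Fin (m + m) :=
  finProdFinEquiv.trans (finCongr (mul_two m))

/-- The enumeration of pairs in which all first members precede all second members. -/
def pairFar (m : ℕ) : Fin m × Fin 2 ≃ Fin (m + m) :=
  ((Equiv.prodComm _ _).trans finProdFinEquiv).trans (finCongr (two_mul m))

lemma pairNear_val {m : ℕ} (i : Fin m) (b : Fin 2) :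
    (pairNear m (i, b) : ℕ) = 2 * i + b := by
  simp [pairNear, add_comm]

lemma pairFar_val {m : ℕ} (i : Fin m) (b : Fin 2) :
    (pairFar m (i, b) : ℕ) = i + m * b := by
  simp [pairFar]

lemma pfaffian_pairNear (m : ℕ) :
    pfaffian (Matrix.reindex (pairNear m) (pairNear m) (pairForm m)) = 1 := by
  have hm : (m + m) / 2 = m := by omega
  have key : ∑ σ : Equiv.Perm (Fin (m + m)), ((Equiv.Perm.sign σ : ℤ) : ℂ) *
      ∏ i : Fin ((m + m) / 2), Matrix.reindex (pairNear m) (pairNear m) (pairForm m)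
        (σ ⟨2 * (i : ℕ), by have := i.isLt; omega⟩)
        (σ ⟨2 * (i : ℕ) + 1, by have := i.isLt; omega⟩) = 2 ^ m * (m ! : ℂ) := by
    rw [← sum_pairForm]
    refine Fintype.sum_equiv (pairNear m).symm.permCongr _ _ fun σ => ?_
    rw [Equiv.Perm.sign_permCongr]
    congr 1
    refine Fintype.prod_equiv (finCongr hm) _ _ fun i => ?_
    have a0 : pairNear m (finCongr hm i, 0) = ⟨2 * (i : ℕ), by have := i.isLt; omega⟩ :=
      Fin.ext (by rw [pairNear_val]; simp)
    have a1 : pairNear m (finCongr hm i, 1) = ⟨2 * (i : ℕ) + 1, by have := i.isLt; omega⟩ :=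
      Fin.ext (by rw [pairNear_val]; simp)
    rw [← a0, ← a1]
    simp [Equiv.permCongr_apply]
  rw [pfaffian, key, hm]
  have : (2 : ℂ) ^ m * (m ! : ℂ) ≠ 0 :=
    mul_ne_zero (pow_ne_zero _ two_ne_zero) (by exact_mod_cast Nat.factorial_ne_zero m)
  rw [one_div, inv_mul_cancel₀ this]

lemma offDiag_one (m : ℕ) :
    offDiag (1 : Matrix (Fin m) (Fin m) ℂ) =
      Matrix.reindex (pairFar m) (pairFar m) (pairForm m) := by
  have a0 : ∀ i : Fin m, pairFar m (i, 0) = finSumFinEquiv (Sum.inl i) := fun i =>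
    Fin.ext (by rw [pairFar_val]; simp)
  have a1 : ∀ i : Fin m, pairFar m (i, 1) = finSumFinEquiv (Sum.inr i) := fun i =>
    Fin.ext (by rw [pairFar_val]; simp [add_comm])
  ext p q
  obtain ⟨⟨i, b⟩, rfl⟩ := (pairFar m).surjective p
  obtain ⟨⟨j, c⟩, rfl⟩ := (pairFar m).surjective q
  rw [Matrix.reindex_apply, Matrix.submatrix_apply, Equiv.symm_apply_apply, Equiv.symm_apply_apply]
  have h2 : ∀ b : Fin 2, b = 0 ∨ b = 1 := by decide
  rcases h2 b with rfl | rfl <;> rcases h2 c with rfl | rfl <;>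
    simp only [a0, a1, offDiag, Matrix.reindex_apply, Matrix.submatrix_apply,
      Equiv.symm_apply_apply] <;>
    simp only [pairForm, Matrix.one_apply, Matrix.fromBlocks_apply₁₁, Matrix.fromBlocks_apply₁₂,
      Matrix.fromBlocks_apply₂₁, Matrix.fromBlocks_apply₂₂, Matrix.zero_apply, Matrix.neg_apply,
      Matrix.transpose_apply, eq_comm (a := j)] <;>
    split_ifs <;> simp_all

lemma prod_sign_card {k : ℕ} (σ : Equiv.Perm (Fin k)) (i : Fin k) :
    (∏ j ∈ Finset.Ioi i, if σ i < σ j then (1 : ℤˣ) else -1) =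
      (-1) ^ (Finset.univ.filter fun j => i < j ∧ σ j < σ i).card := by
  rw [Finset.prod_ite, Finset.prod_const_one, one_mul, Finset.prod_const]
  congr 2
  ext j
  simp only [Finset.mem_filter, Finset.mem_Ioi, not_lt, Finset.mem_univ, true_and]
  refine and_congr_right fun h => ⟨fun h' => lt_of_le_of_ne h' fun hc => ?_, le_of_lt⟩
  exact h.ne (σ.injective hc).symm

/-- The shuffle that separates first and second members has `m (m - 1) / 2` inversions. -/
lemma sign_pairing (m : ℕ) : Equiv.Perm.sign ((pairNear m).symm.trans (pairFar m)) =
    (-1) ^ (m * (m - 1) / 2) := by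
  rw [Equiv.Perm.sign_eq_prod_prod_Ioi]
  simp only [prod_sign_card]
  rw [Finset.prod_pow_eq_pow_sum]
  congr 1
  rw [← (pairNear m).sum_comp, Fintype.sum_prod_type]
  simp only [Fin.sum_univ_two, Equiv.trans_apply, Equiv.symm_apply_apply]
  -- a first member is not involved in any inversion as the left partner
  have h0 : ∀ i : Fin m, (Finset.univ.filter fun j => pairNear m (i, 0) < j ∧
      pairFar m ((pairNear m).symm j) < pairFar m (i, 0)).card = 0 := by
    intro i
    rw [Finset.card_eq_zero, Finset.filter_eq_empty_iff]
    intro j _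
    obtain ⟨⟨l, c⟩, rfl⟩ := (pairNear m).surjective j
    rw [Equiv.symm_apply_apply, Fin.lt_def, Fin.lt_def, pairNear_val, pairNear_val, pairFar_val,
      pairFar_val]
    rintro ⟨h1, h2⟩
    have := l.isLt
    have := i.isLt
    fin_cases c <;> simp at h1 h2 <;> omega
  -- the second member of the pair `i` is inverted with the first members of all later pairs
  have h1 : ∀ i : Fin m, (Finset.univ.filter fun j => pairNear m (i, 1) < j ∧
      pairFar m ((pairNear m).symm j) < pairFar m (i, 1)).card = m - 1 - i := by
    intro i
    have : (Finset.univ.filter fun j => pairNear m (i, 1) < j ∧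
      pairFar m ((pairNear m).symm j) < pairFar m (i, 1)) =
      (Finset.Ioi i).image fun l => pairNear m (l, 0) := by
      ext j
      obtain ⟨⟨l, c⟩, rfl⟩ := (pairNear m).surjective j
      simp only [Finset.mem_filter, Finset.mem_univ, true_and, Equiv.symm_apply_apply,
        Finset.mem_image, Finset.mem_Ioi, EmbeddingLike.apply_eq_iff_eq, Prod.mk.injEq]
      rw [Fin.lt_def, Fin.lt_def, pairNear_val, pairNear_val, pairFar_val, pairFar_val]
      have := l.isLt
      have := i.isLt
      have h2 : c = 0 ∨ c = 1 := by revert c; decide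
      rcases h2 with rfl | rfl
      · simp
        omega
      · simp
        omega
    rw [this, Finset.card_image_of_injective _ fun a b h => by simpa using h, Fin.card_Ioi]
  simp only [h0, h1, zero_add]
  rw [Fin.sum_univ_eq_sum_range (fun i => m - 1 - i) m, Finset.sum_range_reflect (fun i => i) m,
    Finset.sum_range_id]

/-- The sign `(-1) ^ (m (m - 1) / 2)` of the Pfaffian of `[[0, 1], [-1, 0]]`. -/
def stdSign (m : ℕ) : ℂ := (-1) ^ (m * (m - 1) / 2)

lemma pfaffian_offDiag_one (m : ℕ) :
    pfaffian (offDiag (1 : Matrix (Fin m) (Fin m) ℂ)) = stdSign m := by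
  have h : offDiag (1 : Matrix (Fin m) (Fin m) ℂ) =
      Matrix.reindex ((pairNear m).symm.trans (pairFar m)) ((pairNear m).symm.trans (pairFar m))
        (Matrix.reindex (pairNear m) (pairNear m) (pairForm m)) := by
    rw [offDiag_one]
    ext i j
    simp
  rw [h, pfaffian_perm, pfaffian_pairNear, sign_pairing, stdSign]
  simp

lemma offDiag_congr {m : ℕ} (B C K : Matrix (Fin m) (Fin m) ℂ) :
    offDiag (B * K * Cᵀ) =
      Matrix.reindex finSumFinEquiv finSumFinEquiv (Matrix.fromBlocks B 0 0 C) * offDiag K *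
        (Matrix.reindex finSumFinEquiv finSumFinEquiv (Matrix.fromBlocks B 0 0 C))ᵀ := by
  simp only [offDiag, Matrix.reindex_apply, Matrix.transpose_submatrix, Matrix.submatrix_mul_equiv,
    Matrix.fromBlocks_transpose, Matrix.fromBlocks_multiply]
  congr 1
  simp [Matrix.mul_assoc, Matrix.transpose_mul]

/-- The Pfaffian of `[[0, K], [-Kᵀ, 0]]`. -/
theorem pfaffian_offDiag {m : ℕ} (K : Matrix (Fin m) (Fin m) ℂ) :
    pfaffian (offDiag K) = stdSign m * K.det := by
  have h := offDiag_congr K 1 (1 : Matrix (Fin m) (Fin m) ℂ)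
  simp only [Matrix.mul_one, Matrix.transpose_one] at h
  rw [h, pfaffian_congr ⟨m, rfl⟩, pfaffian_offDiag_one, Matrix.det_reindex_self,
    Matrix.det_fromBlocks_zero₂₁]
  simp [mul_comm]

/-! ### The Pfaffian of the random matrix model as a determinant -/

/-- The enumeration of rows and columns used in `pfBlock`. -/
def blockEquiv (k N M : ℕ) : (Fin k × Fin N) ⊕ (Fin k × Fin M) ≃ Fin (k * N + k * M) :=
  (Equiv.sumCongr finProdFinEquiv finProdFinEquiv).trans finSumFinEquiv

/-- The matrix `pfBlock` before the enumeration of its rows and columns. -/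
def sourceBlock {k N M : ℕ} (J : Matrix (Fin k) (Fin k) ℂ) (A : Matrix (Fin N) (Fin M) ℂ) :
    Matrix ((Fin k × Fin N) ⊕ (Fin k × Fin M)) ((Fin k × Fin N) ⊕ (Fin k × Fin M)) ℂ :=
  Matrix.fromBlocks (Jᴴ ⊗ₖ 1) (1 ⊗ₖ A) (1 ⊗ₖ (-Aᵀ)) (J ⊗ₖ 1)

lemma pfBlock_eq {n N : ℕ} {ν : ℤ} (J : Matrix (Fin (n + n)) (Fin (n + n)) ℂ) (a : RealMat N ν) :
    pfBlock J a = Matrix.reindex (blockEquiv _ _ _) (blockEquiv _ _ _) (sourceBlock J (cMat a)) :=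
  rfl

/-- A unitary congruence of the source is a congruence of the whole block matrix, by the
entrywise conjugate `U*` on the first block and `U` on the second; `A` is left alone because
`U* Uᵀ = 1`. -/
lemma sourceBlock_congr {k N M : ℕ} {U : Matrix (Fin k) (Fin k) ℂ}
    (hU : U ∈ Matrix.unitaryGroup (Fin k) ℂ) (J : Matrix (Fin k) (Fin k) ℂ)
    (A : Matrix (Fin N) (Fin M) ℂ) :
    sourceBlock (U * J * Uᵀ) A =
      Matrix.fromBlocks (Uᴴᵀ ⊗ₖ (1 : Matrix (Fin N) (Fin N) ℂ)) 0 0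
        (U ⊗ₖ (1 : Matrix (Fin M) (Fin M) ℂ)) * sourceBlock J A *
      (Matrix.fromBlocks (Uᴴᵀ ⊗ₖ (1 : Matrix (Fin N) (Fin N) ℂ)) 0 0
        (U ⊗ₖ (1 : Matrix (Fin M) (Fin M) ℂ)))ᵀ := by
  have h1 : U * Uᴴ = 1 := Matrix.mem_unitaryGroup_iff.mp hU
  have h2 : Uᴴᵀ * Uᵀ = 1 := by rw [← Matrix.transpose_mul, h1, Matrix.transpose_one]
  have T : ∀ {m : ℕ} (X : Matrix (Fin k) (Fin k) ℂ),
      (X ⊗ₖ (1 : Matrix (Fin m) (Fin m) ℂ))ᵀ = Xᵀ ⊗ₖ (1 : Matrix (Fin m) (Fin m) ℂ) := fun X => by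
    rw [← Matrix.kroneckerMap_transpose, Matrix.transpose_one]
  simp only [sourceBlock, Matrix.fromBlocks_transpose, Matrix.fromBlocks_multiply,
    T, Matrix.transpose_transpose, Matrix.transpose_zero, Matrix.zero_mul, Matrix.mul_zero, add_zero, zero_add,
    ← Matrix.mul_kronecker_mul, Matrix.mul_one, Matrix.one_mul, h1, h2]
  congr 1
  congr 1
  rw [Matrix.conjTranspose_mul, Matrix.conjTranspose_mul, Matrix.mul_assoc]
  rfl

lemma conj_det_mul_det {k : ℕ} {U : Matrix (Fin k) (Fin k) ℂ} (hU : U ∈ Matrix.unitaryGroup (Fin k) ℂ) :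
    starRingEnd ℂ U.det * U.det = 1 := by
  have := congrArg Matrix.det (Matrix.mem_unitaryGroup_iff'.mp hU)
  rwa [Matrix.det_mul, Matrix.star_eq_conjTranspose, Matrix.det_conjTranspose,
    Matrix.det_one] at this

/-- The two exponents `N` and `N + ν` of `z*` and `z` combine to `|z|² ^ min (N, N + ν)` times
the chiral power. -/
lemma conj_pow_mul_pow {N : ℕ} {ν : ℤ} (h : 0 ≤ (N : ℤ) + ν) (z : ℂ) :
    (starRingEnd ℂ z) ^ N * z ^ dimR N ν =
      chiralPow ν z * (starRingEnd ℂ z * z) ^ (N - (-ν).toNat) := by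
  unfold chiralPow dimR
  split_ifs with hν
  · have h1 : ((N : ℤ) + ν).toNat = ν.natAbs + N := by omega
    have h2 : N - (-ν).toNat = N := by omega
    rw [h1, h2, pow_add, mul_pow]
    ring
  · have h1 : N = ν.natAbs + (N - (-ν).toNat) := by omega
    have h2 : ((N : ℤ) + ν).toNat = N - (-ν).toNat := by omega
    rw [h2]
    nth_rewrite 1 [h1]
    rw [pow_add, mul_pow]
    ring

lemma pfaffian_pfBlock_congr {n N : ℕ} {ν : ℤ} (h : 0 ≤ (N : ℤ) + ν)
    {U : Matrix (Fin (n + n)) (Fin (n + n)) ℂ} (hU : U ∈ Matrix.unitaryGroup (Fin (n + n)) ℂ)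
    (J : Matrix (Fin (n + n)) (Fin (n + n)) ℂ) (a : RealMat N ν) :
    pfaffian (pfBlock (U * J * Uᵀ) a) = chiralPow ν U.det * pfaffian (pfBlock J a) := by
  rw [pfBlock_eq, sourceBlock_congr hU, pfaffian_reindex_congr, ← pfBlock_eq]
  · congr 1
    rw [Matrix.det_fromBlocks_zero₂₁, Matrix.det_kronecker, Matrix.det_kronecker]
    simp only [Matrix.det_one, one_pow, mul_one, Fintype.card_fin, Matrix.det_transpose,
      Matrix.det_conjTranspose]
    have := conj_pow_mul_pow h U.det
    rw [conj_det_mul_det hU, one_pow, mul_one] at this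
    exact this
  · rw [← mul_add]
    exact (Even.add_self n).mul_right _

/-- The enumeration of `(Fin n × Fin N) ⊕ (Fin n × Fin M)`, doubled. -/
def doubleEquiv (n N M : ℕ) :
    ((Fin n × Fin N) ⊕ (Fin n × Fin M)) ⊕ ((Fin n × Fin N) ⊕ (Fin n × Fin M)) ≃
      Fin ((n + n) * N + (n + n) * M) :=
  (((blockEquiv n N M).sumCongr (blockEquiv n N M)).trans finSumFinEquiv).trans
    (finCongr (by ring))

/-- The regrouping of rows that brings `sourceBlock (offDiag M) A` to off-diagonal form. -/
def regroup (n N M : ℕ) : (Fin (n + n) × Fin N) ⊕ (Fin (n + n) × Fin M) ≃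
    ((Fin n × Fin N) ⊕ (Fin n × Fin M)) ⊕ ((Fin n × Fin N) ⊕ (Fin n × Fin M)) :=
  ((((finSumFinEquiv.symm.prodCongr (Equiv.refl _)).trans (Equiv.sumProdDistrib _ _ _)).trans
      (Equiv.sumComm _ _)).sumCongr
    ((finSumFinEquiv.symm.prodCongr (Equiv.refl _)).trans (Equiv.sumProdDistrib _ _ _))).trans
    (Equiv.sumSumSumComm _ _ _ _)

/-- The block `[[M†, A], [-Aᵀ, M]]`. -/
def cornerBlock {n N D : ℕ} (M : Matrix (Fin n) (Fin n) ℂ) (A : Matrix (Fin N) (Fin D) ℂ) :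
    Matrix ((Fin n × Fin N) ⊕ (Fin n × Fin D)) ((Fin n × Fin N) ⊕ (Fin n × Fin D)) ℂ :=
  Matrix.fromBlocks (Mᴴ ⊗ₖ 1) (1 ⊗ₖ A) (1 ⊗ₖ (-Aᵀ)) (M ⊗ₖ 1)

lemma reindex_sourceBlock {n N D : ℕ} (M : Matrix (Fin n) (Fin n) ℂ)
    (A : Matrix (Fin N) (Fin D) ℂ) :
    Matrix.reindex (regroup n N D) (regroup n N D) (sourceBlock (offDiag M) A) =
      Matrix.fromBlocks 0 (cornerBlock M A) (-(cornerBlock M A)ᵀ) 0 := by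
  apply (Matrix.reindex (regroup n N D) (regroup n N D)).symm.injective
  rw [Equiv.symm_apply_apply]
  ext p q
  rcases p with ⟨p, i⟩ | ⟨p, i⟩ <;> rcases q with ⟨q, j⟩ | ⟨q, j⟩ <;>
    obtain ⟨p | p, rfl⟩ := finSumFinEquiv.surjective p <;>
    obtain ⟨q | q, rfl⟩ := finSumFinEquiv.surjective q <;>
    simp [sourceBlock, cornerBlock, regroup, offDiag, Matrix.one_apply, -finSumFinEquiv_apply_left,
      -finSumFinEquiv_apply_right, Matrix.reindex_apply] <;>
    split_ifs <;> simp_all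

/-- The sign of the permutation that moves the first `a` elements past the following `c`. -/
lemma sign_blockSwap {K a c : ℕ} (hK : a + c ≤ K) (σ : Equiv.Perm (Fin K))
    (hσ : ∀ p, (σ p : ℕ) = if (p : ℕ) < a then (p : ℕ) + c else
      if (p : ℕ) < a + c then (p : ℕ) - a else p) :
    Equiv.Perm.sign σ = (-1) ^ (a * c) := by
  rw [Equiv.Perm.sign_eq_prod_prod_Ioi]
  simp only [prod_sign_card]
  rw [Finset.prod_pow_eq_pow_sum]
  congr 1
  -- each of the first `a` elements is inverted with all of the following `c`, and nothing else is
  have h : ∀ p : Fin K, (Finset.univ.filter fun q => p < q ∧ σ q < σ p).card =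
      if (p : ℕ) < a then c else 0 := by
    intro p
    split_ifs with hp
    · have : (Finset.univ.filter fun q => p < q ∧ σ q < σ p) =
          (Finset.univ : Finset (Fin c)).map
            ((Fin.natAddEmb a).trans (Fin.castLEEmb hK)) := by
        ext q
        simp only [Finset.mem_filter, Finset.mem_univ, true_and, Finset.mem_map]
        rw [Fin.lt_def, Fin.lt_def, hσ, hσ, if_pos hp]
        constructor
        · intro hq
          refine ⟨⟨q - a, ?_⟩, Fin.ext ?_⟩
          · split_ifs at hq <;> omega
          · simp
            split_ifs at hq <;> omega
        · rintro ⟨x, rfl⟩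
          have := x.isLt
          simp
          omega
      rw [this]
      simp
    · rw [Finset.card_eq_zero, Finset.filter_eq_empty_iff]
      intro q _
      rw [Fin.lt_def, Fin.lt_def, hσ, hσ, if_neg hp]
      rintro ⟨h1, h2⟩
      split_ifs at h2 <;> omega
  simp only [h]
  rw [Fin.sum_univ_eq_sum_range (fun p => if p < a then c else 0) K, ← Finset.sum_filter,
    Finset.sum_const, smul_eq_mul]
  congr 1
  have : (Finset.range K).filter (fun p => p < a) = Finset.range a := by
    ext x
    simp
    omega
  rw [this, Finset.card_range]

/-- In the linear order of the rows, `regroup` moves the first half of the first Kronecker block, of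
length `n N`, past its second half and the first half of the second block, of length `n N + n D`. -/
lemma sign_regroup (n N D : ℕ) :
    Equiv.Perm.sign ((blockEquiv (n + n) N D).symm.trans
      ((regroup n N D).trans (doubleEquiv n N D))) = (-1) ^ (n * N * (n * N + n * D)) := by
  apply sign_blockSwap
  · nlinarith
  intro p
  obtain ⟨p, rfl⟩ := (blockEquiv (n + n) N D).surjective p
  rw [Equiv.trans_apply, Equiv.symm_apply_apply]
  have hb : ∀ {m M : ℕ} (i : Fin m) (j : Fin M), (j : ℕ) + M * i < m * M := fun {m M} i j => by
    have := i.isLt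
    have := j.isLt
    calc (j : ℕ) + M * i < M * 1 + M * i := by omega
      _ = M * (1 + i) := by ring
      _ ≤ M * m := Nat.mul_le_mul_left _ (by omega)
      _ = m * M := mul_comm _ _
  rcases p with ⟨p, i⟩ | ⟨p, i⟩ <;>
    obtain ⟨p | p, rfl⟩ := finSumFinEquiv.surjective p <;>
    have h1 := hb p i <;>
    simp [regroup, doubleEquiv, blockEquiv, -finSumFinEquiv_apply_left,
      -finSumFinEquiv_apply_right] <;> simp [add_mul, mul_add, mul_comm N n, mul_comm D n] <;>
    split_ifs <;> omega

/-- The sign of the regrouping and the sign of the standard symplectic form combine to `orderSign`. -/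
lemma orderSign_eq (a b : ℕ) : ((-1 : ℂ) ^ (a * (a + b))) * stdSign (a + b) =
    (-1) ^ (a * (a + 1) / 2 + b * (b - 1) / 2) := by
  have key : ∀ b : ℕ, b * (b - 1) / 2 * 2 + b = b * b := fun b => by
    rw [Nat.div_mul_cancel (even_iff_two_dvd.mp (Nat.even_mul_pred_self b))]
    cases b
    · rfl
    · simp; ring
  have h0 : a * (a + 1) / 2 * 2 = a * (a + 1) :=
    Nat.div_mul_cancel (even_iff_two_dvd.mp (Nat.even_mul_succ_self a))
  have h1 := key (a + b)
  have h2 := key b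
  obtain ⟨t, ht⟩ := Nat.even_mul_succ_self a
  rw [stdSign, ← pow_add]
  have h5 : a * (a + b) + (a + b) * (a + b - 1) / 2 + 2 * a =
      (a * (a + 1) / 2 + b * (b - 1) / 2) + 2 * (t + a * b) := by
    nlinarith
  calc (-1 : ℂ) ^ (a * (a + b) + (a + b) * (a + b - 1) / 2)
      = (-1 : ℂ) ^ (a * (a + b) + (a + b) * (a + b - 1) / 2 + 2 * a) := by
        rw [pow_add _ _ (2 * a), pow_mul]; simp
    _ = _ := by rw [h5, pow_add _ _ (2 * (t + a * b)), pow_mul _ 2]; simp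

/-- The factors `i` of the Dirac operator are removed by a similarity transformation. -/
lemma det_cornerBlock {n N : ℕ} {ν : ℤ} (M : Matrix (Fin n) (Fin n) ℂ) (a : RealMat N ν) :
    (cornerBlock M (cMat a)).det = (diracBlock M a).det := by
  have h : diracBlock M a = Matrix.fromBlocks 1 0 0 ((-Complex.I) • 1) * cornerBlock M (cMat a) *
      Matrix.fromBlocks 1 0 0 (Complex.I • 1) := by
    simp only [diracBlock, cornerBlock, Matrix.fromBlocks_multiply]
    congr 1
    · simp
    · simp
    · ext ⟨i, j⟩ ⟨k, l⟩
      simp [Matrix.one_apply]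
    · simp [smul_smul]
  rw [h, Matrix.det_mul, Matrix.det_mul, Matrix.det_fromBlocks_zero₂₁, Matrix.det_fromBlocks_zero₂₁,
    Matrix.det_smul, Matrix.det_smul]
  simp only [Matrix.det_one, mul_one, one_mul]
  rw [mul_right_comm, ← mul_pow]
  simp

/-- The Pfaffian of the model for an off-diagonal source is the determinant of the massive Dirac
operator. -/
theorem pfaffian_pfBlock_offDiag {n N : ℕ} {ν : ℤ} (M : Matrix (Fin n) (Fin n) ℂ)
    (a : RealMat N ν) :
    pfaffian (pfBlock (offDiag M) a) = orderSign n N ν * (diracBlock M a).det := by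
  set d := doubleEquiv n N (dimR N ν)
  set r := regroup n N (dimR N ν)
  set σ := (blockEquiv (n + n) N (dimR N ν)).symm.trans (r.trans d) with hσ
  -- after the permutation `σ` of its rows and columns the matrix is `offDiag (cornerBlock M A)`
  have h1 : Matrix.reindex σ σ (pfBlock (offDiag M) a) =
      Matrix.reindex d d (Matrix.reindex r r (sourceBlock (offDiag M) (cMat a))) := by
    rw [pfBlock_eq]
    ext i j
    simp [hσ]
  have h2 : Matrix.reindex d d (Matrix.fromBlocks 0 (cornerBlock M (cMat a))
      (-(cornerBlock M (cMat a))ᵀ) 0) =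
      Matrix.reindex (finCongr (by ring)) (finCongr (by ring))
        (offDiag (Matrix.reindex (blockEquiv n N _) (blockEquiv n N _)
          (cornerBlock M (cMat a)))) := by
    apply (Matrix.reindex d d).symm.injective
    rw [Equiv.symm_apply_apply]
    ext p q
    rcases p with p | p <;> rcases q with q | q <;>
      simp [d, doubleEquiv, offDiag, Matrix.reindex_apply, -finSumFinEquiv_apply_left,
        -finSumFinEquiv_apply_right]
  have h3 := pfaffian_perm σ (pfBlock (offDiag M) a)
  rw [h1, reindex_sourceBlock, h2, pfaffian_finCongr, pfaffian_offDiag, Matrix.det_reindex_self,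
    det_cornerBlock, sign_regroup] at h3
  have h4 : ((-1 : ℂ) ^ (n * N * (n * N + n * dimR N ν))) * (-1) ^ (n * N * (n * N + n * dimR N ν)) = 1 := by
    rw [← mul_pow]; simp
  rw [orderSign, ← orderSign_eq, mul_assoc, h3]
  push_cast
  rw [← mul_assoc, h4, one_mul]

/-! ### The Dirac determinant for a diagonal mass matrix -/

/-- The Dirac operator of a single flavour of mass `z`. -/
def flavourBlock {N D : ℕ} (z : ℂ) (A : Matrix (Fin N) (Fin D) ℂ) :
    Matrix (Fin N ⊕ Fin D) (Fin N ⊕ Fin D) ℂ :=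
  Matrix.fromBlocks (starRingEnd ℂ z • 1) (Complex.I • A) (Complex.I • Aᵀ) (z • 1)

lemma det_diracBlock_diagonal {n N : ℕ} {ν : ℤ} (j : Fin n → ℂ) (a : RealMat N ν) :
    (diracBlock (Matrix.diagonal j) a).det = ∏ f, (flavourBlock (j f) (cMat a)).det := by
  rw [← Matrix.det_blockDiagonal, ← Matrix.det_reindex_self
    ((Equiv.prodSumDistrib (Fin n) (Fin N) (Fin (dimR N ν))).symm.trans (Equiv.prodComm _ _))]
  congr 1
  ext ⟨p, i⟩ ⟨q, k⟩
  rcases p with p | p <;> rcases q with q | q <;>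
    simp [diracBlock, flavourBlock, Matrix.blockDiagonal_apply, Matrix.diagonal_apply,
      Matrix.one_apply, Equiv.prodSumDistrib] <;> split_ifs <;> simp_all

/-- The Schur complement formula for one flavour, away from zero mass. -/
lemma det_flavourBlock_of_ne {N : ℕ} {ν : ℤ} (h : 0 ≤ (N : ℤ) + ν) {z : ℂ} (hz : z ≠ 0)
    (a : RealMat N ν) :
    (flavourBlock z (cMat a)).det = chiralPow ν z * gramDet z a := by
  have hz' : starRingEnd ℂ z ≠ 0 := by simpa using hz
  have hn : ((‖z‖ ^ 2 : ℝ) : ℂ) = starRingEnd ℂ z * z := by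
    rw [← Complex.normSq_eq_norm_sq, ← Complex.normSq_eq_conj_mul_self]
  have hI : ∀ {p q : ℕ} (A : Matrix (Fin p) (Fin q) ℂ) (c : ℂ), (Complex.I • A) * (c • (1 : Matrix (Fin q) (Fin q) ℂ)) *
      (Complex.I • Aᵀ) = (-c) • (A * Aᵀ) := fun A c => by
    simp only [Matrix.mul_smul, Matrix.smul_mul, Matrix.mul_one, smul_smul]
    congr 1
    linear_combination c * Complex.I_mul_I
  unfold chiralPow gramDet flavourBlock
  split_ifs with hν
  -- for `ν ≥ 0` the larger block `z • 1` is eliminated, which leaves `z ^ ν`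
  · have hinv : Invertible (z • (1 : Matrix (Fin (dimR N ν)) (Fin (dimR N ν)) ℂ)) :=
      ⟨z⁻¹ • 1, by simp [smul_smul, hz], by simp [smul_smul, hz]⟩
    rw [Matrix.det_fromBlocks₂₂]
    have e1 : ⅟(z • (1 : Matrix (Fin (dimR N ν)) (Fin (dimR N ν)) ℂ)) = z⁻¹ • 1 :=
      invOf_eq_right_inv (by simp [smul_smul, hz])
    rw [e1, hI]
    have e2 : starRingEnd ℂ z • (1 : Matrix (Fin N) (Fin N) ℂ) - (-z⁻¹) • (cMat a * (cMat a)ᵀ) =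
        z⁻¹ • (cMat a * (cMat a)ᵀ + ((‖z‖ ^ 2 : ℝ) : ℂ) • 1) := by
      rw [hn, smul_add, smul_smul]
      have : z⁻¹ * (starRingEnd ℂ z * z) = starRingEnd ℂ z := by field_simp
      rw [this, neg_smul, sub_neg_eq_add, add_comm]
    rw [e2, Matrix.det_smul, Matrix.det_smul, Matrix.det_one, mul_one, Fintype.card_fin,
      Fintype.card_fin, ← mul_assoc]
    congr 1
    have h1 : dimR N ν = ν.natAbs + N := by unfold dimR; omega
    rw [h1, pow_add, mul_assoc, ← mul_pow, mul_inv_cancel₀ hz, one_pow, mul_one]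
  -- for `ν < 0` the larger block is `z* • 1`
  · have hinv : Invertible (starRingEnd ℂ z • (1 : Matrix (Fin N) (Fin N) ℂ)) :=
      ⟨(starRingEnd ℂ z)⁻¹ • 1, by simp [smul_smul, hz], by simp [smul_smul, hz]⟩
    rw [Matrix.det_fromBlocks₁₁]
    have e1 : ⅟(starRingEnd ℂ z • (1 : Matrix (Fin N) (Fin N) ℂ)) = (starRingEnd ℂ z)⁻¹ • 1 :=
      invOf_eq_right_inv (by simp [smul_smul, hz])
    have hI' := hI (cMat a)ᵀ (starRingEnd ℂ z)⁻¹
    rw [Matrix.transpose_transpose] at hI'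
    rw [e1, hI']
    have e2 : z • (1 : Matrix (Fin (dimR N ν)) (Fin (dimR N ν)) ℂ) -
        (-(starRingEnd ℂ z)⁻¹) • ((cMat a)ᵀ * cMat a) =
        (starRingEnd ℂ z)⁻¹ • ((cMat a)ᵀ * cMat a + ((‖z‖ ^ 2 : ℝ) : ℂ) • 1) := by
      rw [hn, smul_add, smul_smul]
      have : (starRingEnd ℂ z)⁻¹ * (starRingEnd ℂ z * z) = z := by field_simp
      rw [this, neg_smul, sub_neg_eq_add, add_comm]
    rw [e2, Matrix.det_smul, Matrix.det_smul, Matrix.det_one, mul_one, Fintype.card_fin,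
      Fintype.card_fin, ← mul_assoc]
    congr 1
    have h1 : N = ν.natAbs + dimR N ν := by unfold dimR; omega
    nth_rewrite 1 [h1]
    rw [pow_add, mul_assoc, ← mul_pow, mul_inv_cancel₀ hz', one_pow, mul_one]

lemma continuous_chiralPow (ν : ℤ) : Continuous (chiralPow ν) := by
  unfold chiralPow
  split_ifs
  · fun_prop
  · exact Complex.continuous_conj.pow _

/-- The Schur complement formula extends to zero mass by continuity. -/
lemma det_flavourBlock {N : ℕ} {ν : ℤ} (h : 0 ≤ (N : ℤ) + ν) (z : ℂ) (a : RealMat N ν) :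
    (flavourBlock z (cMat a)).det = chiralPow ν z * gramDet z a := by
  have h1 : Continuous fun z : ℂ => (flavourBlock z (cMat a)).det := by
    have : Continuous fun z : ℂ => starRingEnd ℂ z := Complex.continuous_conj
    unfold flavourBlock
    refine Continuous.matrix_det (Continuous.matrix_fromBlocks ?_ ?_ ?_ ?_) <;> fun_prop
  have h2 : Continuous fun z : ℂ => chiralPow ν z * gramDet z a := by
    refine (continuous_chiralPow ν).mul ?_
    unfold gramDet
    split_ifs
    · refine Continuous.matrix_det ?_
      fun_prop
    · refine Continuous.matrix_det ?_
      fun_prop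
  refine congrFun (Continuous.ext_on (dense_compl_singleton (0 : ℂ)) h1 h2 ?_) z
  intro z hz
  exact det_flavourBlock_of_ne h hz a

/-- The pointwise form of the model in terms of the normal form of the source. -/
theorem pfaffian_pfBlock_normalForm {n N : ℕ} {ν : ℤ} (h : 0 ≤ (N : ℤ) + ν)
    {U : Matrix (Fin (n + n)) (Fin (n + n)) ℂ} (hU : U ∈ Matrix.unitaryGroup (Fin (n + n)) ℂ)
    (j : Fin n → ℂ) (a : RealMat N ν) :
    pfaffian (pfBlock (U * offDiag (Matrix.diagonal j) * Uᵀ) a) =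
      orderSign n N ν * chiralPow ν U.det * ∏ f, (chiralPow ν (j f) * gramDet (j f) a) := by
  rw [pfaffian_pfBlock_congr h hU, pfaffian_pfBlock_offDiag, det_diracBlock_diagonal]
  simp only [det_flavourBlock h]
  ring

/-! ### The normal form of an antisymmetric matrix -/

/-- A linear functional whose modulus on the unit sphere is maximal at `f` vanishes on the orthogonal
complement of `f`. -/
lemma apply_eq_zero_of_isMax {E : Type*} [NormedAddCommGroup E] [InnerProductSpace ℂ E]
    [FiniteDimensional ℂ E] (g : E →ₗ[ℂ] ℂ) {f : E} (hf : ‖f‖ = 1)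
    (hmax : ∀ y : E, ‖y‖ = 1 → ‖g y‖ ≤ ‖g f‖) {z : E} (hz : inner ℂ f z = 0) : g z = 0 := by
  obtain ⟨r, hr⟩ : ∃ r : E, ∀ y, g y = inner ℂ r y :=
    ⟨(InnerProductSpace.toDual ℂ E).symm (LinearMap.toContinuousLinearMap g), fun y => by
      rw [InnerProductSpace.toDual_symm_apply]; rfl⟩
  by_cases hr0 : r = 0
  · rw [hr, hr0, inner_zero_left]
  have hrn : ‖r‖ ≠ 0 := norm_ne_zero_iff.mpr hr0
  have h1 : ‖r‖ ≤ ‖inner ℂ r f‖ := by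
    have h := hmax (((‖r‖⁻¹ : ℝ) : ℂ) • r) (by
      rw [norm_smul, Complex.norm_real, norm_inv, norm_norm, inv_mul_cancel₀ hrn])
    rw [hr, hr, inner_smul_right, inner_self_eq_norm_sq_to_K] at h
    have : ‖((‖r‖⁻¹ : ℝ) : ℂ) * ((‖r‖ : ℝ) : ℂ) ^ 2‖ = ‖r‖ := by
      rw [← Complex.ofReal_pow, ← Complex.ofReal_mul, Complex.norm_real]
      rw [pow_two, ← mul_assoc, inv_mul_cancel₀ hrn, one_mul, norm_norm]
    exact this.symm.le.trans h
  have h2 : ‖inner ℂ r f‖ = ‖r‖ * ‖f‖ :=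
    le_antisymm (norm_inner_le_norm r f) (by rw [hf, mul_one]; exact h1)
  have hf0 : f ≠ 0 := fun h => by simp [h] at hf
  obtain ⟨c, hc, hfr⟩ := (norm_inner_eq_norm_iff hr0 hf0).mp h2
  rw [hfr, inner_smul_left] at hz
  rw [hr]
  exact (mul_eq_zero.mp hz).resolve_left (by simpa using hc)

/-- Two orthonormal vectors whose orthogonal complement is also orthogonal to them for the alternating
form: a pair of unit vectors at which the modulus of the form is maximal. -/
lemma exists_hyperbolic_pair {E : Type*} [NormedAddCommGroup E] [InnerProductSpace ℂ E]
    [FiniteDimensional ℂ E] (b : E →ₗ[ℂ] E →ₗ[ℂ] ℂ) (hb : ∀ x, b x x = 0)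
    (hE : 2 ≤ Module.finrank ℂ E) :
    ∃ e f : E, ‖e‖ = 1 ∧ ‖f‖ = 1 ∧ inner ℂ e f = 0 ∧
      ∀ z, inner ℂ e z = 0 → inner ℂ f z = 0 → b e z = 0 ∧ b f z = 0 := by
  have hsym : ∀ x y, b x y = - b y x := fun x y => by
    have := hb (x + y)
    simp only [map_add, LinearMap.add_apply, hb, zero_add, add_zero] at this
    exact eq_neg_of_add_eq_zero_right this
  by_cases h0 : ∀ x y, b x y = 0
  · let B := stdOrthonormalBasis ℂ E
    refine ⟨B ⟨0, by omega⟩, B ⟨1, by omega⟩, B.orthonormal.1 _, B.orthonormal.1 _,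
      B.orthonormal.2 (by simp), fun z _ _ => ⟨h0 _ _, h0 _ _⟩⟩
  · push Not at h0
    obtain ⟨x₀, y₀, h0⟩ := h0
    have : ProperSpace E := FiniteDimensional.proper ℂ E
    have hx0 : x₀ ≠ 0 := fun h => h0 (by simp [h])
    have hy0 : y₀ ≠ 0 := fun h => h0 (by simp [h])
    have unit : ∀ x : E, x ≠ 0 → ‖((‖x‖⁻¹ : ℝ) : ℂ) • x‖ = 1 := fun x hx => by
      rw [norm_smul, Complex.norm_real, norm_inv, norm_norm,
        inv_mul_cancel₀ (norm_ne_zero_iff.mpr hx)]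
    have hcont : Continuous fun p : E × E => ‖b p.1 p.2‖ := by
      have h1 : Continuous fun x : E => LinearMap.toContinuousLinearMap (b x) :=
        LinearMap.continuous_of_finiteDimensional
          ((LinearMap.toContinuousLinearMap (𝕜 := ℂ) (E := E) (F' := ℂ)).toLinearMap ∘ₗ b)
      exact ((h1.comp continuous_fst).clm_apply continuous_snd).norm
    obtain ⟨⟨e, f⟩, ⟨he, hf⟩, hmax⟩ :=
      ((isCompact_sphere (0 : E) 1).prod (isCompact_sphere (0 : E) 1)).exists_isMaxOn
        ⟨(((‖x₀‖⁻¹ : ℝ) : ℂ) • x₀, ((‖y₀‖⁻¹ : ℝ) : ℂ) • y₀),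
          by simp only [Set.mem_prod, mem_sphere_zero_iff_norm]; exact ⟨unit _ hx0, unit _ hy0⟩⟩
        hcont.continuousOn
    simp only [mem_sphere_zero_iff_norm] at he hf
    have hmax' : ∀ x y : E, ‖x‖ = 1 → ‖y‖ = 1 → ‖b x y‖ ≤ ‖b e f‖ := fun x y hx hy =>
      hmax (show (x, y) ∈ _ by simp [hx, hy])
    have hpos : b e f ≠ 0 := by
      have h1 := hmax' _ _ (unit _ hx0) (unit _ hy0)
      intro hc
      rw [hc, norm_zero] at h1
      have h2 := norm_le_zero_iff.mp h1
      simp only [map_smul, LinearMap.smul_apply, smul_eq_mul, mul_eq_zero] at h2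
      simp [hx0, hy0, h0] at h2
    have hA : ∀ z, inner ℂ f z = 0 → b e z = 0 := fun z hz =>
      apply_eq_zero_of_isMax (b e) hf (fun y hy => hmax' e y he hy) hz
    have hB : ∀ z, inner ℂ e z = 0 → b f z = 0 := fun z hz =>
      apply_eq_zero_of_isMax (b f) he (fun y hy => by
        rw [hsym f y, hsym f e, norm_neg, norm_neg]
        exact hmax' y f hy hf) hz
    -- `b e` vanishes at `e` and at the component of `e` orthogonal to `f`, hence also at the component
    -- along `f`
    have hef : inner ℂ f e = 0 := by
      have h1 := hA (e - (inner ℂ f e : ℂ) • f) (by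
        rw [inner_sub_right, inner_smul_right, inner_self_eq_norm_sq_to_K, hf]; simp)
      rw [map_sub, hb, map_smul, zero_sub, neg_eq_zero, smul_eq_mul] at h1
      exact (mul_eq_zero.mp h1).resolve_right hpos
    exact ⟨e, f, he, hf, inner_eq_zero_symm.mp hef, fun z h1 h2 => ⟨hA z h2, hB z h1⟩⟩

/-- An alternating form on a Hermitian space of dimension `2 m` has an orthonormal basis of `m`
mutually orthogonal pairs. -/
theorem exists_orthonormal_normalForm (m : ℕ) : ∀ (E : Type) [NormedAddCommGroup E]
    [InnerProductSpace ℂ E] [FiniteDimensional ℂ E] (b : E →ₗ[ℂ] E →ₗ[ℂ] ℂ),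
    (∀ x, b x x = 0) → Module.finrank ℂ E = m + m →
    ∃ (u w : Fin m → E) (j : Fin m → ℂ), Orthonormal ℂ (Sum.elim u w) ∧
      (∀ p q, b (u p) (u q) = 0) ∧ (∀ p q, b (w p) (w q) = 0) ∧
      ∀ p q, b (u p) (w q) = if p = q then j p else 0 := by
  induction m with
  | zero =>
    intro E _ _ _ b _ _
    refine ⟨Fin.elim0, Fin.elim0, Fin.elim0, ⟨fun i => ?_, fun i => ?_⟩, fun p => p.elim0,
      fun p => p.elim0, fun p => p.elim0⟩ <;> rcases i with i | i <;> exact i.elim0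
  | succ m ih =>
    intro E _ _ _ b hb hE
    have hsym : ∀ x y, b x y = - b y x := fun x y => by
      have := hb (x + y)
      simp only [map_add, LinearMap.add_apply, hb, zero_add, add_zero] at this
      exact eq_neg_of_add_eq_zero_right this
    obtain ⟨e, f, he, hf, hef, hz⟩ := exists_hyperbolic_pair b hb (by omega)
    -- the induction hypothesis is applied to the orthogonal complement of the pair
    let F : Submodule ℂ E := (Submodule.span ℂ (Set.range ![e, f]))ᗮ
    have hli : LinearIndependent ℂ ![e, f] := by
      have : Orthonormal ℂ ![e, f] := by
        constructor
        · intro i; fin_cases i <;> simp [he, hf]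
        · intro i k hik
          fin_cases i <;> fin_cases k
          · exact absurd rfl hik
          · exact hef
          · exact inner_eq_zero_symm.mp hef
          · exact absurd rfl hik
      exact this.linearIndependent
    have hF : Module.finrank ℂ F = m + m := by
      have h1 := Submodule.finrank_add_finrank_orthogonal (Submodule.span ℂ (Set.range ![e, f]))
      rw [finrank_span_eq_card hli, hE, Fintype.card_fin] at h1
      show Module.finrank ℂ (Submodule.span ℂ (Set.range ![e, f]))ᗮ = _
      omega
    have hmem : ∀ x : F, inner ℂ e (x : E) = 0 ∧ inner ℂ f (x : E) = 0 := fun x =>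
      ⟨(Submodule.mem_orthogonal _ _).mp x.2 e (Submodule.subset_span ⟨0, rfl⟩),
        (Submodule.mem_orthogonal _ _).mp x.2 f (Submodule.subset_span ⟨1, rfl⟩)⟩
    obtain ⟨u, w, j, ho, huu, hww, huw⟩ := ih F (b.compl₁₂ F.subtype F.subtype)
      (fun x => hb x) hF
    simp only [LinearMap.compl₁₂_apply, Submodule.subtype_apply] at huu hww huw
    rw [orthonormal_iff_ite] at ho
    have hbe : ∀ x : F, b e x = 0 := fun x => (hz x (hmem x).1 (hmem x).2).1
    have hbf : ∀ x : F, b f x = 0 := fun x => (hz x (hmem x).1 (hmem x).2).2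
    have hbe' : ∀ x : F, b x e = 0 := fun x => by rw [hsym, hbe, neg_zero]
    have hbf' : ∀ x : F, b x f = 0 := fun x => by rw [hsym, hbf, neg_zero]
    have hfe : inner ℂ f e = (0 : ℂ) := inner_eq_zero_symm.mp hef
    have hl : ∀ x : F, inner ℂ (x : E) e = 0 ∧ inner ℂ (x : E) f = 0 := fun x =>
      ⟨inner_eq_zero_symm.mp (hmem x).1, inner_eq_zero_symm.mp (hmem x).2⟩
    have h11 := fun p q => ho (Sum.inl p) (Sum.inl q)
    have h12 := fun p q => ho (Sum.inl p) (Sum.inr q)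
    have h21 := fun p q => ho (Sum.inr p) (Sum.inl q)
    have h22 := fun p q => ho (Sum.inr p) (Sum.inr q)
    simp only [Sum.elim_inl, Sum.elim_inr, Submodule.coe_inner, Sum.inl.injEq, Sum.inr.injEq,
      reduceCtorEq, if_false] at h11 h12 h21 h22
    refine ⟨Fin.cons e fun i => u i, Fin.cons f fun i => w i, Fin.cons (b e f) j, ?_, ?_, ?_, ?_⟩
    · rw [orthonormal_iff_ite]
      intro p q
      rcases p with p | p <;> rcases q with q | q <;> refine Fin.cases ?_ (fun p => ?_) p <;>
        refine Fin.cases ?_ (fun q => ?_) q <;>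
        simp [he, hf, hef, hfe, hmem, hl, h11, h12, h21, h22, Fin.succ_ne_zero,
          (Fin.succ_ne_zero _).symm]
    · intro p q
      refine Fin.cases ?_ (fun p => ?_) p <;> refine Fin.cases ?_ (fun q => ?_) q <;>
        simp [hb, hbe, hbe', huu]
    · intro p q
      refine Fin.cases ?_ (fun p => ?_) p <;> refine Fin.cases ?_ (fun q => ?_) q <;>
        simp [hb, hbf, hbf', hww]
    · intro p q
      refine Fin.cases ?_ (fun p => ?_) p <;> refine Fin.cases ?_ (fun q => ?_) q <;>
        simp [hbe, hbf', huw, Fin.succ_ne_zero, (Fin.succ_ne_zero _).symm]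

/-- Every complex antisymmetric matrix is unitarily congruent to `[[0, j], [-j, 0]]`, `j` diagonal. -/
theorem exists_unitary_normalForm {n : ℕ} {J : Matrix (Fin (n + n)) (Fin (n + n)) ℂ}
    (hJ : IsAntisymm J) : ∃ U ∈ Matrix.unitaryGroup (Fin (n + n)) ℂ, ∃ j : Fin n → ℂ,
      J = U * offDiag (Matrix.diagonal j) * Uᵀ := by
  let L : EuclideanSpace ℂ (Fin (n + n)) →ₗ[ℂ] (Fin (n + n) → ℂ) :=
    (WithLp.linearEquiv 2 ℂ (Fin (n + n) → ℂ)).toLinearMap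
  have hb0 : ∀ x y : Fin (n + n) → ℂ, Matrix.toLinearMap₂' ℂ J x y = x ⬝ᵥ J *ᵥ y := fun x y =>
    Matrix.toLinearMap₂'_apply' J x y
  obtain ⟨u, w, j, ho, huu, hww, huw⟩ := exists_orthonormal_normalForm n
    (EuclideanSpace ℂ (Fin (n + n))) ((Matrix.toLinearMap₂' ℂ J).compl₁₂ L L) (fun x => by
      rw [LinearMap.compl₁₂_apply, hb0]
      have h1 : L x ⬝ᵥ J *ᵥ L x = - (L x ⬝ᵥ J *ᵥ L x) := by
        nth_rewrite 1 [Matrix.dotProduct_mulVec, ← Matrix.mulVec_transpose, hJ, Matrix.neg_mulVec,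
          neg_dotProduct, dotProduct_comm]
        rfl
      exact self_eq_neg.mp h1) (by simp)
  simp only [LinearMap.compl₁₂_apply, hb0] at huu hww huw
  have hwu : ∀ p q, L (w p) ⬝ᵥ J *ᵥ L (u q) = - if q = p then j q else 0 := fun p q => by
    rw [← huw, Matrix.dotProduct_mulVec, ← Matrix.mulVec_transpose, hJ, Matrix.neg_mulVec,
      neg_dotProduct, dotProduct_comm]
  -- the columns of `W` are the normal form basis, so that `Wᵀ J W` is in normal form and `U = W*`
  let W : Matrix (Fin (n + n)) (Fin (n + n)) ℂ :=
    Matrix.of fun p q => Sum.elim u w (finSumFinEquiv.symm q) p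
  have hcol : ∀ q, (fun p => W p q) = L (Sum.elim u w (finSumFinEquiv.symm q)) := fun q => rfl
  have hWJ : Wᵀ * J * W = offDiag (Matrix.diagonal j) := by
    ext p q
    have h1 : (Wᵀ * J * W) p q = (fun i => W i p) ⬝ᵥ J *ᵥ (fun i => W i q) := by
      rw [Matrix.dotProduct_mulVec]
      simp only [Matrix.mul_apply, dotProduct, Matrix.vecMul, Matrix.transpose_apply]
    rw [h1, hcol, hcol, offDiag, Matrix.reindex_apply, Matrix.submatrix_apply]
    rcases finSumFinEquiv.symm p with p | p <;> rcases finSumFinEquiv.symm q with q | q <;>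
      simp [huu, hww, huw, hwu, Matrix.diagonal_apply]
    rcases eq_or_ne p q with rfl | h
    · simp
    · simp [h, h.symm]
  have hWW : Wᴴ * W = 1 := by
    rw [orthonormal_iff_ite] at ho
    ext p q
    have h1 := ho (finSumFinEquiv.symm p) (finSumFinEquiv.symm q)
    rw [PiLp.inner_apply] at h1
    rw [Matrix.mul_apply, Matrix.one_apply]
    simp only [EmbeddingLike.apply_eq_iff_eq] at h1
    rw [← h1]
    refine Finset.sum_congr rfl fun i _ => ?_
    simp [W, mul_comm]
  have hWW' : W * Wᴴ = 1 := mul_eq_one_comm.mp hWW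
  refine ⟨Wᴴᵀ, ?_, j, ?_⟩
  · rw [Matrix.mem_unitaryGroup_iff, Matrix.star_eq_conjTranspose]
    have : Wᴴᵀᴴ = Wᵀ := by ext; simp
    rw [this, ← Matrix.transpose_mul, hWW', Matrix.transpose_one]
  · rw [← hWJ, Matrix.transpose_transpose]
    calc J = (W * Wᴴ)ᵀ * J * (W * Wᴴ) := by rw [hWW']; simp
      _ = _ := by rw [Matrix.transpose_mul]; simp only [Matrix.mul_assoc]

lemma blockDiag_mem_unitary {n : ℕ} {B C : Matrix (Fin n) (Fin n) ℂ}
    (hB : B ∈ Matrix.unitaryGroup (Fin n) ℂ) (hC : C ∈ Matrix.unitaryGroup (Fin n) ℂ) :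
    Matrix.reindex finSumFinEquiv finSumFinEquiv (Matrix.fromBlocks B 0 0 C) ∈
      Matrix.unitaryGroup (Fin (n + n)) ℂ := by
  rw [Matrix.mem_unitaryGroup_iff, Matrix.star_eq_conjTranspose] at *
  rw [Matrix.reindex_apply, Matrix.conjTranspose_submatrix, Matrix.submatrix_mul_equiv,
    Matrix.fromBlocks_conjTranspose, Matrix.fromBlocks_multiply]
  simp [hB, hC]

lemma diagonal_mem_unitary {n : ℕ} {z : Fin n → ℂ} (hz : ∀ f, ‖z f‖ = 1) :
    Matrix.diagonal z ∈ Matrix.unitaryGroup (Fin n) ℂ := by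
  rw [Matrix.mem_unitaryGroup_iff, Matrix.star_eq_conjTranspose, Matrix.diagonal_conjTranspose,
    Matrix.diagonal_mul_diagonal]
  rw [← Matrix.diagonal_one]
  congr 1
  ext f
  simp [Complex.mul_conj, Complex.normSq_eq_norm_sq, hz]

lemma norm_det_of_unitary {k : ℕ} {U : Matrix (Fin k) (Fin k) ℂ}
    (hU : U ∈ Matrix.unitaryGroup (Fin k) ℂ) : ‖U.det‖ = 1 := by
  have h := congrArg norm (conj_det_mul_det hU)
  rw [norm_mul, RCLike.norm_conj, norm_one] at h
  nlinarith [norm_nonneg U.det]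

/-- The normal form with a congruence of determinant one. -/
theorem exists_specialUnitary_normalForm {n : ℕ} (hn : 0 < n)
    {J : Matrix (Fin (n + n)) (Fin (n + n)) ℂ} (hJ : IsAntisymm J) :
    ∃ U ∈ Matrix.specialUnitaryGroup (Fin (n + n)) ℂ, ∃ j : Fin n → ℂ,
      J = U * offDiag (Matrix.diagonal j) * Uᵀ := by
  obtain ⟨U, hU, j, rfl⟩ := exists_unitary_normalForm hJ
  have hd := norm_det_of_unitary hU
  have hd0 : U.det ≠ 0 := fun h => by simp [h] at hd
  -- the phase of `det U` is moved into the first entry of `j`; here `n > 0` is needed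
  let z : Fin n → ℂ := Function.update 1 ⟨0, hn⟩ U.det⁻¹
  have hz : ∀ f, ‖z f‖ = 1 := fun f => by
    by_cases hf : f = ⟨0, hn⟩
    · subst hf; simp [z, hd]
    · simp [z, hf]
  have hz0 : ∀ f, z f ≠ 0 := fun f h => by simpa [h] using hz f
  let D := Matrix.reindex finSumFinEquiv finSumFinEquiv
    (Matrix.fromBlocks (Matrix.diagonal z) 0 0 (1 : Matrix (Fin n) (Fin n) ℂ))
  have hDdet : D.det = U.det⁻¹ := by
    simp [D, Matrix.det_diagonal, z, Finset.prod_update_of_mem]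
  refine ⟨U * D, ?_, fun f => (z f)⁻¹ * j f, ?_⟩
  · rw [Matrix.mem_specialUnitaryGroup_iff]
    refine ⟨mul_mem hU (blockDiag_mem_unitary (diagonal_mem_unitary hz) (one_mem _)), ?_⟩
    rw [Matrix.det_mul, hDdet, mul_inv_cancel₀ hd0]
  · have h1 := offDiag_congr (Matrix.diagonal z) 1 (Matrix.diagonal fun f => (z f)⁻¹ * j f)
    have h2 : Matrix.diagonal z * (Matrix.diagonal fun f => (z f)⁻¹ * j f) *
        (1 : Matrix (Fin n) (Fin n) ℂ)ᵀ = Matrix.diagonal j := by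
      rw [Matrix.diagonal_mul_diagonal, Matrix.transpose_one, Matrix.mul_one]
      congr 1
      ext f
      rw [← mul_assoc, mul_inv_cancel₀ (hz0 f), one_mul]
    rw [h2] at h1
    rw [h1, Matrix.transpose_mul]
    simp only [Matrix.mul_assoc, D]

/-! ### Functions of exponential growth and Gaussian integrability -/

/-- Continuous functions of at most exponential growth. -/
def ExpBdd {E : Type*} [NormedAddCommGroup E] (f : E → ℂ) : Prop :=
  Continuous f ∧ ∃ C K : ℝ, 0 ≤ C ∧ 0 ≤ K ∧ ∀ x, ‖f x‖ ≤ C * Real.exp (K * ‖x‖)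

namespace ExpBdd

variable {E : Type*} [NormedAddCommGroup E]

lemma const (c : ℂ) : ExpBdd fun _ : E => c :=
  ⟨continuous_const, ‖c‖, 0, norm_nonneg _, le_rfl, fun x => by simp⟩

lemma mul {f g : E → ℂ} (hf : ExpBdd f) (hg : ExpBdd g) : ExpBdd fun x => f x * g x := by
  obtain ⟨hf, C, K, hC, hK, h⟩ := hf
  obtain ⟨hg, C', K', hC', hK', h'⟩ := hg
  refine ⟨hf.mul hg, C * C', K + K', mul_nonneg hC hC', add_nonneg hK hK', fun x => ?_⟩
  rw [norm_mul, add_mul, Real.exp_add]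
  calc ‖f x‖ * ‖g x‖ ≤ (C * Real.exp (K * ‖x‖)) * (C' * Real.exp (K' * ‖x‖)) :=
        mul_le_mul (h x) (h' x) (norm_nonneg _) (by positivity)
    _ = _ := by ring

lemma add {f g : E → ℂ} (hf : ExpBdd f) (hg : ExpBdd g) : ExpBdd fun x => f x + g x := by
  obtain ⟨hf, C, K, hC, hK, h⟩ := hf
  obtain ⟨hg, C', K', hC', hK', h'⟩ := hg
  refine ⟨hf.add hg, C + C', K + K', add_nonneg hC hC', add_nonneg hK hK', fun x => ?_⟩
  have e1 : Real.exp (K * ‖x‖) ≤ Real.exp ((K + K') * ‖x‖) :=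
    Real.exp_le_exp.mpr (by nlinarith [norm_nonneg x])
  have e2 : Real.exp (K' * ‖x‖) ≤ Real.exp ((K + K') * ‖x‖) :=
    Real.exp_le_exp.mpr (by nlinarith [norm_nonneg x])
  calc ‖f x + g x‖ ≤ ‖f x‖ + ‖g x‖ := norm_add_le _ _
    _ ≤ C * Real.exp ((K + K') * ‖x‖) + C' * Real.exp ((K + K') * ‖x‖) :=
        add_le_add ((h x).trans (by gcongr)) ((h' x).trans (by gcongr))
    _ = _ := by ring

lemma neg {f : E → ℂ} (hf : ExpBdd f) : ExpBdd fun x => - f x := by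
  simpa using (const (-1)).mul hf

lemma sub {f g : E → ℂ} (hf : ExpBdd f) (hg : ExpBdd g) : ExpBdd fun x => f x - g x := by
  simpa [sub_eq_add_neg] using hf.add hg.neg

lemma sum {ι : Type*} (s : Finset ι) {f : ι → E → ℂ} (hf : ∀ i, ExpBdd (f i)) :
    ExpBdd fun x => ∑ i ∈ s, f i x := by
  classical
  induction s using Finset.induction_on with
  | empty => simpa using const 0
  | insert a s ha ih => simpa [Finset.sum_insert ha] using (hf a).add ih

lemma prod {ι : Type*} (s : Finset ι) {f : ι → E → ℂ} (hf : ∀ i, ExpBdd (f i)) :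
    ExpBdd fun x => ∏ i ∈ s, f i x := by
  classical
  induction s using Finset.induction_on with
  | empty => simpa using const 1
  | insert a s ha ih => simpa [Finset.prod_insert ha] using (hf a).mul ih

lemma pow {f : E → ℂ} (hf : ExpBdd f) (k : ℕ) : ExpBdd fun x => f x ^ k := by
  induction k with
  | zero => simpa using const 1
  | succ k ih => simpa [pow_succ] using ih.mul hf

lemma clm [NormedSpace ℝ E] (l : E →L[ℝ] ℂ) : ExpBdd fun x => l x := by
  refine ⟨l.continuous, ‖l‖, 1, norm_nonneg _, zero_le_one, fun x => ?_⟩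
  refine (l.le_opNorm x).trans (mul_le_mul_of_nonneg_left ?_ (norm_nonneg _))
  rw [one_mul]
  linarith [Real.add_one_le_exp ‖x‖]

lemma pfaffian {k : ℕ} {X : E → Matrix (Fin k) (Fin k) ℂ} (hX : ∀ i j, ExpBdd fun x => X x i j) :
    ExpBdd fun x => pfaffian (X x) := by
  unfold ChiralRMT.pfaffian
  exact (const _).mul (sum _ fun σ => (const _).mul (prod _ fun i => hX _ _))

lemma det {ι : Type*} [Fintype ι] [DecidableEq ι] {X : E → Matrix ι ι ℂ}
    (hX : ∀ i j, ExpBdd fun x => X x i j) :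
    ExpBdd fun x => (X x).det := by
  simp only [Matrix.det_apply']
  exact sum _ fun σ => (const _).mul (prod _ fun i => hX _ _)

/-- A function of exponential growth is integrable against a Gaussian weight. -/
lemma integrable_mul [NormedSpace ℝ E] [FiniteDimensional ℝ E] [MeasurableSpace E] [BorelSpace E]
    {μ : Measure E} [μ.IsAddHaarMeasure] {f w : E → ℂ} (hf : ExpBdd f) (hw : Continuous w)
    {C c : ℝ} (hc : 0 < c) (hwb : ∀ x, ‖w x‖ ≤ C * Real.exp (-c * ‖x‖ ^ 2)) :
    Integrable (fun x => w x * f x) μ := by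
  obtain ⟨hf, C', K, hC', hK, h⟩ := hf
  set r : ℝ := Module.finrank ℝ E + 1 with hr
  have h1 : Integrable (fun x : E => (1 + ‖x‖) ^ (-r)) μ :=
    integrable_one_add_norm (by rw [hr]; linarith)
  have hC : 0 ≤ C := by
    have := (norm_nonneg _).trans (hwb 0)
    exact nonneg_of_mul_nonneg_left this (Real.exp_pos _)
  -- the integrable function `(1 + ‖x‖) ^ (-r)`, `r > dim E`, dominates after completing the square in
  -- the exponent `K t - c t² + r t`
  refine (h1.const_mul (C * C' * Real.exp ((K + r) ^ 2 / (4 * c)))).mono'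
    ((hw.mul hf).aestronglyMeasurable) (Eventually.of_forall fun x => ?_)
  set t := ‖x‖ with ht
  have ht0 : 0 ≤ t := norm_nonneg x
  have hr0 : 0 ≤ r := by positivity
  have hp : 1 ≤ Real.exp (r * t) * (1 + t) ^ (-r) := by
    rw [Real.rpow_neg (by positivity), ← div_eq_mul_inv, one_le_div (by positivity)]
    calc (1 + t) ^ r ≤ (Real.exp t) ^ r :=
          Real.rpow_le_rpow (by positivity) (by linarith [Real.add_one_le_exp t]) hr0
      _ = Real.exp (r * t) := by rw [← Real.exp_mul, mul_comm]
  rw [norm_mul]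
  calc ‖w x‖ * ‖f x‖ ≤ (C * Real.exp (-c * t ^ 2)) * (C' * Real.exp (K * t)) :=
        mul_le_mul (hwb x) (h x) (norm_nonneg _) (by positivity)
    _ = (C * C' * Real.exp (K * t - c * t ^ 2)) * 1 := by
        rw [show K * t - c * t ^ 2 = -c * t ^ 2 + K * t by ring, Real.exp_add]
        ring
    _ ≤ (C * C' * Real.exp (K * t - c * t ^ 2)) * (Real.exp (r * t) * (1 + t) ^ (-r)) :=
        mul_le_mul_of_nonneg_left hp (by positivity)
    _ = (C * C' * Real.exp (K * t - c * t ^ 2 + r * t)) * (1 + t) ^ (-r) := by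
        rw [Real.exp_add]
        ring
    _ ≤ (C * C' * Real.exp ((K + r) ^ 2 / (4 * c))) * (1 + t) ^ (-r) := by
        gcongr
        rw [le_div_iff₀ (by positivity)]
        nlinarith [sq_nonneg (2 * c * t - (K + r))]

end ExpBdd

lemma trace_transpose_mul_self {N : ℕ} {ν : ℤ} (a : RealMat N ν) :
    ((Matrix.of a)ᵀ * Matrix.of a).trace = ∑ i, ∑ k, a i k ^ 2 := by
  simp only [Matrix.trace, Matrix.diag, Matrix.mul_apply, Matrix.transpose_apply, Matrix.of_apply]
  rw [Finset.sum_comm]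
  refine Finset.sum_congr rfl fun _ _ => Finset.sum_congr rfl fun _ _ => by ring

lemma gaussWeight_eq {N : ℕ} {ν : ℤ} (a : RealMat N ν) :
    gaussWeight a = Real.exp (-(N : ℝ) * ∑ i, ∑ k, a i k ^ 2) := by
  rw [gaussWeight, trace_transpose_mul_self]

lemma gaussWeight_pos {N : ℕ} {ν : ℤ} (a : RealMat N ν) : 0 < gaussWeight a := Real.exp_pos _

lemma continuous_gaussWeight {N : ℕ} {ν : ℤ} : Continuous (gaussWeight (N := N) (ν := ν)) := by
  simp only [funext gaussWeight_eq]
  fun_prop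

lemma norm_sq_le_sum_sq {p q : ℕ} (a : Fin p → Fin q → ℝ) : ‖a‖ ^ 2 ≤ ∑ i, ∑ k, a i k ^ 2 := by
  set S := ∑ i, ∑ k, a i k ^ 2 with hS
  have hS0 : 0 ≤ S := by positivity
  have h1 : ‖a‖ ≤ Real.sqrt S := by
    refine (pi_norm_le_iff_of_nonneg (Real.sqrt_nonneg _)).mpr fun i =>
      (pi_norm_le_iff_of_nonneg (Real.sqrt_nonneg _)).mpr fun k => ?_
    rw [Real.norm_eq_abs]
    refine Real.abs_le_sqrt ?_
    calc a i k ^ 2 ≤ ∑ k, a i k ^ 2 :=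
          Finset.single_le_sum (f := fun k => a i k ^ 2) (fun _ _ => sq_nonneg _) (Finset.mem_univ k)
      _ ≤ S := Finset.single_le_sum (f := fun i => ∑ k, a i k ^ 2)
          (fun _ _ => Finset.sum_nonneg fun _ _ => sq_nonneg _) (Finset.mem_univ i)
  calc ‖a‖ ^ 2 ≤ Real.sqrt S ^ 2 := by gcongr
    _ = S := Real.sq_sqrt hS0

/-- For `N = 0` the space of matrices is a point, so that the bound holds there as well. -/
lemma gaussWeight_le {N : ℕ} {ν : ℤ} (a : RealMat N ν) :
    gaussWeight a ≤ Real.exp (-1 * ‖a‖ ^ 2) := by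
  rw [gaussWeight_eq]
  refine Real.exp_le_exp.mpr ?_
  rcases Nat.eq_zero_or_pos N with rfl | hN
  · have : a = 0 := Subsingleton.elim _ _
    simp [this]
  · have h1 : (1 : ℝ) ≤ N := by exact_mod_cast hN
    nlinarith [norm_sq_le_sum_sq a, sq_nonneg ‖a‖]

lemma ExpBdd.entry {N : ℕ} {ν : ℤ} (i : Fin N) (k : Fin (dimR N ν)) :
    ExpBdd fun a : RealMat N ν => cMat a i k :=
  ExpBdd.clm (Complex.ofRealCLM ∘L
    (ContinuousLinearMap.proj k : (Fin (dimR N ν) → ℝ) →L[ℝ] ℝ) ∘L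
    (ContinuousLinearMap.proj i : (Fin N → Fin (dimR N ν) → ℝ) →L[ℝ] (Fin (dimR N ν) → ℝ)))

lemma ExpBdd.integrable_gauss {N : ℕ} {ν : ℤ} {f : RealMat N ν → ℂ} (hf : ExpBdd f) :
    Integrable fun a => (gaussWeight a : ℂ) * f a :=
  hf.integrable_mul (Complex.continuous_ofReal.comp continuous_gaussWeight) (C := 1) one_pos
    fun a => by
      rw [Complex.norm_real, Real.norm_of_nonneg (gaussWeight_pos a).le, one_mul]
      exact gaussWeight_le a

lemma ExpBdd.pfBlock {n N : ℕ} {ν : ℤ} (J : Matrix (Fin (n + n)) (Fin (n + n)) ℂ)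
    (p q : Fin ((n + n) * N + (n + n) * dimR N ν)) :
    ExpBdd fun a : RealMat N ν => pfBlock J a p q := by
  simp only [pfBlock_eq, Matrix.reindex_apply, Matrix.submatrix_apply, sourceBlock]
  rcases (blockEquiv (n + n) N (dimR N ν)).symm p with p | p <;>
    rcases (blockEquiv (n + n) N (dimR N ν)).symm q with q | q <;>
    simp only [Matrix.fromBlocks_apply₁₁, Matrix.fromBlocks_apply₁₂, Matrix.fromBlocks_apply₂₁,
      Matrix.fromBlocks_apply₂₂, Matrix.kroneckerMap_apply, Matrix.neg_apply,
      Matrix.transpose_apply]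
  · exact ExpBdd.const _
  · exact (ExpBdd.const _).mul (ExpBdd.entry _ _)
  · exact (ExpBdd.const _).mul (ExpBdd.entry _ _).neg
  · exact ExpBdd.const _

theorem integrable_rmtIntegrand (n N : ℕ) (ν : ℤ) (J : Matrix (Fin (n + n)) (Fin (n + n)) ℂ) :
    Integrable (rmtIntegrand n N ν J) :=
  (ExpBdd.pfaffian fun p q => ExpBdd.pfBlock J p q).integrable_gauss

/-! ### The model in terms of the normal form of the source -/

theorem gRMT_normalForm {n N : ℕ} {ν : ℤ} (h : 0 ≤ (N : ℤ) + ν)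
    {U : Matrix (Fin (n + n)) (Fin (n + n)) ℂ} (hU : U ∈ Matrix.unitaryGroup (Fin (n + n)) ℂ)
    (j : Fin n → ℂ) :
    gRMT n N ν (U * offDiag (Matrix.diagonal j) * Uᵀ) =
      orderSign n N ν * chiralPow ν U.det * gProduct n N ν j := by
  rw [gRMT, gProduct, ← integral_const_mul]
  refine integral_congr_ae (Eventually.of_forall fun a => ?_)
  simp only [rmtIntegrand, pfaffian_pfBlock_normalForm h hU]
  ring

theorem gProduct_eq_zMassMuZero {n N : ℕ} {ν : ℤ} (h : 0 ≤ (N : ℤ) + ν) (j : Fin n → ℂ) :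
    gProduct n N ν j = zMassMuZero n N ν (Matrix.diagonal j) := by
  refine integral_congr_ae (Eventually.of_forall fun a => ?_)
  simp only [det_diracBlock_diagonal, det_flavourBlock h]

theorem gRMT_offDiag {n N : ℕ} {ν : ℤ} (M : Matrix (Fin n) (Fin n) ℂ) :
    gRMT n N ν (offDiag M) = orderSign n N ν * zMassMuZero n N ν M := by
  rw [gRMT, zMassMuZero, ← integral_const_mul]
  refine integral_congr_ae (Eventually.of_forall fun a => ?_)
  simp only [rmtIntegrand, pfaffian_pfBlock_offDiag]
  ring

/-! ### Gaussian moments with values in a commutative algebra -/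

/-- The moments `∫ exp (-c x²) x ^ k dx`, divided by `√(π / c)`. -/
def gaussMoment (c : ℝ) (k : ℕ) : ℝ :=
  if Even k then (k ! : ℝ) / ((k / 2)! * (4 * c) ^ (k / 2)) else 0

lemma integrable_gauss_pow {c : ℝ} (hc : 0 < c) (k : ℕ) :
    Integrable fun x : ℝ => Real.exp (-c * x ^ 2) * x ^ k := by
  have h := integrable_rpow_mul_exp_neg_mul_sq hc (s := (k : ℝ)) (by
    have : (0 : ℝ) ≤ k := k.cast_nonneg
    linarith)
  refine h.congr (Eventually.of_forall fun x => ?_)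
  simp [mul_comm]

/-- Integration by parts. -/
lemma integral_gauss_pow_succ_succ {c : ℝ} (hc : 0 < c) (k : ℕ) :
    ∫ x : ℝ, Real.exp (-c * x ^ 2) * x ^ (k + 2) =
      ((k + 1 : ℕ) / (2 * c)) * ∫ x : ℝ, Real.exp (-c * x ^ 2) * x ^ k := by
  have hv : ∀ x : ℝ, HasDerivAt (fun x => -(2 * c)⁻¹ * Real.exp (-c * x ^ 2))
      (x * Real.exp (-c * x ^ 2)) x := fun x => by
    have h1 := (((hasDerivAt_pow 2 x).const_mul (-c)).exp).const_mul (-(2 * c)⁻¹)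
    refine h1.congr_deriv ?_
    simp
    field_simp
  have hu : ∀ x : ℝ, HasDerivAt (fun x : ℝ => x ^ (k + 1)) ((k + 1 : ℕ) * x ^ k) x := fun x => by
    simpa using hasDerivAt_pow (k + 1) x
  have h := integral_mul_deriv_eq_deriv_mul_of_integrable (u := fun x : ℝ => x ^ (k + 1))
    (v := fun x => -(2 * c)⁻¹ * Real.exp (-c * x ^ 2)) (fun x _ => hu x) (fun x _ => hv x)
    ((integrable_gauss_pow hc (k + 2)).congr (Eventually.of_forall fun x => by simp; ring))
    (((integrable_gauss_pow hc k).const_mul (-(2 * c)⁻¹ * (k + 1 : ℕ))).congr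
      (Eventually.of_forall fun x => by simp; ring))
    (((integrable_gauss_pow hc (k + 1)).const_mul (-(2 * c)⁻¹)).congr
      (Eventually.of_forall fun x => by simp; ring))
  calc _ = ∫ x : ℝ, x ^ (k + 1) * (x * Real.exp (-c * x ^ 2)) :=
        integral_congr_ae (Eventually.of_forall fun x => by simp; ring)
    _ = _ := by
      rw [h, ← integral_neg, ← integral_const_mul]
      refine integral_congr_ae (Eventually.of_forall fun x => ?_)
      simp
      field_simp

lemma integral_gauss_pow {c : ℝ} (hc : 0 < c) (k : ℕ) :
    ∫ x : ℝ, Real.exp (-c * x ^ 2) * x ^ k = Real.sqrt (Real.pi / c) * gaussMoment c k := by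
  induction k using Nat.twoStepInduction with
  | zero => simpa [gaussMoment] using integral_gaussian c
  | one =>
    have h := integral_neg_eq_self (fun x : ℝ => Real.exp (-c * x ^ 2) * x ^ 1) volume
    have h2 : ∀ x : ℝ, Real.exp (-c * (-x) ^ 2) * (-x) ^ 1 = -(Real.exp (-c * x ^ 2) * x ^ 1) :=
      fun x => by rw [neg_sq]; ring
    simp only [h2, integral_neg] at h
    simp only [gaussMoment, Nat.not_even_one, if_false, mul_zero]
    linarith
  | more k ih _ =>
    rw [integral_gauss_pow_succ_succ hc, ih]
    unfold gaussMoment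
    by_cases hk : Even k
    · obtain ⟨m, rfl⟩ := hk
      have e1 : (m + m) / 2 = m := by omega
      have e2 : (m + m + 2) / 2 = m + 1 := by omega
      rw [if_pos ⟨m, rfl⟩, if_pos ⟨m + 1, by ring⟩, e1, e2, Nat.factorial_succ (m + m + 1),
        Nat.factorial_succ (m + m), Nat.factorial_succ m, pow_succ]
      have := Nat.factorial_ne_zero m
      push_cast
      field_simp
      ring
    · rw [if_neg hk, if_neg (by rw [Nat.even_add]; simpa using hk)]
      ring

section Wick

variable {α : Type*} [Fintype α] {R : Type*} [CommRing R] [Algebra ℂ R]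

lemma integrable_gauss_monomial {c : ℝ} (hc : 0 < c) (k : α → ℕ) :
    Integrable fun x : α → ℝ => Real.exp (-c * ∑ i, x i ^ 2) * ∏ i, x i ^ k i := by
  refine (Integrable.fintype_prod (f := fun i (x : ℝ) => Real.exp (-c * x ^ 2) * x ^ k i)
    fun i => integrable_gauss_pow hc (k i)).congr (Eventually.of_forall fun x => ?_)
  simp only [Finset.prod_mul_distrib, ← Real.exp_sum, Finset.mul_sum]

lemma integral_gauss_monomial {c : ℝ} (hc : 0 < c) (k : α → ℕ) :
    ∫ x : α → ℝ, Real.exp (-c * ∑ i, x i ^ 2) * ∏ i, x i ^ k i =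
      Real.sqrt (Real.pi / c) ^ Fintype.card α * ∏ i, gaussMoment c (k i) := by
  calc _ = ∫ x : α → ℝ, ∏ i, (Real.exp (-c * x i ^ 2) * x i ^ k i) := by
        refine integral_congr_ae (Eventually.of_forall fun x => ?_)
        simp only [Finset.prod_mul_distrib, ← Real.exp_sum, Finset.mul_sum]
    _ = ∏ i, ∫ x : ℝ, Real.exp (-c * x ^ 2) * x ^ k i :=
        integral_fintype_prod_volume_eq_prod fun i (x : ℝ) => Real.exp (-c * x ^ 2) * x ^ k i
    _ = _ := by
        simp only [integral_gauss_pow hc, Finset.prod_mul_distrib, Finset.prod_const,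
          Finset.card_univ]

lemma linear_pow_expand [DecidableEq α] (l : R →ₗ[ℂ] ℂ) (d : α → R) (k : ℕ) (w : ℝ) (x : α → ℝ) :
    (w : ℂ) * l ((∑ i, (x i : ℂ) • d i) ^ k) =
      ∑ κ ∈ Finset.piAntidiag Finset.univ k, ((w * ∏ i, x i ^ κ i : ℝ) : ℂ) *
        (Nat.multinomial Finset.univ κ * l (∏ i, d i ^ κ i)) := by
  rw [Finset.sum_pow_eq_sum_piAntidiag, map_sum, Finset.mul_sum]
  refine Finset.sum_congr rfl fun κ _ => ?_
  have : (Nat.multinomial Finset.univ κ : R) * ∏ i, ((x i : ℂ) • d i) ^ κ i =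
      ((Nat.multinomial Finset.univ κ : ℂ) * ∏ i, (x i : ℂ) ^ κ i) • ∏ i, d i ^ κ i := by
    simp only [Algebra.smul_def, map_mul, map_natCast, map_prod, map_pow, mul_pow,
      Finset.prod_mul_distrib]
    ring
  rw [this, map_smul, smul_eq_mul]
  push_cast
  ring

lemma integrable_gauss_linear_pow {c : ℝ} (hc : 0 < c) (l : R →ₗ[ℂ] ℂ) (d : α → R) (k : ℕ) :
    Integrable fun x : α → ℝ =>
      (Real.exp (-c * ∑ i, x i ^ 2) : ℂ) * l ((∑ i, (x i : ℂ) • d i) ^ k) := by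
  classical
  simp only [linear_pow_expand]
  exact integrable_finsetSum _ fun κ _ => ((integrable_gauss_monomial hc κ).ofReal).mul_const _

/-- Wick's theorem: the moments of a Gaussian linear form `∑ xᵢ dᵢ` with values in a commutative
algebra depend only on its covariance `∑ dᵢ²`. -/
theorem integral_gauss_linear_pow {c : ℝ} (hc : 0 < c) (l : R →ₗ[ℂ] ℂ) (d : α → R) (k : ℕ) :
    ∫ x : α → ℝ, (Real.exp (-c * ∑ i, x i ^ 2) : ℂ) * l ((∑ i, (x i : ℂ) • d i) ^ k) =
      ((Real.sqrt (Real.pi / c) ^ Fintype.card α : ℝ) : ℂ) *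
        (gaussMoment 1 k * l (((c⁻¹ : ℝ) : ℂ) ^ (k / 2) • (∑ i, d i ^ 2) ^ (k / 2))) := by
  classical
  simp only [linear_pow_expand]
  rw [integral_finsetSum _ fun κ _ => ((integrable_gauss_monomial hc κ).ofReal).mul_const _]
  have h1 : ∀ κ : α → ℕ, ∫ x : α → ℝ,
      ((Real.exp (-c * ∑ i, x i ^ 2) * ∏ i, x i ^ κ i : ℝ) : ℂ) *
        (Nat.multinomial Finset.univ κ * l (∏ i, d i ^ κ i)) =
      ((Real.sqrt (Real.pi / c) ^ Fintype.card α : ℝ) : ℂ) * (((∏ i, gaussMoment c (κ i) : ℝ) : ℂ) *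
        (Nat.multinomial Finset.univ κ * l (∏ i, d i ^ κ i))) := fun κ => by
    rw [integral_mul_const, integral_complex_ofReal, integral_gauss_monomial hc]
    push_cast
    ring
  simp only [h1, ← Finset.mul_sum]
  congr 1
  by_cases hk : Even k
  · obtain ⟨m, rfl⟩ := hk
    have e1 : (m + m) / 2 = m := by omega
    rw [e1, Finset.sum_pow_eq_sum_piAntidiag, Finset.smul_sum, map_sum, Finset.mul_sum]
    symm
    -- the monomials with a nonzero moment are the squares, which are those of the power of `∑ dᵢ²`
    refine Finset.sum_of_injOn (fun κ i => 2 * κ i) ?_ ?_ ?_ ?_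
    · intro κ _ κ' _ h
      funext i
      have := congrFun h i
      simp only at this
      omega
    · intro κ hκ
      simp only [Finset.mem_coe, Finset.mem_piAntidiag, Finset.mem_univ,
        implies_true, and_true] at hκ ⊢
      rw [← Finset.mul_sum, ← two_mul]
      simpa using hκ
    · intro κ hκ hn
      have hodd : ∃ i, ¬ Even (κ i) := by
        by_contra hc
        push Not at hc
        apply hn
        refine ⟨fun i => κ i / 2, ?_, ?_⟩
        · simp only [Finset.mem_piAntidiag, Finset.mem_univ, implies_true, and_true] at hκ
          simp only [Finset.mem_coe, Finset.mem_piAntidiag, Finset.mem_univ,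
            implies_true, and_true]
          have : 2 * Finset.univ.sum (fun i => κ i / 2) = m + m := by
            rw [← hκ, Finset.mul_sum]
            exact Finset.sum_congr rfl fun i _ => Nat.two_mul_div_two_of_even (hc i)
          omega
        · funext i
          exact Nat.two_mul_div_two_of_even (hc i)
      obtain ⟨i, hi⟩ := hodd
      have : (∏ i, gaussMoment c (κ i)) = 0 :=
        Finset.prod_eq_zero (Finset.mem_univ i) (by rw [gaussMoment, if_neg hi])
      rw [this]
      simp
    · intro κ hκ
      have hs : ∑ i, κ i = m := by simpa using hκ
      -- the moments of a square convert its multinomial coefficient into that of its root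
      have hg : (∏ i, gaussMoment c (2 * κ i)) * Nat.multinomial Finset.univ (fun i => 2 * κ i) =
          gaussMoment 1 (m + m) * (c⁻¹ ^ m * Nat.multinomial Finset.univ κ) := by
        have hm1 := Nat.multinomial_spec Finset.univ κ
        have hm2 := Nat.multinomial_spec Finset.univ (fun i => 2 * κ i)
        rw [← Finset.mul_sum] at hm2
        rw [hs] at hm1 hm2
        have hm1' : (∏ i, ((κ i)! : ℝ)) * Nat.multinomial Finset.univ κ = (m ! : ℝ) := by
          exact_mod_cast hm1
        have hm2' : (∏ i, ((2 * κ i)! : ℝ)) * Nat.multinomial Finset.univ (fun i => 2 * κ i) =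
            ((2 * m)! : ℝ) := by exact_mod_cast hm2
        have hp : (∏ i, gaussMoment c (2 * κ i)) =
            (∏ i, ((2 * κ i)! : ℝ)) / ((∏ i, ((κ i)! : ℝ)) * (4 * c) ^ m) := by
          rw [← hs, ← Finset.prod_pow_eq_pow_sum, ← Finset.prod_mul_distrib,
            ← Finset.prod_div_distrib]
          refine Finset.prod_congr rfl fun i _ => ?_
          rw [gaussMoment, if_pos (even_two_mul _), Nat.mul_div_cancel_left _ two_pos]
        have h0 : (∏ i, ((κ i)! : ℝ)) ≠ 0 :=
          Finset.prod_ne_zero_iff.mpr fun i _ => by exact_mod_cast Nat.factorial_ne_zero _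
        have h00 : (m ! : ℝ) ≠ 0 := by exact_mod_cast Nat.factorial_ne_zero _
        rw [hp, div_mul_eq_mul_div, hm2', gaussMoment, if_pos ⟨m, rfl⟩, e1, ← two_mul]
        rw [div_eq_iff (by positivity), ← hm1']
        have h3 : (Nat.multinomial Finset.univ κ : ℝ) ≠ 0 := fun h => by
          rw [h, mul_zero] at hm1'
          exact h00 hm1'.symm
        rw [inv_pow]
        field_simp
        ring
      have hg' := congrArg (fun t : ℝ => (t : ℂ)) hg
      push_cast at hg'
      have hd : ∏ i, d i ^ (2 * κ i) = ∏ i, (d i ^ 2) ^ κ i := by simp only [pow_mul]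
      push_cast
      rw [hd, ← mul_assoc, hg', map_smul, smul_eq_mul, ← nsmul_eq_mul, map_nsmul, nsmul_eq_mul]
      ring
  -- for odd `k` every monomial contains an odd power
  · have h0 : gaussMoment 1 k = 0 := by rw [gaussMoment, if_neg hk]
    rw [h0]
    simp only [Complex.ofReal_zero, zero_mul]
    refine Finset.sum_eq_zero fun κ hκ => ?_
    have hs : ∑ i, κ i = k := by simpa using hκ
    have hodd : ∃ i, ¬ Even (κ i) := by
      by_contra hc
      push Not at hc
      exact hk (hs ▸ Finset.even_sum _ fun i _ => hc i)
    obtain ⟨i, hi⟩ := hodd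
    have : (∏ i, gaussMoment c (κ i)) = 0 :=
      Finset.prod_eq_zero (Finset.mem_univ i) (by rw [gaussMoment, if_neg hi])
    rw [this]
    simp

lemma integral_gauss_affine_pow {c : ℝ} (hc : 0 < c) (l : R →ₗ[ℂ] ℂ) (d : α → R) (r : R) (m : ℕ) :
    ∫ x : α → ℝ, (Real.exp (-c * ∑ i, x i ^ 2) : ℂ) * l ((r + ∑ i, (x i : ℂ) • d i) ^ m) =
      ((Real.sqrt (Real.pi / c) ^ Fintype.card α : ℝ) : ℂ) * ∑ k ∈ Finset.range (m + 1),
        (gaussMoment 1 (m - k) * (l ∘ₗ LinearMap.mulLeft ℂ (r ^ k * (m.choose k : R)))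
          ((((c⁻¹ : ℝ) : ℂ) • ∑ i, d i ^ 2) ^ ((m - k) / 2))) := by
  -- binomial expansion in the constant `r`, which the functional `l` absorbs
  have h1 : ∀ x : α → ℝ, (Real.exp (-c * ∑ i, x i ^ 2) : ℂ) * l ((r + ∑ i, (x i : ℂ) • d i) ^ m) =
      ∑ k ∈ Finset.range (m + 1), (Real.exp (-c * ∑ i, x i ^ 2) : ℂ) *
        (l ∘ₗ LinearMap.mulLeft ℂ (r ^ k * (m.choose k : R)))
          ((∑ i, (x i : ℂ) • d i) ^ (m - k)) := fun x => by
    rw [add_pow, map_sum, Finset.mul_sum]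
    refine Finset.sum_congr rfl fun k _ => ?_
    rw [LinearMap.comp_apply, LinearMap.mulLeft_apply]
    congr 2
    ring
  simp only [h1]
  rw [integral_finsetSum _ fun k _ => integrable_gauss_linear_pow hc _ _ _, Finset.mul_sum]
  refine Finset.sum_congr rfl fun k _ => ?_
  rw [integral_gauss_linear_pow hc, smul_pow]

/-- Two Gaussian linear forms with the same covariance have the same moments. -/
theorem integral_gauss_eq_of_covariance {β : Type*} [Fintype β] {c c' : ℝ} (hc : 0 < c)
    (hc' : 0 < c') (l : R →ₗ[ℂ] ℂ) (d : α → R) (d' : β → R)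
    (h : ((c⁻¹ : ℝ) : ℂ) • ∑ i, d i ^ 2 = ((c'⁻¹ : ℝ) : ℂ) • ∑ i, d' i ^ 2) (r : R) (m : ℕ) :
    ((Real.sqrt (Real.pi / c') ^ Fintype.card β : ℝ) : ℂ) *
      ∫ x : α → ℝ, (Real.exp (-c * ∑ i, x i ^ 2) : ℂ) * l ((r + ∑ i, (x i : ℂ) • d i) ^ m) =
    ((Real.sqrt (Real.pi / c) ^ Fintype.card α : ℝ) : ℂ) *
      ∫ x : β → ℝ, (Real.exp (-c' * ∑ i, x i ^ 2) : ℂ) * l ((r + ∑ i, (x i : ℂ) • d' i) ^ m) := by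
  rw [integral_gauss_affine_pow hc, integral_gauss_affine_pow hc', h]
  ring

end Wick

/-! ### Pfaffians as Berezin integrals -/

/-- The Berezin integral: the coefficient of the top form. -/
def berezin (K : ℕ) : ExteriorAlgebra ℂ (Fin K → ℂ) →ₗ[ℂ] ℂ :=
  ExteriorAlgebra.liftAlternating fun i =>
    if h : i = K then
      (Matrix.detRowAlternating (R := ℂ) (n := Fin K)).domDomCongr (finCongr h.symm) else 0

lemma berezin_ιMulti {K l : ℕ} (h : l = K) (v : Fin l → Fin K → ℂ) :
    berezin K (ExteriorAlgebra.ιMulti ℂ l v) = (Matrix.of fun i => v (finCongr h.symm i)).det := by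
  rw [berezin, ExteriorAlgebra.liftAlternating_apply_ιMulti, dif_pos h]
  rfl

/-- The generators of the Grassmann algebra. -/
def grassGen {K : ℕ} (p : Fin K) : ExteriorAlgebra ℂ (Fin K → ℂ) :=
  ExteriorAlgebra.ι ℂ (Pi.single p 1)

lemma grassGen_mul {K : ℕ} (p q : Fin K) : grassGen p * grassGen q = -(grassGen q * grassGen p) :=
  eq_neg_of_add_eq_zero_left (ExteriorAlgebra.ι_add_mul_swap _ _)

/-- Products of two generators are central. -/
lemma grassGen_mul_mem_center {K : ℕ} (p q : Fin K) :
    grassGen p * grassGen q ∈ Subalgebra.center ℂ (ExteriorAlgebra ℂ (Fin K → ℂ)) := by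
  rw [Subalgebra.mem_center_iff]
  intro x
  induction x using ExteriorAlgebra.induction with
  | algebraMap r => exact Algebra.commutes _ _
  | ι v =>
    have h : ∀ w : Fin K → ℂ, ExteriorAlgebra.ι ℂ v * ExteriorAlgebra.ι ℂ w =
        -(ExteriorAlgebra.ι ℂ w * ExteriorAlgebra.ι ℂ v) := fun w =>
      eq_neg_of_add_eq_zero_left (ExteriorAlgebra.ι_add_mul_swap _ _)
    rw [grassGen, grassGen, ← mul_assoc, h, neg_mul, mul_assoc, h, mul_neg, neg_neg, mul_assoc]
  | mul a b ha hb => rw [mul_assoc, hb, ← mul_assoc, ha, mul_assoc]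
  | add a b ha hb => rw [add_mul, mul_add, ha, hb]

/-- The commutative algebra in which the quadratic forms of the generators live. -/
abbrev GrassCenter (K : ℕ) := Subalgebra.center ℂ (ExteriorAlgebra ℂ (Fin K → ℂ))

/-- The product of two generators, as a central element. -/
def grassPair {K : ℕ} (p q : Fin K) : GrassCenter K :=
  ⟨grassGen p * grassGen q, grassGen_mul_mem_center p q⟩

lemma grassPair_swap {K : ℕ} (p q : Fin K) : grassPair p q = - grassPair q p :=
  Subtype.ext (grassGen_mul p q)

lemma grassPair_mul {K : ℕ} (p q r s : Fin K) :
    grassPair p q * grassPair r s = -(grassPair p r * grassPair q s) := by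
  refine Subtype.ext ?_
  show grassGen p * grassGen q * (grassGen r * grassGen s) =
    -(grassGen p * grassGen r * (grassGen q * grassGen s))
  calc _ = grassGen p * (grassGen q * grassGen r) * grassGen s := by simp only [mul_assoc]
    _ = _ := by rw [grassGen_mul q r]; simp only [mul_assoc, mul_neg, neg_mul]

/-- The quadratic form `∑ X p q ψ_p ψ_q` of the generators. -/
def grassQuad {K : ℕ} (X : Matrix (Fin K) (Fin K) ℂ) : GrassCenter K :=
  ∑ p, ∑ q, X p q • grassPair p q

/-- Expansion of a power of a quadratic form into products of generators. -/
lemma grassQuad_pow {K : ℕ} (X : Matrix (Fin K) (Fin K) ℂ) (j : ℕ) :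
    ((grassQuad X ^ j : GrassCenter K) : ExteriorAlgebra ℂ (Fin K → ℂ)) =
      ∑ f : Fin (2 * j) → Fin K, (∏ i : Fin j, X (f ⟨2 * (i : ℕ), by have := i.isLt; omega⟩)
        (f ⟨2 * (i : ℕ) + 1, by have := i.isLt; omega⟩)) •
        ExteriorAlgebra.ιMulti ℂ (2 * j) fun i => Pi.single (f i) (1 : ℂ) := by
  induction j with
  | zero => simp [ExteriorAlgebra.ιMulti_zero_apply]
  | succ j ih =>
    have h1 : ((grassQuad X : GrassCenter K) : ExteriorAlgebra ℂ (Fin K → ℂ)) =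
        ∑ p, ∑ q, X p q • (grassGen p * grassGen q) := by
      simp [grassQuad, grassPair]
    let E : (Fin K × (Fin K × (Fin (2 * j) → Fin K))) ≃ (Fin (2 * (j + 1)) → Fin K) :=
      ((Equiv.refl (Fin K)).prodCongr (Fin.consEquiv fun _ : Fin (2 * j + 1) => Fin K)).trans
        (Fin.consEquiv fun _ : Fin (2 * j + 1 + 1) => Fin K)
    rw [pow_succ', MulMemClass.coe_mul, ih, h1, ← E.sum_comp, Fintype.sum_prod_type,
      Finset.sum_mul]
    refine Finset.sum_congr rfl fun p _ => ?_
    rw [Fintype.sum_prod_type, Finset.sum_mul]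
    refine Finset.sum_congr rfl fun q _ => ?_
    rw [Finset.mul_sum]
    refine Finset.sum_congr rfl fun f _ => ?_
    rw [Fin.prod_univ_succ, smul_mul_smul_comm]
    congr 1
    rw [mul_assoc]
    show _ = ExteriorAlgebra.ιMulti ℂ (2 * j + 1 + 1) _
    rw [ExteriorAlgebra.ιMulti_succ_apply, ExteriorAlgebra.ιMulti_succ_apply]
    rfl

/-- The Pfaffian as a Berezin integral. -/
theorem pfaffian_eq_berezin {K : ℕ} (hK : Even K) (X : Matrix (Fin K) (Fin K) ℂ) :
    pfaffian X = (1 / ((2 : ℂ) ^ (K / 2) * ((K / 2)! : ℂ))) *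
      berezin K ((grassQuad X ^ (K / 2) : GrassCenter K) : ExteriorAlgebra ℂ (Fin K → ℂ)) := by
  have h2 : 2 * (K / 2) = K := Nat.two_mul_div_two_of_even hK
  rw [pfaffian, grassQuad_pow, map_sum]
  congr 1
  have h := sum_fun_eq_sum_perm (1 : Matrix (Fin K) (Fin K) ℂ) fun f =>
    ∏ i : Fin (K / 2), X (f ⟨2 * (i : ℕ), by have := i.isLt; omega⟩)
          (f ⟨2 * (i : ℕ) + 1, by have := i.isLt; omega⟩)
  rw [Matrix.det_one, one_mul] at h
  rw [← h]
  refine Fintype.sum_equiv ((finCongr h2.symm).arrowCongr (Equiv.refl _)) _ _ fun f => ?_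
  rw [map_smul, smul_eq_mul, berezin_ιMulti h2]
  congr 1
  rw [← Matrix.det_transpose]
  congr 1
  ext i k
  simp [Matrix.one_apply, Pi.single_apply]

/-! ### The dual representation -/

section Duality

variable {k N M : ℕ}

/-- The bilinear `ψ_a · ψ_b`, summed over the row index of the random matrix, where the generators `ψ`
belong to the first diagonal block of `sourceBlock`. -/
def rowBilinear (k N M : ℕ) (a b : Fin k) : GrassCenter (k * N + k * M) :=
  ∑ i : Fin N, grassPair (blockEquiv k N M (Sum.inl (a, i))) (blockEquiv k N M (Sum.inl (b, i)))

/-- The bilinear `χ_a · χ_b`, summed over the column index of the random matrix, where the generators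
`χ` belong to the second diagonal block of `sourceBlock`. -/
def colBilinear (k N M : ℕ) (a b : Fin k) : GrassCenter (k * N + k * M) :=
  ∑ i : Fin M, grassPair (blockEquiv k N M (Sum.inr (a, i))) (blockEquiv k N M (Sum.inr (b, i)))

/-- The bilinear `∑ₐ ψ_a χ_a` that multiplies an entry of the random matrix. -/
def entryBilinear (k N M : ℕ) (x : Fin N × Fin M) : GrassCenter (k * N + k * M) :=
  ∑ a : Fin k, grassPair (blockEquiv k N M (Sum.inl (a, x.1))) (blockEquiv k N M (Sum.inr (a, x.2)))

lemma rowBilinear_swap (a b : Fin k) : rowBilinear k N M a b = - rowBilinear k N M b a := by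
  simp only [rowBilinear, ← Finset.sum_neg_distrib, ← grassPair_swap]

lemma colBilinear_swap (a b : Fin k) : colBilinear k N M a b = - colBilinear k N M b a := by
  simp only [colBilinear, ← Finset.sum_neg_distrib, ← grassPair_swap]

/-- The exchange of the two ways of pairing four Grassmann variables. -/
lemma sum_entryBilinear_sq : ∑ x, entryBilinear k N M x ^ 2 =
    -∑ a, ∑ b, colBilinear k N M a b * rowBilinear k N M a b := by
  have h : ∀ i j, entryBilinear k N M (i, j) ^ 2 = -∑ a, ∑ b,
      grassPair (blockEquiv k N M (Sum.inl (a, i))) (blockEquiv k N M (Sum.inl (b, i))) *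
        grassPair (blockEquiv k N M (Sum.inr (a, j))) (blockEquiv k N M (Sum.inr (b, j))) := by
    intro i j
    rw [pow_two, entryBilinear, Finset.sum_mul_sum, ← Finset.sum_neg_distrib]
    refine Finset.sum_congr rfl fun a _ => ?_
    rw [← Finset.sum_neg_distrib]
    exact Finset.sum_congr rfl fun b _ => grassPair_mul _ _ _ _
  rw [Fintype.sum_prod_type]
  simp only [h, Finset.sum_neg_distrib]
  congr 1
  have h2 : ∀ a b, colBilinear k N M a b * rowBilinear k N M a b = ∑ i, ∑ j,
      grassPair (blockEquiv k N M (Sum.inl (a, i))) (blockEquiv k N M (Sum.inl (b, i))) *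
        grassPair (blockEquiv k N M (Sum.inr (a, j))) (blockEquiv k N M (Sum.inr (b, j))) := by
    intro a b
    rw [mul_comm (colBilinear k N M a b), rowBilinear, colBilinear, Finset.sum_mul_sum]
  simp only [h2]
  calc _ = ∑ i, ∑ a, ∑ j, ∑ b, _ := Finset.sum_congr rfl fun i _ => Finset.sum_comm
    _ = ∑ a, ∑ i, ∑ j, ∑ b, _ := Finset.sum_comm
    _ = ∑ a, ∑ i, ∑ b, ∑ j, _ :=
      Finset.sum_congr rfl fun a _ => Finset.sum_congr rfl fun i _ => Finset.sum_comm
    _ = _ := Finset.sum_congr rfl fun a _ => Finset.sum_comm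

/-- The quadratic form of the model is linear in the source and in the random matrix. -/
lemma grassQuad_sourceBlock (J : Matrix (Fin k) (Fin k) ℂ) (A : Matrix (Fin N) (Fin M) ℂ) :
    grassQuad (Matrix.reindex (blockEquiv k N M) (blockEquiv k N M) (sourceBlock J A)) =
      (∑ a, ∑ b, Jᴴ a b • rowBilinear k N M a b + ∑ a, ∑ b, J a b • colBilinear k N M a b) +
      ∑ x : Fin N × Fin M, A x.1 x.2 • (2 : ℂ) • entryBilinear k N M x := by
  have h1 : grassQuad (Matrix.reindex (blockEquiv k N M) (blockEquiv k N M) (sourceBlock J A)) =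
      ∑ x, ∑ y, sourceBlock J A x y • grassPair (blockEquiv k N M x) (blockEquiv k N M y) := by
    rw [grassQuad, ← (blockEquiv k N M).sum_comp]
    refine Finset.sum_congr rfl fun x _ => ?_
    rw [← (blockEquiv k N M).sum_comp]
    simp
  have hA : ∀ (a b : Fin k) (i : Fin N) (j : Fin M), (1 : Matrix (Fin k) (Fin k) ℂ) a b *
      A i j = if a = b then A i j else 0 := fun a b i j => by simp [Matrix.one_apply]
  have hA' : ∀ (a b : Fin k) (i : Fin N) (j : Fin M), (1 : Matrix (Fin k) (Fin k) ℂ) a b *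
      -A i j = if a = b then -A i j else 0 := fun a b i j => by
    rw [Matrix.one_apply]; split_ifs <;> simp
  have hJ : ∀ {p : ℕ} (Y : Matrix (Fin k) (Fin k) ℂ) (a b : Fin k) (i j : Fin p),
      Y a b * (1 : Matrix (Fin p) (Fin p) ℂ) i j = if i = j then Y a b else 0 :=
    fun Y a b i j => by simp [Matrix.one_apply]
  rw [h1]
  simp only [Fintype.sum_sum_type, Fintype.sum_prod_type, sourceBlock, Matrix.fromBlocks_apply₁₁,
    Matrix.fromBlocks_apply₁₂, Matrix.fromBlocks_apply₂₁, Matrix.fromBlocks_apply₂₂,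
    Matrix.kroneckerMap_apply, Matrix.neg_apply, Matrix.transpose_apply, hA, hA', hJ, ite_smul,
    zero_smul, Finset.sum_ite_eq, Finset.mem_univ, if_true, Finset.sum_add_distrib]
  have e1 : ∑ a : Fin k, ∑ i : Fin N, ∑ b : Fin k, Jᴴ a b •
      grassPair (blockEquiv k N M (Sum.inl (a, i))) (blockEquiv k N M (Sum.inl (b, i))) =
      ∑ a, ∑ b, Jᴴ a b • rowBilinear k N M a b := by
    refine Finset.sum_congr rfl fun a _ => ?_
    rw [Finset.sum_comm]
    simp only [rowBilinear, Finset.smul_sum]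
  have e2 : ∑ a : Fin k, ∑ i : Fin M, ∑ b : Fin k, J a b •
      grassPair (blockEquiv k N M (Sum.inr (a, i))) (blockEquiv k N M (Sum.inr (b, i))) =
      ∑ a, ∑ b, J a b • colBilinear k N M a b := by
    refine Finset.sum_congr rfl fun a _ => ?_
    rw [Finset.sum_comm]
    simp only [colBilinear, Finset.smul_sum]
  have e3 : ∑ a : Fin k, ∑ i : Fin N, ∑ b : Fin k, ∑ j : Fin M, (if a = b then A i j •
      grassPair (blockEquiv k N M (Sum.inl (a, i))) (blockEquiv k N M (Sum.inr (b, j))) else 0) =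
      ∑ i, ∑ j, A i j • entryBilinear k N M (i, j) := by
    rw [Finset.sum_comm]
    refine Finset.sum_congr rfl fun i _ => ?_
    simp only [entryBilinear, Finset.smul_sum]
    rw [Finset.sum_comm (s := (Finset.univ : Finset (Fin M)))]
    refine Finset.sum_congr rfl fun a _ => ?_
    rw [Finset.sum_comm]
    simp
  have e4 : ∑ a : Fin k, ∑ j : Fin M, ∑ b : Fin k, ∑ i : Fin N, (if a = b then -A i j •
      grassPair (blockEquiv k N M (Sum.inr (a, j))) (blockEquiv k N M (Sum.inl (b, i))) else 0) =
      ∑ i, ∑ j, A i j • entryBilinear k N M (i, j) := by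
    rw [Finset.sum_comm, Finset.sum_comm (s := (Finset.univ : Finset (Fin N)))]
    refine Finset.sum_congr rfl fun j _ => ?_
    simp only [entryBilinear, Finset.smul_sum]
    rw [Finset.sum_comm (s := (Finset.univ : Finset (Fin N)))]
    refine Finset.sum_congr rfl fun a _ => ?_
    rw [Finset.sum_comm]
    refine Finset.sum_congr rfl fun i _ => ?_
    rw [grassPair_swap]
    simp
  rw [e1, e2, e3, e4]
  simp only [two_smul, smul_add, Finset.sum_add_distrib]
  abel

end Duality

/-- Currying preserves Lebesgue measure. -/
lemma measurePreserving_uncurry (p q : ℕ) :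
    MeasurePreserving (MeasurableEquiv.curry (Fin p) (Fin q) ℝ).symm := by
  refine ⟨(MeasurableEquiv.curry (Fin p) (Fin q) ℝ).symm.measurable, ?_⟩
  symm
  refine Measure.pi_eq fun s hs => ?_
  rw [MeasurableEquiv.map_apply]
  have : (MeasurableEquiv.curry (Fin p) (Fin q) ℝ).symm ⁻¹' Set.univ.pi s =
      Set.univ.pi fun i => Set.univ.pi fun j => s (i, j) := by
    ext a
    simp only [Set.mem_preimage, Set.mem_univ_pi, Prod.forall]
    rfl
  rw [this, volume_pi_pi]
  simp only [volume_pi_pi, Fintype.prod_prod_type]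

/-- The space of all complex `k × k` matrices. As a function space it carries the supremum norm; the
Frobenius norm enters through `frobSq`. -/
abbrev MatSpace (k : ℕ) : Type := Fin k → Fin k → ℂ

/-- Real and imaginary parts as coordinates on the space of complex matrices. -/
def matCoord (k : ℕ) : ((Fin k × Fin k) ⊕ (Fin k × Fin k) → ℝ) ≃L[ℝ] MatSpace k :=
  LinearEquiv.toContinuousLinearEquiv
    { toFun := fun x a b => ⟨x (Sum.inl (a, b)), x (Sum.inr (a, b))⟩
      map_add' := fun x y => rfl
      map_smul' := fun c x => by
        funext a b
        apply Complex.ext <;> simp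
      invFun := fun B => Sum.elim (fun p => (B p.1 p.2).re) fun p => (B p.1 p.2).im
      left_inv := fun x => by
        funext p
        rcases p with p | p <;> rfl
      right_inv := fun B => rfl }

lemma matCoord_apply {k : ℕ} (x : (Fin k × Fin k) ⊕ (Fin k × Fin k) → ℝ) (a b : Fin k) :
    matCoord k x a b = (x (Sum.inl (a, b)) : ℂ) + (x (Sum.inr (a, b)) : ℂ) * Complex.I :=
  Complex.mk_eq_add_mul_I _ _

/-- Lebesgue measure on the real and imaginary parts of the entries. -/
def matMeasure (k : ℕ) : Measure (MatSpace k) := Measure.map (matCoord k) volume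

instance (k : ℕ) : (matMeasure k).IsAddHaarMeasure :=
  ContinuousLinearEquiv.isAddHaarMeasure_map (matCoord k) volume

/-- The square of the Frobenius norm. -/
def frobSq {k : ℕ} (B : MatSpace k) : ℝ := ∑ a, ∑ b, ‖B a b‖ ^ 2

lemma frobSq_matCoord {k : ℕ} (x : (Fin k × Fin k) ⊕ (Fin k × Fin k) → ℝ) :
    frobSq (matCoord k x) = ∑ i, x i ^ 2 := by
  rw [Fintype.sum_sum_type, ← Finset.sum_add_distrib, Fintype.sum_prod_type, frobSq]
  refine Finset.sum_congr rfl fun a _ => Finset.sum_congr rfl fun b _ => ?_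
  rw [← Complex.normSq_eq_norm_sq, Complex.normSq_apply]
  show x (Sum.inl (a, b)) * x (Sum.inl (a, b)) + x (Sum.inr (a, b)) * x (Sum.inr (a, b)) = _
  ring

/-- Twice the antisymmetric part. -/
def antisymPart {k : ℕ} (B : MatSpace k) : Matrix (Fin k) (Fin k) ℂ :=
  Matrix.of B - (Matrix.of B)ᵀ

lemma isAntisymm_antisymPart {k : ℕ} (B : MatSpace k) : IsAntisymm (antisymPart B) := by
  simp [IsAntisymm, antisymPart]

lemma pfBlock_even {n N : ℕ} (M : ℕ) : Even ((n + n) * N + (n + n) * M) := by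
  rw [← mul_add]
  exact (Even.add_self n).mul_right _

section

variable {k N M : ℕ}

lemma sum_antisymPart_row (B : MatSpace k) :
    ∑ a, ∑ b, (antisymPart B)ᴴ a b • rowBilinear k N M a b =
      -∑ a, ∑ b, ((2 : ℂ) * starRingEnd ℂ (B a b)) • rowBilinear k N M a b := by
  have h1 : ∀ a b, (antisymPart B)ᴴ a b • rowBilinear k N M a b =
      -((starRingEnd ℂ (B b a) : ℂ) • rowBilinear k N M b a) -
        (starRingEnd ℂ (B a b) : ℂ) • rowBilinear k N M a b := fun a b => by
    rw [rowBilinear_swap b a, antisymPart, Matrix.conjTranspose_apply, Matrix.sub_apply,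
      Matrix.transpose_apply, Matrix.of_apply, Matrix.of_apply, star_sub, sub_smul, smul_neg]
    exact congrArg₂ (· - ·) (neg_neg _).symm rfl
  simp only [h1, Finset.sum_sub_distrib, Finset.sum_neg_distrib, mul_smul, two_smul,
    Finset.sum_add_distrib]
  rw [Finset.sum_comm]
  abel

lemma sum_antisymPart_col (B : MatSpace k) :
    ∑ a, ∑ b, (antisymPart B) a b • colBilinear k N M a b =
      ∑ a, ∑ b, ((2 : ℂ) * B a b) • colBilinear k N M a b := by
  have h1 : ∀ a b, (antisymPart B) a b • colBilinear k N M a b =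
      B a b • colBilinear k N M a b + B b a • colBilinear k N M b a := fun a b => by
    rw [colBilinear_swap b a, antisymPart, Matrix.sub_apply, Matrix.transpose_apply,
      Matrix.of_apply, Matrix.of_apply, sub_smul, smul_neg, sub_eq_add_neg]
  simp only [h1, mul_smul, two_smul, Finset.sum_add_distrib]
  rw [Finset.sum_comm (f := fun a b => B b a • colBilinear k N M b a)]

/-- The directions in which the real and imaginary parts of `B` enter the quadratic form. -/
def dualDirection (k N M : ℕ) : (Fin k × Fin k) ⊕ (Fin k × Fin k) → GrassCenter (k * N + k * M) :=
  Sum.elim (fun p => (2 : ℂ) • (colBilinear k N M p.1 p.2 - rowBilinear k N M p.1 p.2))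
    fun p => (2 * Complex.I) • (colBilinear k N M p.1 p.2 + rowBilinear k N M p.1 p.2)

lemma sum_dualDirection (x : (Fin k × Fin k) ⊕ (Fin k × Fin k) → ℝ) :
    ∑ i, (x i : ℂ) • dualDirection k N M i =
      ∑ a, ∑ b, (antisymPart (matCoord k x))ᴴ a b • rowBilinear k N M a b +
      ∑ a, ∑ b, antisymPart (matCoord k x) a b • colBilinear k N M a b := by
  rw [sum_antisymPart_row, sum_antisymPart_col, Fintype.sum_sum_type, Fintype.sum_prod_type,
    Fintype.sum_prod_type]
  simp only [← Finset.sum_neg_distrib, ← Finset.sum_add_distrib]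
  refine Finset.sum_congr rfl fun a _ => Finset.sum_congr rfl fun b _ => ?_
  simp only [dualDirection, Sum.elim_inl, Sum.elim_inr, matCoord_apply, map_add, map_mul,
    Complex.conj_ofReal, Complex.conj_I]
  module

lemma sq_add_sq_smul {R : Type*} [CommRing R] [Algebra ℂ R] (c r : R) :
    ((2 : ℂ) • (c - r)) ^ 2 + ((2 * Complex.I) • (c + r)) ^ 2 = (-16 : ℂ) • (c * r) := by
  simp only [smul_pow, mul_pow, Complex.I_sq]
  simp only [Algebra.smul_def]
  simp only [map_mul, map_pow, map_neg, map_one, map_ofNat]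
  ring

lemma smul_neg_covariance {E : Type*} [AddCommGroup E] [Module ℂ E] {N : ℝ} (hN : 0 < N) (x : E) :
    ((N⁻¹ : ℝ) : ℂ) • ((2 : ℂ) ^ 2 • -x) = (((4 * N)⁻¹ : ℝ) : ℂ) • (-16 : ℂ) • x := by
  have : (N : ℂ) ≠ 0 := by exact_mod_cast hN.ne'
  rw [← neg_one_smul ℂ x, smul_smul, smul_smul, smul_smul]
  congr 1
  push_cast
  field_simp
  norm_num

/-- The covariance of the dual variable, which by `sum_entryBilinear_sq` is proportional to that of the
entries of the random matrix. -/
lemma sum_dualDirection_sq :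
    ∑ i, dualDirection k N M i ^ 2 =
      (-16 : ℂ) • ∑ a, ∑ b, colBilinear k N M a b * rowBilinear k N M a b := by
  rw [Fintype.sum_sum_type, Fintype.sum_prod_type, Fintype.sum_prod_type]
  simp only [Finset.smul_sum, ← Finset.sum_add_distrib]
  refine Finset.sum_congr rfl fun a _ => Finset.sum_congr rfl fun b _ => ?_
  exact sq_add_sq_smul _ _

end

/-- The dual representation: the integral over the real matrix `A` is an integral over complex
antisymmetric matrices `B - Bᵀ` of the size of the source. -/
theorem gRMT_eq_dual {n N : ℕ} {ν : ℤ} (hN : 0 < N) (J : Matrix (Fin (n + n)) (Fin (n + n)) ℂ) :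
    ((Real.sqrt (Real.pi / (4 * N)) ^
        Fintype.card ((Fin (n + n) × Fin (n + n)) ⊕ (Fin (n + n) × Fin (n + n))) : ℝ) : ℂ) *
      gRMT n N ν J =
    ((Real.sqrt (Real.pi / N) ^ Fintype.card (Fin N × Fin (dimR N ν)) : ℝ) : ℂ) *
      ∫ B, (Real.exp (-(4 * N) * frobSq B) : ℂ) *
        pfaffian (pfBlock (J + antisymPart B) (0 : RealMat N ν)) ∂(matMeasure (n + n)) := by
  have hN' : (0 : ℝ) < N := by exact_mod_cast hN
  set K := (n + n) * N + (n + n) * dimR N ν with hK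
  -- both sides are Gaussian averages of `l` applied to a power of an affine form in the generators
  set l : GrassCenter K →ₗ[ℂ] ℂ := ((1 / ((2 : ℂ) ^ (K / 2) * ((K / 2)! : ℂ))) • berezin K) ∘ₗ
    (GrassCenter K).val.toLinearMap with hl
  have hpf : ∀ (Y : Matrix (Fin (n + n)) (Fin (n + n)) ℂ) (a : RealMat N ν),
      pfaffian (pfBlock Y a) = l (grassQuad (pfBlock Y a) ^ (K / 2)) := fun Y a => by
    rw [pfaffian_eq_berezin (pfBlock_even _)]
    rfl
  set r : GrassCenter K := grassQuad (pfBlock J (0 : RealMat N ν)) with hr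
  have hr' : r = ∑ a, ∑ b, Jᴴ a b • rowBilinear (n + n) N (dimR N ν) a b +
      ∑ a, ∑ b, J a b • colBilinear (n + n) N (dimR N ν) a b := by
    rw [hr, pfBlock_eq, grassQuad_sourceBlock]
    simp [cMat]
  -- the variances `1 / N` and `1 / (4 N)` make the two covariances equal
  have key := integral_gauss_eq_of_covariance (c := (N : ℝ)) (c' := 4 * (N : ℝ)) hN'
    (by positivity) l (fun x => (2 : ℂ) • entryBilinear (n + n) N (dimR N ν) x)
    (dualDirection (n + n) N (dimR N ν)) (by
      simp only [smul_pow, ← Finset.smul_sum]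
      rw [sum_dualDirection_sq, sum_entryBilinear_sq]
      exact smul_neg_covariance (E := GrassCenter K) hN' _) r (K / 2)
  have hA : gRMT n N ν J = ∫ x : Fin N × Fin (dimR N ν) → ℝ,
      (Real.exp (-(N : ℝ) * ∑ i, x i ^ 2) : ℂ) *
        l ((r + ∑ i, (x i : ℂ) • (2 : ℂ) • entryBilinear (n + n) N (dimR N ν) i) ^ (K / 2)) := by
    rw [gRMT, ← (measurePreserving_uncurry N (dimR N ν)).integral_comp'
      (g := fun x : Fin N × Fin (dimR N ν) → ℝ => (Real.exp (-(N : ℝ) * ∑ i, x i ^ 2) : ℂ) *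
        l ((r + ∑ i, (x i : ℂ) • (2 : ℂ) • entryBilinear (n + n) N (dimR N ν) i) ^ (K / 2)))]
    refine integral_congr_ae (Eventually.of_forall fun a => ?_)
    have hg : gaussWeight a =
        Real.exp (-(N : ℝ) * ∑ i, (MeasurableEquiv.curry (Fin N) (Fin (dimR N ν)) ℝ).symm a i ^ 2) := by
      rw [gaussWeight_eq, Fintype.sum_prod_type]
      rfl
    simp only [rmtIntegrand]
    rw [hg, hpf, pfBlock_eq, grassQuad_sourceBlock, ← hr']
    rfl
  have hB : ∫ B, (Real.exp (-(4 * N) * frobSq B) : ℂ) *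
        pfaffian (pfBlock (J + antisymPart B) (0 : RealMat N ν)) ∂(matMeasure (n + n)) =
      ∫ x : (Fin (n + n) × Fin (n + n)) ⊕ (Fin (n + n) × Fin (n + n)) → ℝ,
        (Real.exp (-(4 * (N : ℝ)) * ∑ i, x i ^ 2) : ℂ) *
        l ((r + ∑ i, (x i : ℂ) • dualDirection (n + n) N (dimR N ν) i) ^ (K / 2)) := by
    refine ((matCoord (n + n)).toHomeomorph.measurableEmbedding.integral_map _).trans ?_
    refine integral_congr_ae (Eventually.of_forall fun x => ?_)
    simp only [ContinuousLinearEquiv.coe_toHomeomorph]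
    rw [frobSq_matCoord, hpf, pfBlock_eq, grassQuad_sourceBlock, sum_dualDirection, hr']
    congr 3
    simp only [Matrix.conjTranspose_add, Matrix.add_apply, add_smul, Finset.sum_add_distrib]
    simp [cMat]
    abel
  rw [hA, hB]
  exact key

/-! ### The dual integrand as a power of a fixed weight -/

lemma chiralPow_mul (ν : ℤ) (z w : ℂ) : chiralPow ν (z * w) = chiralPow ν z * chiralPow ν w := by
  unfold chiralPow
  split_ifs
  · exact mul_pow _ _ _
  · rw [map_mul, mul_pow]

lemma chiralPow_one (ν : ℤ) : chiralPow ν 1 = 1 := by simp [chiralPow]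

lemma chiralPow_prod (ν : ℤ) {ι : Type*} (s : Finset ι) (z : ι → ℂ) :
    chiralPow ν (∏ i ∈ s, z i) = ∏ i ∈ s, chiralPow ν (z i) := by
  classical
  induction s using Finset.induction_on with
  | empty => simp [chiralPow_one]
  | insert a s ha ih => rw [Finset.prod_insert ha, Finset.prod_insert ha, chiralPow_mul, ih]

lemma chiralPow_ofReal (ν : ℤ) (x : ℝ) : chiralPow ν (x : ℂ) = (x : ℂ) ^ ν.natAbs := by
  unfold chiralPow
  rw [Complex.conj_ofReal, ite_self]

lemma norm_chiralPow (ν : ℤ) (z : ℂ) : ‖chiralPow ν z‖ = ‖z‖ ^ ν.natAbs := by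
  unfold chiralPow
  split_ifs
  · rw [norm_pow]
  · rw [norm_pow, RCLike.norm_conj]

lemma stdSign_mul_self (m : ℕ) : stdSign m * stdSign m = 1 := by
  rw [stdSign, ← mul_pow]
  norm_num

lemma norm_stdSign (m : ℕ) : ‖stdSign m‖ = 1 := by simp [stdSign]

lemma pfaffian_normalForm {n : ℕ} (U : Matrix (Fin (n + n)) (Fin (n + n)) ℂ) (j : Fin n → ℂ) :
    pfaffian (U * offDiag (Matrix.diagonal j) * Uᵀ) = U.det * (stdSign n * ∏ f, j f) := by
  rw [pfaffian_congr (Even.add_self n), pfaffian_offDiag, Matrix.det_diagonal]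

lemma norm_pfaffian_normalForm {n : ℕ} {U : Matrix (Fin (n + n)) (Fin (n + n)) ℂ}
    (hU : U ∈ Matrix.unitaryGroup (Fin (n + n)) ℂ) (j : Fin n → ℂ) :
    ‖pfaffian (U * offDiag (Matrix.diagonal j) * Uᵀ)‖ = ∏ f, ‖j f‖ := by
  rw [pfaffian_normalForm, norm_mul, norm_mul, norm_det_of_unitary hU, norm_stdSign, norm_prod,
    one_mul, one_mul]

lemma gramDet_zero {N : ℕ} {ν : ℤ} (h : 0 ≤ (N : ℤ) + ν) (z : ℂ) :
    gramDet z (0 : RealMat N ν) = ((‖z‖ ^ 2 : ℝ) : ℂ) ^ (N - (-ν).toNat) := by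
  have h0 : cMat (0 : RealMat N ν) = 0 := by
    ext i j
    simp [cMat]
  unfold gramDet
  rw [h0]
  split_ifs with hν
  · rw [Matrix.zero_mul, zero_add, Matrix.det_smul, Matrix.det_one, mul_one, Fintype.card_fin]
    congr 1
    omega
  · rw [Matrix.mul_zero, zero_add, Matrix.det_smul, Matrix.det_one, mul_one, Fintype.card_fin]
    congr 1
    unfold dimR
    omega

/-- In the absence of `A`, the Pfaffian is a function of the Pfaffian of the source. -/
lemma pfaffian_pfBlock_zero {n N : ℕ} {ν : ℤ} (h : 0 ≤ (N : ℤ) + ν)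
    {Y : Matrix (Fin (n + n)) (Fin (n + n)) ℂ} (hY : IsAntisymm Y) :
    pfaffian (pfBlock Y (0 : RealMat N ν)) = orderSign n N ν *
      chiralPow ν (stdSign n * pfaffian Y) * ((‖pfaffian Y‖ ^ 2 : ℝ) : ℂ) ^ (N - (-ν).toNat) := by
  obtain ⟨U, hU, j, rfl⟩ := exists_unitary_normalForm hY
  rw [pfaffian_pfBlock_normalForm h hU, norm_pfaffian_normalForm hU, pfaffian_normalForm]
  have h1 : stdSign n * (U.det * (stdSign n * ∏ f, j f)) = U.det * ∏ f, j f := by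
    linear_combination (U.det * ∏ f, j f) * stdSign_mul_self n
  rw [h1, chiralPow_mul, chiralPow_prod, Finset.prod_mul_distrib]
  simp only [gramDet_zero h]
  rw [← Finset.prod_pow, Complex.ofReal_prod, ← Finset.prod_pow]
  ring

/-- The real part of `tr (X† B)`. -/
def rePair {k : ℕ} (X : Matrix (Fin k) (Fin k) ℂ) (B : MatSpace k) : ℝ :=
  (Xᴴ * Matrix.of B).trace.re

lemma rePair_eq {k : ℕ} (X : Matrix (Fin k) (Fin k) ℂ) (B : MatSpace k) :
    rePair X B = ∑ a, ∑ b, (starRingEnd ℂ (X a b) * B a b).re := by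
  rw [rePair, Matrix.trace, Complex.re_sum, Finset.sum_comm]
  refine Finset.sum_congr rfl fun b _ => ?_
  rw [Matrix.diag_apply, Matrix.mul_apply, Complex.re_sum]
  rfl

lemma frobSq_sub_smul {k : ℕ} (B : MatSpace k) (c : ℝ) (X : Matrix (Fin k) (Fin k) ℂ) :
    frobSq (B - (c : ℂ) • Matrix.of.symm X) =
      frobSq B - 2 * c * rePair X B + c ^ 2 * frobSq (Matrix.of.symm X) := by
  rw [rePair_eq, frobSq, frobSq, frobSq, Finset.mul_sum, Finset.mul_sum,
    ← Finset.sum_sub_distrib, ← Finset.sum_add_distrib]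
  refine Finset.sum_congr rfl fun a _ => ?_
  rw [Finset.mul_sum, Finset.mul_sum, ← Finset.sum_sub_distrib, ← Finset.sum_add_distrib]
  refine Finset.sum_congr rfl fun b _ => ?_
  simp only [← Complex.normSq_eq_norm_sq, Complex.normSq_apply]
  simp
  ring

/-- The weight whose powers carry the dependence on `N` of the dual integral. -/
def peakWeight {n : ℕ} (B : MatSpace (n + n)) : ℝ :=
  ‖pfaffian (antisymPart B)‖ ^ 2 * Real.exp (-4 * frobSq B)

/-- The factor of the dual integrand that does not depend on `N`. -/
def peakFactor {n : ℕ} (ν : ℤ) (X : Matrix (Fin (n + n)) (Fin (n + n)) ℂ)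
    (B : MatSpace (n + n)) : ℂ :=
  chiralPow ν (stdSign n * pfaffian (antisymPart B)) *
    (Real.exp (-4 * (-ν).toNat * frobSq B) : ℂ) *
    (Real.exp (2 * Real.sqrt 2 * rePair X B) : ℂ)

lemma antisymPart_sub {k : ℕ} (B C : MatSpace k) :
    antisymPart (B - C) = antisymPart B - antisymPart C := by
  ext a b
  simp [antisymPart]
  ring

lemma antisymPart_smul_of_isAntisymm {k : ℕ} (c : ℂ) {X : Matrix (Fin k) (Fin k) ℂ}
    (hX : IsAntisymm X) : antisymPart (c • Matrix.of.symm X) = (2 * c) • X := by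
  ext a b
  have h : X b a = -X a b := congrFun (congrFun hX a) b
  show c • X a b - c • X b a = (2 * c) • X a b
  rw [h]
  simp
  ring

lemma IsAntisymm.smul {k : ℕ} {X : Matrix (Fin k) (Fin k) ℂ} (hX : IsAntisymm X) (c : ℂ) :
    IsAntisymm (c • X) := by
  rw [IsAntisymm, Matrix.transpose_smul, hX, smul_neg]

/-- In the scaling limit of the source, the shift of `B` that absorbs the source into `antisymPart B`
turns the dual integrand into a power of a fixed weight times a factor that does not depend on `N`. -/
theorem gRMT_eq_peak {n N : ℕ} {ν : ℤ} (hN : 0 < N) (h : 0 ≤ (N : ℤ) + ν)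
    {X : Matrix (Fin (n + n)) (Fin (n + n)) ℂ} (hX : IsAntisymm X) :
    ((Real.sqrt (Real.pi / (4 * N)) ^
        Fintype.card ((Fin (n + n) × Fin (n + n)) ⊕ (Fin (n + n) × Fin (n + n))) : ℝ) : ℂ) *
      gRMT n N ν (((1 / (Real.sqrt 2 * N) : ℝ) : ℂ) • X) =
    ((Real.sqrt (Real.pi / N) ^ Fintype.card (Fin N × Fin (dimR N ν)) : ℝ) : ℂ) *
      orderSign n N ν * (Real.exp (-(frobSq (Matrix.of.symm X) / (2 * N))) : ℂ) *
      ∫ B, (peakWeight B ^ (N - (-ν).toNat) : ℝ) * peakFactor ν X B ∂(matMeasure (n + n)) := by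
  have hN' : (0 : ℝ) < N := by exact_mod_cast hN
  rw [gRMT_eq_dual hN, mul_assoc, mul_assoc]
  congr 1
  -- the shift `B ↦ B - c X` removes the source, as `antisymPart (c X) = 2 c X`
  set c : ℝ := 1 / (2 * (Real.sqrt 2 * N)) with hc
  have hs : Real.sqrt 2 * Real.sqrt 2 = 2 := Real.mul_self_sqrt (by norm_num)
  have hs0 : 0 < Real.sqrt 2 := by positivity
  have hcN : 8 * N * c = 2 * Real.sqrt 2 := by
    rw [hc]
    field_simp
    nlinarith
  have hcN2 : 4 * N * c ^ 2 = 1 / (2 * N) := by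
    rw [hc]
    field_simp
    nlinarith
  rw [← integral_sub_right_eq_self _ ((c : ℂ) • Matrix.of.symm X),
    ← mul_assoc, ← integral_const_mul]
  refine integral_congr_ae (Eventually.of_forall fun B => ?_)
  simp only
  have h1 : ((1 / (Real.sqrt 2 * N) : ℝ) : ℂ) • X +
      antisymPart (B - (c : ℂ) • Matrix.of.symm X) = antisymPart B := by
    rw [antisymPart_sub, antisymPart_smul_of_isAntisymm _ hX]
    have : (2 * (c : ℂ)) = ((1 / (Real.sqrt 2 * N) : ℝ) : ℂ) := by
      rw [hc]
      push_cast
      field_simp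
    rw [this]
    abel
  rw [h1, pfaffian_pfBlock_zero h (isAntisymm_antisymPart B), frobSq_sub_smul]
  -- one power of the weight uses up `exp (-4 frobSq B)`; for `ν < 0` a surplus `|ν|` is left over
  have h2 : (N : ℝ) = ((N - (-ν).toNat : ℕ) : ℝ) + ((-ν).toNat : ℝ) := by
    rw [← Nat.cast_add]
    congr 1
    omega
  have h3 : Real.exp (-(4 * N) * (frobSq B - 2 * c * rePair X B + c ^ 2 * frobSq (Matrix.of.symm X))) =
      Real.exp (-4 * frobSq B) ^ (N - (-ν).toNat) * Real.exp (-4 * (-ν).toNat * frobSq B) *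
        Real.exp (2 * Real.sqrt 2 * rePair X B) * Real.exp (-(frobSq (Matrix.of.symm X) / (2 * N))) := by
    rw [← Real.exp_nat_mul, ← Real.exp_add, ← Real.exp_add, ← Real.exp_add, ← hcN]
    congr 1
    have h4 : frobSq (Matrix.of.symm X) / (2 * N) = 4 * N * c ^ 2 * frobSq (Matrix.of.symm X) := by rw [hcN2]; ring
    rw [h4]
    linear_combination -4 * frobSq B * h2
  rw [h3, peakWeight, peakFactor]
  push_cast
  ring

/-! ### Concentration of powers of a weight -/

/-- Laplace's principle for a weight whose maximum may be attained on a large set: if `F` is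
constant on that set, the averages of `F` with respect to high powers of `w` tend to its value. -/
theorem tendsto_integral_pow_mul_div {E : Type*} [TopologicalSpace E] [MeasurableSpace E]
    [BorelSpace E] {μ : Measure E} [μ.IsOpenPosMeasure] {w : E → ℝ} {F : E → ℂ}
    (hw : Continuous w) (hF : Continuous F) (hw0 : ∀ x, 0 ≤ w x)
    {x₀ : E} (hx₀ : 0 < w x₀) (hmax : ∀ x, w x ≤ w x₀) (hlim : Tendsto w (cocompact E) (𝓝 0))
    (hint : ∀ m : ℕ, 0 < m → Integrable (fun x => w x ^ m) μ)
    (hintF : ∀ m : ℕ, 0 < m → Integrable (fun x => ((w x ^ m : ℝ) : ℂ) * F x) μ)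
    {c : ℂ} (hc : ∀ x, w x = w x₀ → F x = c) :
    Tendsto (fun m : ℕ => (∫ x, ((w x ^ m : ℝ) : ℂ) * F x ∂μ) / ((∫ x, w x ^ m ∂μ : ℝ) : ℂ))
      atTop (𝓝 c) := by
  -- lower bounds for the normalization
  have hlow : ∀ t, 0 < t → t < w x₀ → 0 < μ.real {x | t ≤ w x} ∧
      ∀ m : ℕ, 0 < m → t ^ m * μ.real {x | t ≤ w x} ≤ ∫ x, w x ^ m ∂μ := by
    intro t ht htx
    have hset : ∀ m : ℕ, 0 < m → {x | t ≤ w x} = {x | t ^ m ≤ w x ^ m} := fun m hm => by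
      ext x
      exact (pow_le_pow_iff_left₀ ht.le (hw0 x) hm.ne').symm
    constructor
    · refine ENNReal.toReal_pos ?_ ?_
      · have hopen : IsOpen {x | t < w x} := isOpen_lt continuous_const hw
        exact (lt_of_lt_of_le (hopen.measure_pos μ ⟨x₀, htx⟩)
          (measure_mono fun x (hx : t < w x) => hx.le)).ne'
      · have h1 := (hint 1 one_pos).measure_ge_lt_top ht
        simpa using h1.ne
    · intro m hm
      rw [hset m hm]
      exact mul_meas_ge_le_integral_of_nonneg (Eventually.of_forall fun x => pow_nonneg (hw0 x) m)
        (hint m hm) _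
  have hpos : ∀ m : ℕ, 0 < m → 0 < ∫ x, w x ^ m ∂μ := fun m hm => by
    obtain ⟨h1, h2⟩ := hlow (w x₀ / 2) (by linarith) (by linarith)
    exact lt_of_lt_of_le (by positivity) (h2 m hm)
  set G : E → ℂ := fun x => F x - c with hG
  have hGc : Continuous G := hF.sub continuous_const
  have hintG : ∀ m : ℕ, 0 < m → Integrable (fun x => ((w x ^ m : ℝ) : ℂ) * G x) μ := fun m hm => by
    have := (hintF m hm).sub ((hint m hm).ofReal.mul_const c)
    refine this.congr (Eventually.of_forall fun x => ?_)
    simp only [hG, Pi.sub_apply, mul_sub]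
    rfl
  have hintG' : ∀ m : ℕ, 0 < m → Integrable (fun x => w x ^ m * ‖G x‖) μ := fun m hm => by
    refine (hintG m hm).norm.congr (Eventually.of_forall fun x => ?_)
    simp only [norm_mul, Complex.norm_real, norm_pow, Real.norm_of_nonneg (hw0 x)]
  -- it suffices that the averages of `‖F - c‖` tend to zero
  have key : Tendsto (fun m : ℕ => (∫ x, w x ^ m * ‖G x‖ ∂μ) / ∫ x, w x ^ m ∂μ) atTop (𝓝 0) := by
    rw [Metric.tendsto_atTop]
    intro ε hε
    -- where `w > η` the deviation of `F` is small: the remaining set of large deviation and large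
    -- weight is compact, so that `w` stays below its maximum there
    obtain ⟨η, hη0, hη1, hη⟩ : ∃ η, 0 < η ∧ η < w x₀ ∧ ∀ x, η < w x → ‖G x‖ ≤ ε / 2 := by
      have hK1 : IsClosed ({x | w x₀ / 2 ≤ w x} ∩ {x | ε / 2 ≤ ‖G x‖}) :=
        (isClosed_le continuous_const hw).inter (isClosed_le continuous_const hGc.norm)
      have hev : ∀ᶠ x in cocompact E, w x < w x₀ / 2 := hlim.eventually_lt_const (by linarith)
      obtain ⟨T, hT, hTs⟩ := mem_cocompact.mp hev
      have hK : IsCompact ({x | w x₀ / 2 ≤ w x} ∩ {x | ε / 2 ≤ ‖G x‖}) := by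
        refine hT.of_isClosed_subset hK1 fun x hx => ?_
        by_contra hxT
        exact (not_lt.mpr hx.1) (show w x < w x₀ / 2 from hTs hxT)
      rcases Set.eq_empty_or_nonempty ({x | w x₀ / 2 ≤ w x} ∩ {x | ε / 2 ≤ ‖G x‖}) with he | he
      · refine ⟨w x₀ / 2, by linarith, by linarith, fun x hx => ?_⟩
        by_contra hx'
        have : x ∈ ({x | w x₀ / 2 ≤ w x} ∩ {x | ε / 2 ≤ ‖G x‖}) := ⟨hx.le, (not_le.mp hx').le⟩
        rw [he] at this
        exact this
      · obtain ⟨y, hy, hymax⟩ := hK.exists_isMaxOn he hw.continuousOn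
        have hy1 : w y < w x₀ := by
          refine lt_of_le_of_ne (hmax y) fun h => ?_
          have h2 : ε / 2 ≤ ‖G y‖ := hy.2
          rw [hG] at h2
          simp only [hc y h, sub_self, norm_zero] at h2
          linarith
        refine ⟨w y, lt_of_lt_of_le (by linarith) hy.1, hy1, fun x hx => ?_⟩
        by_contra hx'
        have hxK : x ∈ ({x | w x₀ / 2 ≤ w x} ∩ {x | ε / 2 ≤ ‖G x‖}) :=
          ⟨le_trans hy.1 hx.le, (not_le.mp hx').le⟩
        exact absurd (hymax hxK) (not_le.mpr hx)
    set t := (η + w x₀) / 2 with ht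
    have ht0 : 0 < t := by linarith
    obtain ⟨hv, hvm⟩ := hlow t ht0 (by linarith)
    set v := μ.real {x | t ≤ w x}
    set C := ∫ x, w x ^ 1 * ‖G x‖ ∂μ with hC
    have hC0 : 0 ≤ C := integral_nonneg fun x => mul_nonneg (pow_nonneg (hw0 x) _) (norm_nonneg _)
    have hr : Tendsto (fun m : ℕ => C / (t * v) * (η / t) ^ m) atTop (𝓝 0) := by
      have := (tendsto_pow_atTop_nhds_zero_of_lt_one (r := η / t) (by positivity)
        ((div_lt_one ht0).mpr (by linarith))).const_mul (C / (t * v))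
      simpa using this
    obtain ⟨m₀, hm₀⟩ := (Metric.tendsto_atTop.mp hr) (ε / 2) (by linarith)
    refine ⟨m₀ + 1, fun m hm => ?_⟩
    obtain ⟨m, rfl⟩ : ∃ q, m = q + 1 := ⟨m - 1, by omega⟩
    have hm' := hm₀ m (by omega)
    -- the rest contributes at most `η ^ m * C`, exponentially less than the normalization, which is
    -- at least `t ^ (m + 1) * v` with `t > η`
    have hup : ∫ x, w x ^ (m + 1) * ‖G x‖ ∂μ ≤
        ε / 2 * (∫ x, w x ^ (m + 1) ∂μ) + η ^ m * C := by
      rw [hC, ← integral_const_mul, ← integral_const_mul, ← integral_add]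
      · refine integral_mono (hintG' _ m.succ_pos) ?_ fun x => ?_
        · exact ((hint _ m.succ_pos).const_mul _).add ((hintG' 1 one_pos).const_mul _)
        · rcases lt_or_ge η (w x) with hx | hx
          · have h1 := mul_le_mul_of_nonneg_left (hη x hx) (pow_nonneg (hw0 x) (m + 1))
            have h2 : 0 ≤ η ^ m * (w x ^ 1 * ‖G x‖) := mul_nonneg (by positivity)
              (mul_nonneg (pow_nonneg (hw0 x) _) (norm_nonneg _))
            simp only
            linarith
          · have h1 : w x ^ m ≤ η ^ m := pow_le_pow_left₀ (hw0 x) hx m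
            have h2 : 0 ≤ w x ^ 1 * ‖G x‖ := mul_nonneg (pow_nonneg (hw0 x) _) (norm_nonneg _)
            have h3 := mul_le_mul_of_nonneg_right h1 h2
            have h4 : 0 ≤ ε / 2 * w x ^ (m + 1) := mul_nonneg (by linarith) (pow_nonneg (hw0 x) _)
            simp only
            rw [pow_succ, mul_assoc]
            rw [pow_one] at h3 ⊢
            rw [pow_succ] at h4
            linarith
      · exact (hint _ m.succ_pos).const_mul _
      · exact (hintG' 1 one_pos).const_mul _
    have hI := hpos (m + 1) m.succ_pos
    have h0 : 0 ≤ ∫ x, w x ^ (m + 1) * ‖G x‖ ∂μ :=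
      integral_nonneg fun x => mul_nonneg (pow_nonneg (hw0 x) _) (norm_nonneg _)
    rw [Real.dist_eq, sub_zero, abs_of_nonneg (div_nonneg h0 hI.le), div_lt_iff₀ hI]
    rw [Real.dist_eq, sub_zero, abs_of_nonneg (by positivity)] at hm'
    have h5 : η ^ m * C = (C / (t * v) * (η / t) ^ m) * (t ^ (m + 1) * v) := by
      rw [div_pow, pow_succ]
      field_simp
    have h6 := mul_le_mul_of_nonneg_left (hvm (m + 1) m.succ_pos)
      (show 0 ≤ C / (t * v) * (η / t) ^ m by positivity)
    have h7 := mul_lt_mul_of_pos_right hm' hI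
    nlinarith
  rw [tendsto_iff_norm_sub_tendsto_zero]
  refine squeeze_zero' (Eventually.of_forall fun m => norm_nonneg _) ?_ key
  filter_upwards [eventually_gt_atTop 0] with m hm
  have hI := hpos m hm
  have hI' : ((∫ x, w x ^ m ∂μ : ℝ) : ℂ) ≠ 0 := by exact_mod_cast hI.ne'
  have h1 : (∫ x, ((w x ^ m : ℝ) : ℂ) * F x ∂μ) / ((∫ x, w x ^ m ∂μ : ℝ) : ℂ) - c =
      (∫ x, ((w x ^ m : ℝ) : ℂ) * G x ∂μ) / ((∫ x, w x ^ m ∂μ : ℝ) : ℂ) := by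
    have : ∫ x, ((w x ^ m : ℝ) : ℂ) * G x ∂μ =
        ∫ x, ((w x ^ m : ℝ) : ℂ) * F x ∂μ - ((∫ x, w x ^ m ∂μ : ℝ) : ℂ) * c := by
      rw [← integral_complex_ofReal, ← integral_mul_const]
      refine Eq.trans ?_ (integral_sub (hintF m hm) ((hint m hm).ofReal.mul_const c))
      exact integral_congr_ae (Eventually.of_forall fun x => mul_sub _ _ _)
    rw [this]
    field_simp
  rw [h1, norm_div, Complex.norm_real, Real.norm_of_nonneg hI.le]
  refine div_le_div_of_nonneg_right ?_ hI.le
  refine (norm_integral_le_integral_norm _).trans (le_of_eq ?_)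
  refine integral_congr_ae (Eventually.of_forall fun x => ?_)
  simp only [norm_mul, Complex.norm_real, norm_pow, Real.norm_of_nonneg (hw0 x)]

/-! ### The maximum of the weight -/

lemma trace_conjTranspose_mul_self {k : ℕ} (B : MatSpace k) :
    ((Matrix.of B)ᴴ * Matrix.of B).trace = (frobSq B : ℂ) := by
  rw [Matrix.trace, frobSq, Finset.sum_comm, Complex.ofReal_sum]
  refine Finset.sum_congr rfl fun b _ => ?_
  rw [Matrix.diag_apply, Matrix.mul_apply, Complex.ofReal_sum]
  refine Finset.sum_congr rfl fun a _ => ?_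
  rw [← Complex.normSq_eq_norm_sq, Complex.normSq_eq_conj_mul_self]
  rfl

/-- The action `B ↦ U B Uᵀ` on complex matrices. -/
def congrMap {k : ℕ} (U : Matrix (Fin k) (Fin k) ℂ) : MatSpace k →ₗ[ℝ] MatSpace k where
  toFun B := Matrix.of.symm (U * Matrix.of B * Uᵀ)
  map_add' B C := by
    show U * (Matrix.of B + Matrix.of C) * Uᵀ = U * Matrix.of B * Uᵀ + U * Matrix.of C * Uᵀ
    rw [mul_add, add_mul]
  map_smul' c B := by
    show U * (c • Matrix.of B) * Uᵀ = c • (U * Matrix.of B * Uᵀ)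
    rw [Matrix.mul_smul, Matrix.smul_mul]

lemma of_congrMap {k : ℕ} (U : Matrix (Fin k) (Fin k) ℂ) (B : MatSpace k) :
    Matrix.of (congrMap U B) = U * Matrix.of B * Uᵀ := rfl

lemma congrMap_mul {k : ℕ} (U V : Matrix (Fin k) (Fin k) ℂ) (B : MatSpace k) :
    congrMap (U * V) B = congrMap U (congrMap V B) := by
  apply Matrix.of.injective
  simp only [of_congrMap, Matrix.transpose_mul, mul_assoc]

lemma congrMap_one {k : ℕ} (B : MatSpace k) : congrMap 1 B = B := by
  apply Matrix.of.injective
  rw [of_congrMap, Matrix.transpose_one, one_mul, mul_one]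

lemma antisymPart_congrMap {k : ℕ} (U : Matrix (Fin k) (Fin k) ℂ) (B : MatSpace k) :
    antisymPart (congrMap U B) = U * antisymPart B * Uᵀ := by
  rw [antisymPart, of_congrMap, antisymPart, Matrix.mul_sub, Matrix.sub_mul,
    Matrix.transpose_mul, Matrix.transpose_mul, Matrix.transpose_transpose, mul_assoc, mul_assoc]

lemma transpose_mul_conjTranspose_of_unitary {k : ℕ} {U : Matrix (Fin k) (Fin k) ℂ}
    (hU : U ∈ Matrix.unitaryGroup (Fin k) ℂ) : Uᵀ * Uᵀᴴ = 1 := by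
  have h := congrArg Matrix.transpose (Matrix.mem_unitaryGroup_iff'.mp hU)
  rwa [Matrix.star_eq_conjTranspose, Matrix.transpose_mul, Matrix.transpose_one] at h

lemma frobSq_congrMap {k : ℕ} {U : Matrix (Fin k) (Fin k) ℂ}
    (hU : U ∈ Matrix.unitaryGroup (Fin k) ℂ) (B : MatSpace k) :
    frobSq (congrMap U B) = frobSq B := by
  have h : (frobSq (congrMap U B) : ℂ) = frobSq B := by
    rw [← trace_conjTranspose_mul_self, ← trace_conjTranspose_mul_self, of_congrMap,
      Matrix.conjTranspose_mul, Matrix.conjTranspose_mul]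
    have hU' : Uᴴ * U = 1 := Matrix.mem_unitaryGroup_iff'.mp hU
    calc (Uᵀᴴ * ((Matrix.of B)ᴴ * Uᴴ) * (U * Matrix.of B * Uᵀ)).trace
        = (Uᵀᴴ * ((Matrix.of B)ᴴ * (Uᴴ * U) * Matrix.of B * Uᵀ)).trace := by
          simp only [mul_assoc]
      _ = (((Matrix.of B)ᴴ * Matrix.of B) * (Uᵀ * Uᵀᴴ)).trace := by
          rw [hU', mul_one, Matrix.trace_mul_comm, mul_assoc]
      _ = _ := by rw [transpose_mul_conjTranspose_of_unitary hU, mul_one]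
  exact_mod_cast h

lemma norm_pfaffian_congr {n : ℕ} {U : Matrix (Fin (n + n)) (Fin (n + n)) ℂ}
    (hU : U ∈ Matrix.unitaryGroup (Fin (n + n)) ℂ) (Y : Matrix (Fin (n + n)) (Fin (n + n)) ℂ) :
    ‖pfaffian (U * Y * Uᵀ)‖ = ‖pfaffian Y‖ := by
  rw [pfaffian_congr (Even.add_self n), norm_mul, norm_det_of_unitary hU, one_mul]

lemma peakWeight_congrMap {n : ℕ} {U : Matrix (Fin (n + n)) (Fin (n + n)) ℂ}
    (hU : U ∈ Matrix.unitaryGroup (Fin (n + n)) ℂ) (B : MatSpace (n + n)) :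
    peakWeight (congrMap U B) = peakWeight B := by
  rw [peakWeight, peakWeight, antisymPart_congrMap, norm_pfaffian_congr hU, frobSq_congrMap hU]

lemma frobSq_nonneg {k : ℕ} (B : MatSpace k) : 0 ≤ frobSq B := by
  unfold frobSq
  positivity

lemma frobSq_eq_zero {k : ℕ} {B : MatSpace k} (h : frobSq B = 0) : B = 0 := by
  unfold frobSq at h
  funext a b
  have h1 := (Finset.sum_eq_zero_iff_of_nonneg fun a _ => by positivity).mp h a (Finset.mem_univ a)
  have h2 := (Finset.sum_eq_zero_iff_of_nonneg fun b _ => by positivity).mp h1 b (Finset.mem_univ b)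
  simpa using h2

/-- The decomposition of the Frobenius norm into symmetric and antisymmetric parts. -/
lemma four_mul_frobSq {k : ℕ} (B : MatSpace k) :
    4 * frobSq B = frobSq (Matrix.of.symm (antisymPart B)) + frobSq (B + fun a b => B b a) := by
  have h1 : ∀ a b, ‖B a b - B b a‖ ^ 2 + ‖B a b + B b a‖ ^ 2 =
      2 * ‖B a b‖ ^ 2 + 2 * ‖B b a‖ ^ 2 := fun a b => by
    simp only [← Complex.normSq_eq_norm_sq, Complex.normSq_apply, Complex.sub_re, Complex.sub_im,
      Complex.add_re, Complex.add_im]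
    ring
  have h2 : ∑ a, ∑ b, ‖B b a‖ ^ 2 = frobSq B := Finset.sum_comm
  have h3 : frobSq (Matrix.of.symm (antisymPart B)) + frobSq (B + fun a b => B b a) =
      ∑ a, ∑ b, (‖B a b - B b a‖ ^ 2 + ‖B a b + B b a‖ ^ 2) := by
    simp only [Finset.sum_add_distrib]
    rfl
  rw [h3]
  simp only [h1, Finset.sum_add_distrib, ← Finset.mul_sum]
  rw [h2]
  show 4 * frobSq B = 2 * frobSq B + 2 * frobSq B
  ring

lemma frobSq_offDiag {n : ℕ} (j : Fin n → ℂ) :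
    frobSq (Matrix.of.symm (offDiag (Matrix.diagonal j))) = 2 * ∑ f, ‖j f‖ ^ 2 := by
  have h : ∀ (p q : Fin n ⊕ Fin n), Matrix.of.symm (offDiag (Matrix.diagonal j))
      (finSumFinEquiv p) (finSumFinEquiv q) =
      Matrix.fromBlocks 0 (Matrix.diagonal j) (-(Matrix.diagonal j)ᵀ) 0 p q := fun p q => by
    show offDiag (Matrix.diagonal j) (finSumFinEquiv p) (finSumFinEquiv q) = _
    simp [offDiag]
  rw [frobSq, ← finSumFinEquiv.sum_comp]
  simp only [← finSumFinEquiv.sum_comp, h, Fintype.sum_sum_type]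
  have hd : ∀ a : Fin n, ∑ b, ‖Matrix.diagonal j a b‖ ^ 2 = ‖j a‖ ^ 2 := fun a => by
    rw [Finset.sum_eq_single a (fun b _ hb => by simp [Matrix.diagonal_apply_ne' _ hb])
      (fun h => absurd (Finset.mem_univ a) h), Matrix.diagonal_apply_eq]
  simp only [Matrix.fromBlocks_apply₁₁, Matrix.fromBlocks_apply₁₂, Matrix.fromBlocks_apply₂₁,
    Matrix.fromBlocks_apply₂₂, Matrix.zero_apply, Matrix.neg_apply, Matrix.diagonal_transpose,
    norm_neg, norm_zero, hd]
  simp [two_mul]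

lemma mul_exp_neg_le (t : ℝ) : t * Real.exp (-2 * t) ≤ 1 / 2 * Real.exp (-1) := by
  have h := Real.add_one_le_exp (2 * t - 1)
  have h2 : Real.exp (-1) = Real.exp (2 * t - 1) * Real.exp (-2 * t) := by
    rw [← Real.exp_add]
    congr 1
    ring
  rw [h2]
  nlinarith [Real.exp_pos (-2 * t)]

lemma eq_half_of_mul_exp_neg {t : ℝ} (ht : t * Real.exp (-2 * t) = 1 / 2 * Real.exp (-1)) :
    t = 1 / 2 := by
  by_contra hne
  have h := Real.add_one_lt_exp (x := 2 * t - 1) fun h => hne (by linarith)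
  have h2 : Real.exp (-1) = Real.exp (2 * t - 1) * Real.exp (-2 * t) := by
    rw [← Real.exp_add]
    congr 1
    ring
  rw [h2] at ht
  nlinarith [Real.exp_pos (-2 * t)]

/-- The point `(2√2)⁻¹ I`, at which the weight is maximal. -/
def peakPoint (n : ℕ) : MatSpace (n + n) :=
  Matrix.of.symm (((1 / (2 * Real.sqrt 2) : ℝ) : ℂ) • symplecticI n)

lemma isAntisymm_offDiag {n : ℕ} (K : Matrix (Fin n) (Fin n) ℂ) : IsAntisymm (offDiag K) := by
  rw [IsAntisymm, offDiag, Matrix.transpose_reindex, Matrix.fromBlocks_transpose]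
  ext a b
  simp only [Matrix.reindex_apply, Matrix.submatrix_apply, Matrix.neg_apply]
  rcases finSumFinEquiv.symm a with p | p <;> rcases finSumFinEquiv.symm b with q | q <;> simp

lemma antisymPart_peakPoint (n : ℕ) :
    antisymPart (peakPoint n) = ((1 / Real.sqrt 2 : ℝ) : ℂ) • symplecticI n := by
  have h := antisymPart_smul_of_isAntisymm ((1 / (2 * Real.sqrt 2) : ℝ) : ℂ)
    (isAntisymm_offDiag (-1 : Matrix (Fin n) (Fin n) ℂ))
  refine h.trans ?_
  rw [symplecticI]
  congr 1
  push_cast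
  field_simp

lemma offDiag_smul {n : ℕ} (c : ℂ) (K : Matrix (Fin n) (Fin n) ℂ) :
    offDiag (c • K) = c • offDiag K := by
  ext a b
  rw [offDiag, offDiag, Matrix.smul_apply, Matrix.reindex_apply,
    Matrix.submatrix_apply, Matrix.reindex_apply, Matrix.submatrix_apply]
  rcases finSumFinEquiv.symm a with p | p <;> rcases finSumFinEquiv.symm b with q | q <;> simp

lemma smul_symplecticI {n : ℕ} (c : ℂ) :
    c • symplecticI n = offDiag (Matrix.diagonal fun _ : Fin n => -c) := by
  rw [symplecticI, ← offDiag_smul]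
  congr 1
  ext p q
  rw [Matrix.smul_apply, Matrix.neg_apply, Matrix.one_apply, Matrix.diagonal_apply]
  split_ifs <;> simp

lemma pfaffian_symplecticI (n : ℕ) : pfaffian (symplecticI n) = stdSign n * (-1) ^ n := by
  rw [symplecticI, pfaffian_offDiag, Matrix.det_neg, Matrix.det_one, mul_one, Fintype.card_fin]

/-- The weight in terms of the normal form of the antisymmetric part. -/
lemma peakWeight_eq {n : ℕ} {U : Matrix (Fin (n + n)) (Fin (n + n)) ℂ}
    (hU : U ∈ Matrix.unitaryGroup (Fin (n + n)) ℂ) {j : Fin n → ℂ} {B : MatSpace (n + n)}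
    (hB : antisymPart B = U * offDiag (Matrix.diagonal j) * Uᵀ) :
    peakWeight B = (∏ f, ‖j f‖ ^ 2 * Real.exp (-2 * ‖j f‖ ^ 2)) *
      Real.exp (-frobSq (B + fun a b => B b a)) := by
  have h : frobSq (Matrix.of.symm (antisymPart B)) = 2 * ∑ f, ‖j f‖ ^ 2 := by
    rw [hB, ← frobSq_offDiag]
    exact frobSq_congrMap hU _
  rw [peakWeight, neg_mul, four_mul_frobSq, h, hB, norm_pfaffian_normalForm hU, ← Finset.prod_pow,
    Finset.prod_mul_distrib, ← Real.exp_sum, mul_assoc, ← Real.exp_add, ← Finset.mul_sum]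
  congr 2
  ring

lemma peakWeight_nonneg {n : ℕ} (B : MatSpace (n + n)) : 0 ≤ peakWeight B := by
  unfold peakWeight
  positivity

lemma peakWeight_le {n : ℕ} (B : MatSpace (n + n)) :
    peakWeight B ≤ (1 / 2 * Real.exp (-1)) ^ n := by
  obtain ⟨U, hU, j, hj⟩ := exists_unitary_normalForm (isAntisymm_antisymPart B)
  rw [peakWeight_eq hU hj]
  have h1 : ∏ f : Fin n, ‖j f‖ ^ 2 * Real.exp (-2 * ‖j f‖ ^ 2) ≤ (1 / 2 * Real.exp (-1)) ^ n := by
    have := Finset.prod_le_prod (s := (Finset.univ : Finset (Fin n)))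
      (f := fun f => ‖j f‖ ^ 2 * Real.exp (-2 * ‖j f‖ ^ 2)) (g := fun _ => 1 / 2 * Real.exp (-1))
      (fun f _ => by positivity) fun f _ => mul_exp_neg_le _
    simpa using this
  have h2 : Real.exp (-frobSq (B + fun a b => B b a)) ≤ 1 :=
    Real.exp_le_one_iff.mpr (neg_nonpos.mpr (frobSq_nonneg _))
  calc _ ≤ (1 / 2 * Real.exp (-1)) ^ n * 1 := mul_le_mul h1 h2 (by positivity) (by positivity)
    _ = _ := mul_one _

/-- The weight is maximal exactly on the orbit of `peakPoint n` under the unitary group. -/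
lemma exists_congrMap_peakPoint {n : ℕ} {B : MatSpace (n + n)}
    (hB : peakWeight B = (1 / 2 * Real.exp (-1)) ^ n) :
    ∃ U ∈ Matrix.unitaryGroup (Fin (n + n)) ℂ, B = congrMap U (peakPoint n) := by
  obtain ⟨U, hU, j, hj⟩ := exists_unitary_normalForm (isAntisymm_antisymPart B)
  rw [peakWeight_eq hU hj] at hB
  set P := ∏ f : Fin n, ‖j f‖ ^ 2 * Real.exp (-2 * ‖j f‖ ^ 2) with hP
  have hP0 : 0 ≤ P := Finset.prod_nonneg fun f _ => by positivity
  have hM : 0 < (1 / 2 * Real.exp (-1)) ^ n := by positivity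
  have h1 : P ≤ (1 / 2 * Real.exp (-1)) ^ n := by
    rw [hP]
    have := Finset.prod_le_prod (s := (Finset.univ : Finset (Fin n)))
      (f := fun f => ‖j f‖ ^ 2 * Real.exp (-2 * ‖j f‖ ^ 2)) (g := fun _ => 1 / 2 * Real.exp (-1))
      (fun f _ => by positivity) fun f _ => mul_exp_neg_le _
    simpa using this
  have h2 : Real.exp (-frobSq (B + fun a b => B b a)) ≤ 1 :=
    Real.exp_le_one_iff.mpr (neg_nonpos.mpr (frobSq_nonneg _))
  have hPpos : 0 < P := by
    refine lt_of_le_of_ne hP0 fun h => ?_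
    rw [← h, zero_mul] at hB
    exact hM.ne hB
  -- the symmetric part vanishes
  have hs : frobSq (B + fun a b => B b a) = 0 := by
    have h3 : Real.exp (-frobSq (B + fun a b => B b a)) = 1 := by
      refine le_antisymm h2 ?_
      by_contra hlt
      push Not at hlt
      have := mul_lt_mul_of_pos_left hlt hPpos
      linarith
    have := Real.exp_eq_one_iff _ |>.mp h3
    linarith
  have hs' := frobSq_eq_zero hs
  have hBQ : Matrix.of B = (1 / 2 : ℂ) • antisymPart B := by
    ext a b
    have h4 : B a b + B b a = 0 := congrFun (congrFun hs' a) b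
    show B a b = (1 / 2 : ℂ) • (B a b - B b a)
    rw [smul_eq_mul]
    linear_combination (1 / 2 : ℂ) * h4
  -- every `‖j f‖ ^ 2` maximizes its factor
  rw [hs, neg_zero, Real.exp_zero, mul_one] at hB
  have hj2 : ∀ f, ‖j f‖ ^ 2 = 1 / 2 := by
    intro f
    refine eq_half_of_mul_exp_neg (le_antisymm (mul_exp_neg_le _) ?_)
    by_contra hlt
    push Not at hlt
    have hne : ∀ g ∈ Finset.univ, 0 < ‖j g‖ ^ 2 * Real.exp (-2 * ‖j g‖ ^ 2) := fun g _ => by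
      refine lt_of_le_of_ne (by positivity) fun h => ?_
      rw [hP, Finset.prod_eq_zero (Finset.mem_univ g) h.symm] at hPpos
      exact lt_irrefl _ hPpos
    have := Finset.prod_lt_prod hne (g := fun _ => 1 / 2 * Real.exp (-1))
      (fun g _ => mul_exp_neg_le _) ⟨f, Finset.mem_univ f, hlt⟩
    rw [Finset.prod_const, Finset.card_univ, Fintype.card_fin] at this
    exact this.ne hB
  set s : ℝ := Real.sqrt 2 with hs2
  have hss : s * s = 2 := Real.mul_self_sqrt (by norm_num)
  have hs0 : 0 < s := by rw [hs2]; positivity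
  -- the phases of the `j f` are absorbed into the unitary matrix
  let D : Matrix (Fin n) (Fin n) ℂ := Matrix.diagonal fun f => -(s : ℂ) * j f
  have hD : D ∈ Matrix.unitaryGroup (Fin n) ℂ := diagonal_mem_unitary fun f => by
    rw [norm_mul, norm_neg, Complex.norm_real, Real.norm_of_nonneg hs0.le]
    have h5 : (s * ‖j f‖) ^ 2 = 1 := by
      rw [mul_pow, hj2, sq, hss]
      norm_num
    nlinarith [norm_nonneg (j f), mul_nonneg hs0.le (norm_nonneg (j f))]
  set R := Matrix.reindex finSumFinEquiv finSumFinEquiv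
    (Matrix.fromBlocks D 0 0 (1 : Matrix (Fin n) (Fin n) ℂ)) with hR
  have hRu : R ∈ Matrix.unitaryGroup (Fin (n + n)) ℂ := blockDiag_mem_unitary hD (one_mem _)
  refine ⟨U * R, mul_mem hU hRu, ?_⟩
  apply Matrix.of.injective
  rw [of_congrMap, hBQ, hj]
  have h6 : R * offDiag (Matrix.diagonal fun _ : Fin n => -((1 / (2 * s) : ℝ) : ℂ)) * Rᵀ =
      (1 / 2 : ℂ) • offDiag (Matrix.diagonal j) := by
    rw [hR, ← offDiag_congr]
    have h7 : D * (Matrix.diagonal fun _ : Fin n => -((1 / (2 * s) : ℝ) : ℂ)) *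
        (1 : Matrix (Fin n) (Fin n) ℂ)ᵀ = (1 / 2 : ℂ) • Matrix.diagonal j := by
      rw [Matrix.transpose_one, mul_one, Matrix.diagonal_mul_diagonal, ← Matrix.diagonal_smul]
      congr 1
      funext f
      have : (s : ℂ) ≠ 0 := by exact_mod_cast hs0.ne'
      simp only [Pi.smul_apply, smul_eq_mul]
      push_cast
      field_simp
    rw [h7, offDiag_smul]
  have h8 : Matrix.of (peakPoint n) =
      offDiag (Matrix.diagonal fun _ : Fin n => -((1 / (2 * s) : ℝ) : ℂ)) := smul_symplecticI _
  rw [h8, Matrix.transpose_mul]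
  calc (1 / 2 : ℂ) • (U * offDiag (Matrix.diagonal j) * Uᵀ)
      = U * ((1 / 2 : ℂ) • offDiag (Matrix.diagonal j)) * Uᵀ := by
        rw [Matrix.mul_smul, Matrix.smul_mul]
    _ = _ := by
        rw [← h6]
        simp only [mul_assoc]

lemma peakWeight_peakPoint (n : ℕ) : peakWeight (peakPoint n) = (1 / 2 * Real.exp (-1)) ^ n := by
  have hs : Real.sqrt 2 ^ 2 = 2 := Real.sq_sqrt (by norm_num)
  have hj : antisymPart (peakPoint n) = (1 : Matrix (Fin (n + n)) (Fin (n + n)) ℂ) *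
      offDiag (Matrix.diagonal fun _ : Fin n => -((1 / Real.sqrt 2 : ℝ) : ℂ)) * 1ᵀ := by
    rw [Matrix.transpose_one, one_mul, mul_one, antisymPart_peakPoint, smul_symplecticI]
  have hn : ‖-((1 / Real.sqrt 2 : ℝ) : ℂ)‖ ^ 2 = 1 / 2 := by
    rw [norm_neg, Complex.norm_real, Real.norm_eq_abs, sq_abs, div_pow, hs, one_pow]
  have h0 : (peakPoint n + fun a b => peakPoint n b a) = 0 := by
    funext a b
    have := congrFun (congrFun (isAntisymm_offDiag (-1 : Matrix (Fin n) (Fin n) ℂ)) a) b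
    show ((1 / (2 * Real.sqrt 2) : ℝ) : ℂ) • symplecticI n a b +
      ((1 / (2 * Real.sqrt 2) : ℝ) : ℂ) • symplecticI n b a = 0
    rw [← smul_add]
    have h1 : symplecticI n b a = - symplecticI n a b := this
    rw [h1, add_neg_cancel, smul_zero]
  rw [peakWeight_eq (one_mem _) hj, h0]
  simp only [hn]
  simp [frobSq]

/-! ### The unitary group and its action on matrices -/

instance instHaarU (k : ℕ) : (haarU k).IsHaarMeasure := by
  unfold haarU
  infer_instance

instance instProbabilityHaarU (k : ℕ) : IsProbabilityMeasure (haarU k) := by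
  refine ⟨?_⟩
  have := Measure.haarMeasure_self
    (K₀ := (⊤ : TopologicalSpace.PositiveCompacts (Matrix.unitaryGroup (Fin k) ℂ)))
  simpa [haarU] using this

/-- The compact group `U(k)` is unimodular. -/
instance instRightInvariantHaarU (k : ℕ) : (haarU k).IsMulRightInvariant := by
  refine ⟨fun V => ?_⟩
  have hV : Measurable fun U : Matrix.unitaryGroup (Fin k) ℂ => U * V :=
    (continuous_mul_const V).measurable
  have hleft : (Measure.map (fun U => U * V) (haarU k)).IsMulLeftInvariant := by
    refine ⟨fun W => ?_⟩
    rw [Measure.map_map (continuous_const_mul W).measurable hV]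
    have : (fun U => W * U) ∘ (fun U => U * V) = (fun U => U * V) ∘ fun U => W * U := by
      funext U
      simp [mul_assoc]
    rw [this, ← Measure.map_map hV (continuous_const_mul W).measurable, map_mul_left_eq_self]
  have hprob : IsProbabilityMeasure (Measure.map (fun U => U * V) (haarU k)) :=
    Measure.isProbabilityMeasure_map hV.aemeasurable
  have h := Measure.isMulInvariant_eq_smul_of_compactSpace
    (Measure.map (fun U => U * V) (haarU k)) (haarU k)
  have h1 := congrArg (fun μ : Measure _ => μ Set.univ) h
  simp only [measure_univ, Measure.smul_apply, ENNReal.smul_def, smul_eq_mul, mul_one] at h1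
  have h2 : (Measure.map (fun U => U * V) (haarU k)).haarScalarFactor (haarU k) = 1 := by
    exact_mod_cast h1.symm
  rw [h, h2, one_smul]

lemma norm_sq_le_frobSq {k : ℕ} (B : MatSpace k) : ‖B‖ ^ 2 ≤ frobSq B := by
  have h1 : ‖B‖ ≤ Real.sqrt (frobSq B) := by
    refine (pi_norm_le_iff_of_nonneg (Real.sqrt_nonneg _)).mpr fun i =>
      (pi_norm_le_iff_of_nonneg (Real.sqrt_nonneg _)).mpr fun j => Real.le_sqrt_of_sq_le ?_
    calc ‖B i j‖ ^ 2 ≤ ∑ j, ‖B i j‖ ^ 2 :=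
          Finset.single_le_sum (f := fun j => ‖B i j‖ ^ 2) (fun _ _ => by positivity)
            (Finset.mem_univ j)
      _ ≤ frobSq B := Finset.single_le_sum (f := fun i => ∑ j, ‖B i j‖ ^ 2)
            (fun _ _ => by positivity) (Finset.mem_univ i)
  calc ‖B‖ ^ 2 ≤ Real.sqrt (frobSq B) ^ 2 := pow_le_pow_left₀ (norm_nonneg _) h1 2
    _ = frobSq B := Real.sq_sqrt (frobSq_nonneg B)

lemma continuous_frobSq {k : ℕ} : Continuous (frobSq (k := k)) := by
  unfold frobSq
  fun_prop

lemma integrable_exp_neg_frobSq {k : ℕ} {c : ℝ} (hc : 0 < c) {f : MatSpace k → ℂ}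
    (hf : ExpBdd f) : Integrable (fun B => (Real.exp (-c * frobSq B) : ℂ) * f B) (matMeasure k) := by
  refine hf.integrable_mul (C := 1) (by have := continuous_frobSq (k := k); fun_prop) hc fun B => ?_
  rw [Complex.norm_real, Real.norm_of_nonneg (Real.exp_pos _).le, one_mul]
  exact Real.exp_le_exp.mpr (by nlinarith [norm_sq_le_frobSq B])

/-- Lebesgue measure on matrices is invariant under `B ↦ U B Uᵀ` for unitary `U`: the map is
linear and preserves a Gaussian, so that its Jacobian is one. -/
lemma measurePreserving_congrMap {k : ℕ} {U : Matrix (Fin k) (Fin k) ℂ}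
    (hU : U ∈ Matrix.unitaryGroup (Fin k) ℂ) :
    MeasurePreserving (congrMap U) (matMeasure k) (matMeasure k) := by
  have hUU : Uᴴ * U = 1 := Matrix.mem_unitaryGroup_iff'.mp hU
  have hcont : Continuous (congrMap U) := LinearMap.continuous_of_finiteDimensional _
  have hdet : LinearMap.det (congrMap U) ≠ 0 := by
    have h : congrMap Uᴴ ∘ₗ congrMap U = LinearMap.id := by
      refine LinearMap.ext fun B => ?_
      rw [LinearMap.comp_apply, ← congrMap_mul, hUU, congrMap_one, LinearMap.id_apply]
    have h2 := congrArg LinearMap.det h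
    rw [LinearMap.det_comp, LinearMap.det_id] at h2
    exact right_ne_zero_of_mul_eq_one h2
  have hmap := Measure.map_linearMap_addHaar_eq_smul_addHaar (matMeasure k) hdet
  have hint : Integrable (fun B => Real.exp (-1 * frobSq B)) (matMeasure k) := by
    have := (integrable_exp_neg_frobSq (k := k) one_pos (ExpBdd.const 1)).re
    refine this.congr (Eventually.of_forall fun B => ?_)
    simp only [mul_one]
    exact Complex.ofReal_re _
  have hpos : 0 < ∫ B, Real.exp (-1 * frobSq B) ∂(matMeasure k) := integral_exp_pos hint
  have h1 : ∫ B, Real.exp (-1 * frobSq B) ∂(Measure.map (congrMap U) (matMeasure k)) =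
      ∫ B, Real.exp (-1 * frobSq B) ∂(matMeasure k) := by
    rw [integral_map hcont.measurable.aemeasurable
      (by have := continuous_frobSq (k := k); fun_prop)]
    simp only [frobSq_congrMap hU]
  rw [hmap, integral_smul_measure, ENNReal.toReal_ofReal (abs_nonneg _), smul_eq_mul] at h1
  have h2 : |(LinearMap.det (congrMap U))⁻¹| = 1 := by
    have : (|(LinearMap.det (congrMap U))⁻¹| - 1) *
        ∫ B, Real.exp (-1 * frobSq B) ∂(matMeasure k) = 0 := by
      rw [sub_mul, one_mul, h1, sub_self]
    have := (mul_eq_zero.mp this).resolve_right hpos.ne'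
    linarith
  refine ⟨hcont.measurable, ?_⟩
  rw [hmap, h2, ENNReal.ofReal_one, one_smul]

lemma measurableEmbedding_congrMap {k : ℕ} {U : Matrix (Fin k) (Fin k) ℂ}
    (hU : U ∈ Matrix.unitaryGroup (Fin k) ℂ) : MeasurableEmbedding (congrMap U) := by
  have hUU : Uᴴ * U = 1 := Matrix.mem_unitaryGroup_iff'.mp hU
  refine (LinearMap.continuous_of_finiteDimensional (congrMap U)).measurableEmbedding ?_
  intro B C h
  have := congrArg (congrMap Uᴴ) h
  rwa [← congrMap_mul, ← congrMap_mul, hUU, congrMap_one, congrMap_one] at this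

/-! ### Bounds on the dual integrand -/

lemma expBdd_entry {k : ℕ} (a b : Fin k) : ExpBdd fun B : MatSpace k => B a b :=
  ExpBdd.clm ((ContinuousLinearMap.proj b : (Fin k → ℂ) →L[ℝ] ℂ) ∘L
    (ContinuousLinearMap.proj a : (Fin k → Fin k → ℂ) →L[ℝ] (Fin k → ℂ)))

lemma expBdd_pfaffian_antisymPart (n : ℕ) :
    ExpBdd fun B : MatSpace (n + n) => pfaffian (antisymPart B) :=
  ExpBdd.pfaffian fun a b => (expBdd_entry a b).sub (expBdd_entry b a)

lemma ExpBdd.norm {E : Type*} [NormedAddCommGroup E] {f : E → ℂ} (hf : ExpBdd f) :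
    ExpBdd fun x => ((‖f x‖ : ℝ) : ℂ) := by
  obtain ⟨hf, C, K, hC, hK, h⟩ := hf
  exact ⟨Complex.continuous_ofReal.comp hf.norm, C, K, hC, hK, fun x => by simpa using h x⟩

lemma continuous_peakWeight (n : ℕ) : Continuous (peakWeight (n := n)) := by
  have h1 := (expBdd_pfaffian_antisymPart n).1
  have h2 := continuous_frobSq (k := n + n)
  unfold peakWeight
  fun_prop

lemma continuous_peakFactor {n : ℕ} (ν : ℤ) (X : Matrix (Fin (n + n)) (Fin (n + n)) ℂ) :
    Continuous (peakFactor ν X) := by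
  have h1 := (expBdd_pfaffian_antisymPart n).1
  have h2 := continuous_frobSq (k := n + n)
  have h3 : Continuous (rePair X) := by
    simp only [funext (rePair_eq X)]
    fun_prop
  have h4 : Continuous fun B : MatSpace (n + n) =>
      chiralPow ν (stdSign n * pfaffian (antisymPart B)) :=
    (continuous_chiralPow ν).comp (continuous_const.mul h1)
  unfold peakFactor
  fun_prop

/-- A bound on `peakFactor` that is invariant under the action of the unitary group. -/
def peakBound {n : ℕ} (ν : ℤ) (X : Matrix (Fin (n + n)) (Fin (n + n)) ℂ)
    (B : MatSpace (n + n)) : ℝ :=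
  Real.exp (2 * frobSq (Matrix.of.symm X)) *
    (‖pfaffian (antisymPart B)‖ ^ ν.natAbs * Real.exp (frobSq B))

lemma norm_peakFactor_le {n : ℕ} (ν : ℤ) (X : Matrix (Fin (n + n)) (Fin (n + n)) ℂ)
    (B : MatSpace (n + n)) : ‖peakFactor ν X B‖ ≤ peakBound ν X B := by
  have hs : Real.sqrt 2 ^ 2 = 2 := Real.sq_sqrt (by norm_num)
  have h1 : 2 * Real.sqrt 2 * rePair X B ≤ frobSq B + 2 * frobSq (Matrix.of.symm X) := by
    have h := frobSq_nonneg (B - ((Real.sqrt 2 : ℝ) : ℂ) • Matrix.of.symm X)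
    rw [frobSq_sub_smul, hs] at h
    linarith
  have h2 : Real.exp (-4 * (-ν).toNat * frobSq B) ≤ 1 := by
    refine Real.exp_le_one_iff.mpr ?_
    have : (0 : ℝ) ≤ (-ν).toNat * frobSq B := mul_nonneg (Nat.cast_nonneg _) (frobSq_nonneg B)
    linarith
  rw [peakFactor, peakBound, norm_mul, norm_mul, norm_chiralPow, norm_mul, norm_stdSign, one_mul,
    Complex.norm_real, Complex.norm_real, Real.norm_of_nonneg (Real.exp_pos _).le,
    Real.norm_of_nonneg (Real.exp_pos _).le]
  calc _ ≤ ‖pfaffian (antisymPart B)‖ ^ ν.natAbs * 1 *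
        Real.exp (frobSq B + 2 * frobSq (Matrix.of.symm X)) := by
        gcongr
    _ = _ := by
        rw [Real.exp_add]
        ring

lemma peakBound_congrMap {n : ℕ} (ν : ℤ) (X : Matrix (Fin (n + n)) (Fin (n + n)) ℂ)
    {U : Matrix (Fin (n + n)) (Fin (n + n)) ℂ} (hU : U ∈ Matrix.unitaryGroup (Fin (n + n)) ℂ)
    (B : MatSpace (n + n)) : peakBound ν X (congrMap U B) = peakBound ν X B := by
  rw [peakBound, peakBound, antisymPart_congrMap, norm_pfaffian_congr hU, frobSq_congrMap hU]

lemma integrable_norm_pfaffian_mul_exp {n : ℕ} (k : ℕ) {c : ℝ} (hc : 0 < c) :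
    Integrable (fun B : MatSpace (n + n) =>
      ‖pfaffian (antisymPart B)‖ ^ k * Real.exp (-c * frobSq B)) (matMeasure (n + n)) := by
  have := (integrable_exp_neg_frobSq hc ((expBdd_pfaffian_antisymPart n).norm.pow k)).re
  refine this.congr (Eventually.of_forall fun B => ?_)
  simp only
  rw [← Complex.ofReal_pow, ← Complex.ofReal_mul, mul_comm]
  exact Complex.ofReal_re _

lemma peakWeight_pow {n : ℕ} (m : ℕ) (B : MatSpace (n + n)) : peakWeight B ^ m =
    ‖pfaffian (antisymPart B)‖ ^ (2 * m) * Real.exp (-(4 * m) * frobSq B) := by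
  rw [peakWeight, mul_pow, ← pow_mul, ← Real.exp_nat_mul]
  congr 2
  ring

lemma integrable_peakWeight_pow {n : ℕ} {m : ℕ} (hm : 0 < m) :
    Integrable (fun B : MatSpace (n + n) => peakWeight B ^ m) (matMeasure (n + n)) := by
  simp only [peakWeight_pow]
  exact integrable_norm_pfaffian_mul_exp _ (by positivity)

lemma integrable_peakWeight_pow_mul_peakBound {n : ℕ} (ν : ℤ)
    (X : Matrix (Fin (n + n)) (Fin (n + n)) ℂ) {m : ℕ} (hm : 0 < m) :
    Integrable (fun B : MatSpace (n + n) => peakWeight B ^ m * peakBound ν X B)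
      (matMeasure (n + n)) := by
  have hm' : (1 : ℝ) ≤ m := by exact_mod_cast hm
  refine ((integrable_norm_pfaffian_mul_exp (n := n) (2 * m + ν.natAbs)
    (c := 4 * m - 1) (by linarith)).const_mul
    (Real.exp (2 * frobSq (Matrix.of.symm X)))).congr (Eventually.of_forall fun B => ?_)
  simp only
  rw [peakWeight_pow, peakBound, show -(4 * (m : ℝ) - 1) * frobSq B =
    -(4 * m) * frobSq B + frobSq B by ring, Real.exp_add, pow_add]
  ring

/-- The Gaussian factor beats the Pfaffian at infinity. -/
lemma tendsto_peakWeight_cocompact (n : ℕ) :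
    Tendsto (peakWeight (n := n)) (cocompact (MatSpace (n + n))) (𝓝 0) := by
  obtain ⟨-, C, K, hC, hK, h⟩ := expBdd_pfaffian_antisymPart n
  have hb : ∀ B : MatSpace (n + n),
      peakWeight B ≤ C ^ 2 * Real.exp (K ^ 2) * Real.exp (-(3 * ‖B‖)) * Real.exp 3 := fun B => by
    have h1 : ‖pfaffian (antisymPart B)‖ ^ 2 ≤ (C * Real.exp (K * ‖B‖)) ^ 2 :=
      pow_le_pow_left₀ (norm_nonneg _) (h B) 2
    have h2 : Real.exp (-4 * frobSq B) ≤ Real.exp (-4 * ‖B‖ ^ 2) :=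
      Real.exp_le_exp.mpr (by nlinarith [norm_sq_le_frobSq B])
    calc peakWeight B ≤ (C * Real.exp (K * ‖B‖)) ^ 2 * Real.exp (-4 * ‖B‖ ^ 2) :=
          mul_le_mul h1 h2 (Real.exp_pos _).le (by positivity)
      _ = C ^ 2 * Real.exp (2 * (K * ‖B‖) + -4 * ‖B‖ ^ 2) := by
          rw [mul_pow, ← Real.exp_nat_mul, Real.exp_add]
          push_cast
          ring
      _ ≤ C ^ 2 * Real.exp (K ^ 2 + -(3 * ‖B‖) + 3) := by
          refine mul_le_mul_of_nonneg_left (Real.exp_le_exp.mpr ?_) (by positivity)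
          nlinarith [sq_nonneg (K - ‖B‖), sq_nonneg (‖B‖ - 1)]
      _ = _ := by
          rw [Real.exp_add, Real.exp_add]
          ring
  refine squeeze_zero peakWeight_nonneg hb ?_
  have h1 : Tendsto (fun B : MatSpace (n + n) => Real.exp (-(3 * ‖B‖)))
      (cocompact (MatSpace (n + n))) (𝓝 0) :=
    Real.tendsto_exp_neg_atTop_nhds_zero.comp
      ((tendsto_norm_cocompact_atTop).const_mul_atTop (by norm_num))
  simpa using (h1.const_mul (C ^ 2 * Real.exp (K ^ 2))).mul_const (Real.exp 3)

/-! ### Averaging over the unitary group -/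

/-- The average of `peakFactor` over the orbits of the unitary group. -/
def orbitAverage {n : ℕ} (ν : ℤ) (X : Matrix (Fin (n + n)) (Fin (n + n)) ℂ)
    (B : MatSpace (n + n)) : ℂ :=
  ∫ U : Matrix.unitaryGroup (Fin (n + n)) ℂ,
    peakFactor ν X (congrMap (U : Matrix (Fin (n + n)) (Fin (n + n)) ℂ) B) ∂(haarU (n + n))

lemma continuous_peakFactor_congrMap {n : ℕ} (ν : ℤ) (X : Matrix (Fin (n + n)) (Fin (n + n)) ℂ) :
    Continuous fun p : MatSpace (n + n) × Matrix.unitaryGroup (Fin (n + n)) ℂ =>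
      peakFactor ν X (congrMap (p.2 : Matrix (Fin (n + n)) (Fin (n + n)) ℂ) p.1) := by
  have h : Continuous fun p : MatSpace (n + n) × Matrix.unitaryGroup (Fin (n + n)) ℂ =>
      (p.2 : Matrix (Fin (n + n)) (Fin (n + n)) ℂ) * Matrix.of p.1 *
        (p.2 : Matrix (Fin (n + n)) (Fin (n + n)) ℂ)ᵀ := by
    have h1 : Continuous fun p : MatSpace (n + n) × Matrix.unitaryGroup (Fin (n + n)) ℂ =>
      (p.2 : Matrix (Fin (n + n)) (Fin (n + n)) ℂ) := continuous_subtype_val.comp continuous_snd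
    have h2 : Continuous fun p : MatSpace (n + n) × Matrix.unitaryGroup (Fin (n + n)) ℂ =>
      (Matrix.of p.1 : Matrix (Fin (n + n)) (Fin (n + n)) ℂ) := continuous_fst
    exact (h1.matrix_mul h2).matrix_mul h1.matrix_transpose
  exact (continuous_peakFactor ν X).comp h

lemma continuous_orbitAverage {n : ℕ} (ν : ℤ) (X : Matrix (Fin (n + n)) (Fin (n + n)) ℂ) :
    Continuous (orbitAverage ν X) := by
  have := continuous_parametric_integral_of_continuous (μ := haarU (n + n))
    (f := fun (B : MatSpace (n + n)) (U : Matrix.unitaryGroup (Fin (n + n)) ℂ) =>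
      peakFactor ν X (congrMap (U : Matrix (Fin (n + n)) (Fin (n + n)) ℂ) B))
    (continuous_peakFactor_congrMap ν X) isCompact_univ
  simp only [Measure.restrict_univ] at this
  exact this

lemma norm_orbitAverage_le {n : ℕ} (ν : ℤ) (X : Matrix (Fin (n + n)) (Fin (n + n)) ℂ)
    (B : MatSpace (n + n)) : ‖orbitAverage ν X B‖ ≤ peakBound ν X B := by
  have := norm_integral_le_of_norm_le_const (μ := haarU (n + n)) (C := peakBound ν X B)
    (f := fun U : Matrix.unitaryGroup (Fin (n + n)) ℂ =>
      peakFactor ν X (congrMap (U : Matrix (Fin (n + n)) (Fin (n + n)) ℂ) B))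
    (Eventually.of_forall fun U => by
      rw [← peakBound_congrMap ν X U.2 B]
      exact norm_peakFactor_le ν X _)
  simpa [orbitAverage] using this

lemma integrable_peakWeight_pow_mul {n : ℕ} {ν : ℤ} {X : Matrix (Fin (n + n)) (Fin (n + n)) ℂ}
    {f : MatSpace (n + n) → ℂ} (hf : Continuous f) (hb : ∀ B, ‖f B‖ ≤ peakBound ν X B) {m : ℕ}
    (hm : 0 < m) :
    Integrable (fun B => ((peakWeight B ^ m : ℝ) : ℂ) * f B) (matMeasure (n + n)) := by
  have hc := continuous_peakWeight n
  refine (integrable_peakWeight_pow_mul_peakBound ν X hm).mono' (by fun_prop)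
    (Eventually.of_forall fun B => ?_)
  rw [norm_mul, Complex.norm_real, Real.norm_of_nonneg (pow_nonneg (peakWeight_nonneg B) m)]
  exact mul_le_mul_of_nonneg_left (hb B) (pow_nonneg (peakWeight_nonneg B) m)

/-- Since the measure and the weight are invariant under the unitary group, the other factor may be
averaged over it. -/
lemma integral_peakFactor_eq_orbitAverage {n : ℕ} (ν : ℤ)
    (X : Matrix (Fin (n + n)) (Fin (n + n)) ℂ) {m : ℕ} (hm : 0 < m) :
    ∫ B, ((peakWeight B ^ m : ℝ) : ℂ) * peakFactor ν X B ∂(matMeasure (n + n)) =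
      ∫ B, ((peakWeight B ^ m : ℝ) : ℂ) * orbitAverage ν X B ∂(matMeasure (n + n)) := by
  have hswap : Integrable (Function.uncurry fun (B : MatSpace (n + n))
      (U : Matrix.unitaryGroup (Fin (n + n)) ℂ) => ((peakWeight B ^ m : ℝ) : ℂ) *
        peakFactor ν X (congrMap (U : Matrix (Fin (n + n)) (Fin (n + n)) ℂ) B))
      ((matMeasure (n + n)).prod (haarU (n + n))) := by
    have hb : Integrable (fun p : MatSpace (n + n) × Matrix.unitaryGroup (Fin (n + n)) ℂ =>
        peakWeight p.1 ^ m * peakBound ν X p.1) ((matMeasure (n + n)).prod (haarU (n + n))) :=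
      (integrable_peakWeight_pow_mul_peakBound ν X hm).comp_fst _
    refine hb.mono' ?_ (Eventually.of_forall fun p => ?_)
    · refine Continuous.aestronglyMeasurable ?_
      exact (Complex.continuous_ofReal.comp
        (((continuous_peakWeight n).comp continuous_fst).pow m)).mul
        (continuous_peakFactor_congrMap ν X)
    · simp only [Function.uncurry]
      rw [norm_mul, Complex.norm_real,
        Real.norm_of_nonneg (pow_nonneg (peakWeight_nonneg _) m), ← peakBound_congrMap ν X p.2.2]
      exact mul_le_mul_of_nonneg_left (norm_peakFactor_le ν X _)
        (pow_nonneg (peakWeight_nonneg _) m)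
  calc _ = ∫ _U : Matrix.unitaryGroup (Fin (n + n)) ℂ,
        (∫ B, ((peakWeight B ^ m : ℝ) : ℂ) * peakFactor ν X B ∂(matMeasure (n + n)))
          ∂(haarU (n + n)) := by
        rw [integral_const, probReal_univ, one_smul]
    _ = ∫ U : Matrix.unitaryGroup (Fin (n + n)) ℂ,
        (∫ B, ((peakWeight B ^ m : ℝ) : ℂ) *
          peakFactor ν X (congrMap (U : Matrix (Fin (n + n)) (Fin (n + n)) ℂ) B)
          ∂(matMeasure (n + n))) ∂(haarU (n + n)) := by
        refine integral_congr_ae (Eventually.of_forall fun U => ?_)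
        simp only
        rw [← (measurePreserving_congrMap U.2).integral_comp (measurableEmbedding_congrMap U.2)]
        simp only [peakWeight_congrMap U.2]
    _ = ∫ B, (∫ U : Matrix.unitaryGroup (Fin (n + n)) ℂ, ((peakWeight B ^ m : ℝ) : ℂ) *
          peakFactor ν X (congrMap (U : Matrix (Fin (n + n)) (Fin (n + n)) ℂ) B)
          ∂(haarU (n + n))) ∂(matMeasure (n + n)) := (integral_integral_swap hswap).symm
    _ = _ := by
        simp only [integral_const_mul, orbitAverage]

lemma chiralPow_det_unitary (ν : ℤ) {k : ℕ} {U : Matrix (Fin k) (Fin k) ℂ}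
    (hU : U ∈ Matrix.unitaryGroup (Fin k) ℂ) : chiralPow ν U.det = U.det ^ ν := by
  unfold chiralPow
  split_ifs with h
  · conv_rhs => rw [← Int.natAbs_of_nonneg h]
    rw [zpow_natCast]
  · have h1 : ν = -(ν.natAbs : ℤ) := by omega
    conv_rhs => rw [h1]
    rw [_root_.zpow_neg, zpow_natCast, ← inv_pow, eq_inv_of_mul_eq_one_left (conj_det_mul_det hU)]

/-- The value of `peakFactor` at the maximum, apart from the group variable. -/
def peakValue (n : ℕ) (ν : ℤ) : ℝ :=
  ((1 / Real.sqrt 2) ^ n * (-1) ^ n) ^ ν.natAbs *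
    Real.exp (-4 * (-ν).toNat * frobSq (peakPoint n))

lemma peakValue_ne_zero (n : ℕ) (ν : ℤ) : peakValue n ν ≠ 0 := by
  unfold peakValue
  have : Real.sqrt 2 ≠ 0 := by positivity
  refine mul_ne_zero (pow_ne_zero _ (mul_ne_zero (pow_ne_zero _ (by positivity)) ?_))
    (Real.exp_pos _).ne'
  exact pow_ne_zero _ (by norm_num)

lemma peakFactor_congrMap_peakPoint {n : ℕ} (ν : ℤ) (X : Matrix (Fin (n + n)) (Fin (n + n)) ℂ)
    {U : Matrix (Fin (n + n)) (Fin (n + n)) ℂ} (hU : U ∈ Matrix.unitaryGroup (Fin (n + n)) ℂ) :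
    peakFactor ν X (congrMap U (peakPoint n)) = peakValue n ν *
      (U.det ^ ν * (Real.exp (Xᴴ * U * symplecticI n * Uᵀ).trace.re : ℂ)) := by
  have hpf : stdSign n * pfaffian (antisymPart (congrMap U (peakPoint n))) =
      (((1 / Real.sqrt 2) ^ n * (-1) ^ n : ℝ) : ℂ) * U.det := by
    rw [antisymPart_congrMap, pfaffian_congr (Even.add_self n), antisymPart_peakPoint,
      pfaffian_smul, pfaffian_symplecticI, show (n + n) / 2 = n by omega]
    push_cast
    linear_combination (U.det * (1 / (Real.sqrt 2 : ℂ)) ^ n * (-1) ^ n) * stdSign_mul_self n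
  have hre : 2 * Real.sqrt 2 * rePair X (congrMap U (peakPoint n)) =
      (Xᴴ * U * symplecticI n * Uᵀ).trace.re := by
    have h1 : Matrix.of (peakPoint n) = ((1 / (2 * Real.sqrt 2) : ℝ) : ℂ) • symplecticI n := rfl
    rw [rePair, of_congrMap, h1, Matrix.mul_smul, Matrix.smul_mul, Matrix.mul_smul,
      Matrix.trace_smul, smul_eq_mul, Complex.re_ofReal_mul, ← mul_assoc, ← mul_assoc, ← mul_assoc]
    have : Real.sqrt 2 ≠ 0 := by positivity
    field_simp
  rw [peakFactor, hpf, hre, frobSq_congrMap hU, chiralPow_mul, chiralPow_ofReal,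
    chiralPow_det_unitary ν hU, peakValue]
  push_cast
  ring

lemma orbitAverage_peakPoint {n : ℕ} (ν : ℤ) (X : Matrix (Fin (n + n)) (Fin (n + n)) ℂ) :
    orbitAverage ν X (peakPoint n) = peakValue n ν * gFin n ν X := by
  rw [orbitAverage, gFin, ← integral_const_mul]
  exact integral_congr_ae (Eventually.of_forall fun U => peakFactor_congrMap_peakPoint ν X U.2)

lemma orbitAverage_congrMap {n : ℕ} (ν : ℤ) (X : Matrix (Fin (n + n)) (Fin (n + n)) ℂ)
    {V : Matrix (Fin (n + n)) (Fin (n + n)) ℂ} (hV : V ∈ Matrix.unitaryGroup (Fin (n + n)) ℂ)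
    (B : MatSpace (n + n)) : orbitAverage ν X (congrMap V B) = orbitAverage ν X B := by
  unfold orbitAverage
  rw [← integral_mul_right_eq_self (fun U : Matrix.unitaryGroup (Fin (n + n)) ℂ =>
    peakFactor ν X (congrMap (U : Matrix (Fin (n + n)) (Fin (n + n)) ℂ) B)) ⟨V, hV⟩]
  refine integral_congr_ae (Eventually.of_forall fun U => ?_)
  simp only
  rw [← congrMap_mul]
  rfl

/-- The dual integral concentrates on the orbit of `I`, where it becomes the group integral. -/
theorem tendsto_dual_ratio {n : ℕ} (ν : ℤ) (X : Matrix (Fin (n + n)) (Fin (n + n)) ℂ) :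
    Tendsto (fun m : ℕ =>
      (∫ B, ((peakWeight B ^ m : ℝ) : ℂ) * peakFactor ν X B ∂(matMeasure (n + n))) /
        ((∫ B : MatSpace (n + n), peakWeight B ^ m ∂(matMeasure (n + n)) : ℝ) : ℂ))
      atTop (𝓝 (peakValue n ν * gFin n ν X)) := by
  have h := tendsto_integral_pow_mul_div (μ := matMeasure (n + n)) (continuous_peakWeight n)
    (continuous_orbitAverage ν X) peakWeight_nonneg (x₀ := peakPoint n)
    (by rw [peakWeight_peakPoint]; positivity)
    (fun B => by rw [peakWeight_peakPoint]; exact peakWeight_le B) (tendsto_peakWeight_cocompact n)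
    (fun m hm => integrable_peakWeight_pow hm)
    (fun m hm => integrable_peakWeight_pow_mul (continuous_orbitAverage ν X)
      (norm_orbitAverage_le ν X) hm)
    (c := peakValue n ν * gFin n ν X) (fun B hB => by
      rw [peakWeight_peakPoint] at hB
      obtain ⟨U, hU, rfl⟩ := exists_congrMap_peakPoint hB
      rw [orbitAverage_congrMap ν X hU, orbitAverage_peakPoint])
  refine h.congr' ?_
  filter_upwards [eventually_gt_atTop 0] with m hm
  rw [integral_peakFactor_eq_orbitAverage ν X hm]

lemma integral_peakWeight_pow_pos {n m : ℕ} (hm : 0 < m) :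
    0 < ∫ B : MatSpace (n + n), peakWeight B ^ m ∂(matMeasure (n + n)) := by
  refine (integral_pos_iff_support_of_nonneg (fun B => pow_nonneg (peakWeight_nonneg B) m)
    (integrable_peakWeight_pow hm)).mpr ?_
  refine (IsOpen.measure_pos _ ?_ ⟨peakPoint n, ?_⟩)
  · exact ((continuous_peakWeight n).pow m).isOpen_support
  · rw [Function.mem_support, peakWeight_peakPoint]
    positivity

/-- The sign of `orderSign` as a real number. -/
def orderSignReal (n N : ℕ) (ν : ℤ) : ℝ :=
  (-1) ^ (n * N * (n * N + 1) / 2 + n * dimR N ν * (n * dimR N ν - 1) / 2)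

lemma orderSign_eq_ofReal (n N : ℕ) (ν : ℤ) : orderSign n N ν = (orderSignReal n N ν : ℂ) := by
  simp [orderSign, orderSignReal]

lemma orderSignReal_ne_zero (n N : ℕ) (ν : ℤ) : orderSignReal n N ν ≠ 0 :=
  pow_ne_zero _ (by norm_num)

/-- The normalization of the model at finite `N`, the inverse of the Laplace asymptotics of the
dual integral; the irrelevant small values of `N` get the value one. -/
def rmtScale (n : ℕ) (ν : ℤ) (N : ℕ) : ℝ :=
  if N ≤ (-ν).toNat then 1 else
    Real.sqrt (Real.pi / (4 * N)) ^
        Fintype.card ((Fin (n + n) × Fin (n + n)) ⊕ (Fin (n + n) × Fin (n + n))) /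
      (Real.sqrt (Real.pi / N) ^ Fintype.card (Fin N × Fin (dimR N ν)) * orderSignReal n N ν *
        peakValue n ν *
        ∫ B : MatSpace (n + n), peakWeight B ^ (N - (-ν).toNat) ∂(matMeasure (n + n)))

lemma rmtScale_ne_zero (n : ℕ) (ν : ℤ) (N : ℕ) : rmtScale n ν N ≠ 0 := by
  unfold rmtScale
  split_ifs with h
  · exact one_ne_zero
  · have hN : (0 : ℝ) < N := by
      have : 0 < N := by omega
      exact_mod_cast this
    have h1 := integral_peakWeight_pow_pos (n := n) (m := N - (-ν).toNat) (by omega)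
    have h2 := orderSignReal_ne_zero n N ν
    have h3 := peakValue_ne_zero n ν
    have h4 : 0 < Real.sqrt (Real.pi / (4 * N)) := Real.sqrt_pos.mpr (by positivity)
    have h5 : 0 < Real.sqrt (Real.pi / N) := Real.sqrt_pos.mpr (by positivity)
    exact div_ne_zero (pow_ne_zero _ h4.ne')
      (mul_ne_zero (mul_ne_zero (mul_ne_zero (pow_ne_zero _ h5.ne') h2) h3) h1.ne')

/-- The limit of the rescaled model is the group integral. -/
theorem tendsto_rmtScale_mul_gRMT {n : ℕ} (ν : ℤ) {X : Matrix (Fin (n + n)) (Fin (n + n)) ℂ}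
    (hX : IsAntisymm X) :
    Tendsto (fun N : ℕ => (rmtScale n ν N : ℂ) *
      gRMT n N ν (((1 / (Real.sqrt 2 * N) : ℝ) : ℂ) • X)) atTop (𝓝 (gFin n ν X)) := by
  have hv : (peakValue n ν : ℂ) ≠ 0 := by exact_mod_cast peakValue_ne_zero n ν
  have h1 : Tendsto (fun N : ℕ => ((Real.exp (-(frobSq (Matrix.of.symm X) / (2 * N))) : ℝ) : ℂ))
      atTop (𝓝 1) := by
    have h2 : Tendsto (fun N : ℕ => -(frobSq (Matrix.of.symm X) / (2 * (N : ℝ)))) atTop (𝓝 0) := by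
      have : Tendsto (fun N : ℕ => 2 * (N : ℝ)) atTop atTop :=
        tendsto_natCast_atTop_atTop.const_mul_atTop (by norm_num)
      simpa using (this.const_div_atTop (frobSq (Matrix.of.symm X))).neg
    have h3 := (Complex.continuous_ofReal.comp Real.continuous_exp).tendsto 0 |>.comp h2
    simp only [Function.comp_apply, Real.exp_zero, Complex.ofReal_one] at h3
    exact h3
  have h2 := ((tendsto_dual_ratio ν X).comp (tendsto_sub_atTop_nat (-ν).toNat)).const_mul
    ((peakValue n ν : ℂ)⁻¹)
  have h3 := h1.mul h2
  rw [one_mul, ← mul_assoc, inv_mul_cancel₀ hv, one_mul] at h3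
  refine h3.congr' ?_
  filter_upwards [eventually_gt_atTop (-ν).toNat] with N hN
  have hN0 : 0 < N := by omega
  have hNr : (0 : ℝ) < N := by exact_mod_cast hN0
  have hpeak := gRMT_eq_peak hN0 (by omega : 0 ≤ (N : ℤ) + ν) hX
  have hI : ((∫ B : MatSpace (n + n), peakWeight B ^ (N - (-ν).toNat) ∂(matMeasure (n + n)) : ℝ)
      : ℂ) ≠ 0 := by
    exact_mod_cast (integral_peakWeight_pow_pos (n := n) (m := N - (-ν).toNat) (by omega)).ne'
  have ho : (orderSignReal n N ν : ℂ) ≠ 0 := by exact_mod_cast orderSignReal_ne_zero n N ν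
  have hs : ((Real.sqrt (Real.pi / N) : ℝ) : ℂ) ≠ 0 := by
    exact_mod_cast (Real.sqrt_pos.mpr (by positivity)).ne'
  rw [rmtScale, if_neg (by omega), Complex.ofReal_div, div_mul_eq_mul_div, hpeak,
    orderSign_eq_ofReal]
  simp only [Function.comp_apply]
  push_cast at hI ⊢
  field_simp

/-- The two chiral factors have the same normalization. -/
theorem tendsto_rmtScale_sq_mul_zRMT {n : ℕ} (ν : ℤ) (V₄ Φ : ℝ)
    {JL JR : Matrix (Fin (n + n)) (Fin (n + n)) ℂ} (hL : IsAntisymm JL) (hR : IsAntisymm JR) :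
    Tendsto (fun N : ℕ => (rmtScale n ν N : ℂ) ^ 2 *
      zRMT n N ν (((V₄ * Φ / (Real.sqrt 2 * N) : ℝ) : ℂ) • JL)
        (((V₄ * Φ / (Real.sqrt 2 * N) : ℝ) : ℂ) • JR)) atTop (𝓝 (zEff n ν V₄ Φ JL JR)) := by
  have hL' : IsAntisymm JLᴴ := by
    have h := congrArg (fun Y : Matrix (Fin (n + n)) (Fin (n + n)) ℂ => Y.map star) hL
    ext a b
    have h1 := congrFun (congrFun h b) a
    simpa using h1
  have h := (tendsto_rmtScale_mul_gRMT ν (hL'.smul ((V₄ * Φ : ℝ) : ℂ))).mul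
    (tendsto_rmtScale_mul_gRMT ν (hR.smul ((V₄ * Φ : ℝ) : ℂ)))
  refine h.congr fun N => ?_
  have hs : ∀ Y : Matrix (Fin (n + n)) (Fin (n + n)) ℂ,
      ((1 / (Real.sqrt 2 * N) : ℝ) : ℂ) • ((V₄ * Φ : ℝ) : ℂ) • Y =
        ((V₄ * Φ / (Real.sqrt 2 * N) : ℝ) : ℂ) • Y := fun Y => by
    rw [smul_smul]
    congr 1
    push_cast
    ring
  rw [zRMT, hs, hs, Matrix.conjTranspose_smul, Complex.star_def, Complex.conj_ofReal]
  ring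

/-! ### Singular values -/

/-- `det (A Aᵀ + t)` for `ν ≥ 0` and `det (Aᵀ A + t)` for `ν < 0`, as a real number. -/
def gramPoly {N : ℕ} {ν : ℤ} (t : ℝ) (a : RealMat N ν) : ℝ :=
  if 0 ≤ ν then (Matrix.of a * (Matrix.of a)ᵀ + t • (1 : Matrix _ _ ℝ)).det
  else ((Matrix.of a)ᵀ * Matrix.of a + t • (1 : Matrix _ _ ℝ)).det

lemma gramDet_eq_ofReal {N : ℕ} {ν : ℤ} (z : ℂ) (a : RealMat N ν) :
    gramDet z a = (gramPoly (‖z‖ ^ 2) a : ℂ) := by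
  have key : ∀ {p : ℕ} (M : Matrix (Fin p) (Fin p) ℝ) (t : ℝ),
      ((M + t • (1 : Matrix _ _ ℝ)).det : ℂ) =
        (M.map Complex.ofRealHom + (t : ℂ) • (1 : Matrix _ _ ℂ)).det := fun M t => by
    rw [← Complex.ofRealHom_eq_coe, RingHom.map_det, RingHom.mapMatrix_apply]
    congr 1
    ext i j
    rcases eq_or_ne i j with rfl | hij
    · simp
    · simp [hij]
  unfold gramDet gramPoly
  split_ifs
  · rw [key]
    congr 2
    ext i j
    simp [cMat, Matrix.mul_apply]
  · rw [key]
    congr 2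
    ext i j
    simp [cMat, Matrix.mul_apply]

lemma singVal_sq {N : ℕ} {ν : ℤ} (a : RealMat N ν) (k : Fin (dimR N ν)) : singVal a k ^ 2 =
    (Matrix.isHermitian_conjTranspose_mul_self (Matrix.of a)).eigenvalues k :=
  Real.sq_sqrt ((Matrix.posSemidef_conjTranspose_mul_self (Matrix.of a)).eigenvalues_nonneg k)

lemma singVal_nonneg {N : ℕ} {ν : ℤ} (a : RealMat N ν) (k : Fin (dimR N ν)) : 0 ≤ singVal a k :=
  Real.sqrt_nonneg _

lemma det_transpose_mul_self_add {N : ℕ} {ν : ℤ} (a : RealMat N ν) (t : ℝ) :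
    ((Matrix.of a)ᵀ * Matrix.of a + t • (1 : Matrix _ _ ℝ)).det = ∏ k, (singVal a k ^ 2 + t) := by
  have h := congrArg (Polynomial.eval (-t))
    (Matrix.isHermitian_conjTranspose_mul_self (Matrix.of a)).charpoly_eq
  rw [Matrix.eval_charpoly, Polynomial.eval_prod] at h
  have h1 : (Matrix.scalar (Fin (dimR N ν)) (-t) - (Matrix.of a)ᴴ * Matrix.of a) =
      -((Matrix.of a)ᵀ * Matrix.of a + t • (1 : Matrix _ _ ℝ)) := by
    rw [Matrix.conjTranspose_eq_transpose_of_trivial, map_neg, Matrix.scalar_apply,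
      ← Matrix.smul_one_eq_diagonal]
    abel
  rw [h1, Matrix.det_neg] at h
  have h2 : ∏ k, Polynomial.eval (-t) (Polynomial.X - Polynomial.C
      (((Matrix.isHermitian_conjTranspose_mul_self (Matrix.of a)).eigenvalues k : ℝ))) =
      (-1) ^ Fintype.card (Fin (dimR N ν)) * ∏ k, (singVal a k ^ 2 + t) := by
    rw [← Finset.card_univ, ← Finset.prod_const, ← Finset.prod_mul_distrib]
    refine Finset.prod_congr rfl fun k _ => ?_
    rw [singVal_sq, Polynomial.eval_sub, Polynomial.eval_X, Polynomial.eval_C]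
    ring
  exact mul_left_cancel₀ (pow_ne_zero _ (by norm_num)) (h.trans h2)

lemma continuous_gramPoly_left {N : ℕ} {ν : ℤ} (a : RealMat N ν) :
    Continuous fun t => gramPoly t a := by
  unfold gramPoly
  split_ifs <;> exact Continuous.matrix_det (by fun_prop)

/-- For a matrix of full rank the two Gram determinants see the same nonzero singular values. -/
lemma gramPoly_eq_prod {N : ℕ} {ν : ℤ} (h : 0 ≤ (N : ℤ) + ν) {a : RealMat N ν}
    (ha : gramPoly 0 a ≠ 0) {t : ℝ} (ht : 0 ≤ t) :
    gramPoly t a = ∏ k with singVal a k ≠ 0, (singVal a k ^ 2 + t) := by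
  by_cases hν : 0 ≤ ν
  -- for `ν ≥ 0` a matrix of full rank has `N` nonzero singular values and `ν` vanishing ones
  · have hcard : (Finset.univ.filter fun k => singVal a k ≠ 0).card = N := by
      have hrank : ((Matrix.of a)ᴴ * Matrix.of a).rank = N := by
        rw [Matrix.conjTranspose_eq_transpose_of_trivial, Matrix.rank_transpose_mul_self,
          ← Matrix.rank_self_mul_transpose, Matrix.rank_of_isUnit, Fintype.card_fin]
        rw [Matrix.isUnit_iff_isUnit_det, isUnit_iff_ne_zero]
        simpa [gramPoly, hν] using ha
      refine Eq.trans ?_ hrank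
      rw [(Matrix.isHermitian_conjTranspose_mul_self
        (Matrix.of a)).rank_eq_card_non_zero_eigs, Fintype.card_subtype]
      congr 1
      ext k
      simp only [Finset.mem_filter, Finset.mem_univ, true_and]
      rw [← singVal_sq]
      exact (pow_ne_zero_iff two_ne_zero).symm
    have hD : dimR N ν = N + ν.toNat := by
      unfold dimR
      omega
    have hcard' : (Finset.univ.filter fun k => ¬ singVal a k ≠ 0).card = ν.toNat := by
      have := Finset.card_filter_add_card_filter_not (s := Finset.univ) fun k => singVal a k ≠ 0
      rw [hcard, Finset.card_univ, Fintype.card_fin] at this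
      omega
    have hpos : ∀ s : ℝ, 0 < s →
        gramPoly s a = ∏ k with singVal a k ≠ 0, (singVal a k ^ 2 + s) := by
      intro s hs
      have h1 := det_transpose_mul_self_add a s
      rw [← Finset.prod_filter_mul_prod_filter_not (s := Finset.univ)
        (p := fun k => singVal a k ≠ 0)] at h1
      have h2 : ∏ k with ¬ singVal a k ≠ 0, (singVal a k ^ 2 + s) = s ^ ν.toNat := by
        rw [← hcard', ← Finset.prod_const]
        refine Finset.prod_congr rfl fun k hk => ?_
        rw [Finset.mem_filter, not_not] at hk
        rw [hk.2]
        ring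
      -- the Weinstein–Aronszajn identity compares `det (Aᵀ A + s)` with `det (A Aᵀ + s)` for `s > 0`
      have h3 : ((Matrix.of a)ᵀ * Matrix.of a + s • (1 : Matrix _ _ ℝ)).det =
          s ^ dimR N ν * (1 + (Matrix.of a)ᵀ * (s⁻¹ • Matrix.of a)).det := by
        have hdet : ∀ M : Matrix (Fin (dimR N ν)) (Fin (dimR N ν)) ℝ,
            s ^ dimR N ν * M.det = (s • M).det := fun M => by
          rw [Matrix.det_smul, Fintype.card_fin]
        rw [hdet, smul_add, Matrix.mul_smul, smul_smul, mul_inv_cancel₀ hs.ne', one_smul, add_comm]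
      have h4 : (Matrix.of a * (Matrix.of a)ᵀ + s • (1 : Matrix _ _ ℝ)).det =
          s ^ N * (1 + (s⁻¹ • Matrix.of a) * (Matrix.of a)ᵀ).det := by
        have hdet : ∀ M : Matrix (Fin N) (Fin N) ℝ, s ^ N * M.det = (s • M).det := fun M => by
          rw [Matrix.det_smul, Fintype.card_fin]
        rw [hdet, smul_add, Matrix.smul_mul, smul_smul, mul_inv_cancel₀ hs.ne', one_smul, add_comm]
      have h5 : s ^ dimR N ν = s ^ N * s ^ ν.toNat := by rw [hD, pow_add]
      rw [h3, h2, Matrix.det_one_add_mul_comm, h5] at h1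
      refine mul_right_cancel₀ (pow_ne_zero ν.toNat hs.ne') ?_
      rw [gramPoly, if_pos hν, h4, ← h1]
      ring
    -- the case `t = 0` follows by continuity
    rcases ht.eq_or_lt with rfl | ht
    · have hc : Continuous fun s : ℝ => ∏ k with singVal a k ≠ 0, (singVal a k ^ 2 + s) := by
        fun_prop
      have l1 := ((continuous_gramPoly_left a).tendsto 0).mono_left
        (nhdsWithin_le_nhds (s := Set.Ioi 0))
      have l2 := (hc.tendsto 0).mono_left (nhdsWithin_le_nhds (s := Set.Ioi 0))
      refine tendsto_nhds_unique l1 (l2.congr' ?_)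
      filter_upwards [self_mem_nhdsWithin] with s hs
      exact (hpos s hs).symm
    · exact hpos t ht
  · have h1 : ∀ s : ℝ, gramPoly s a = ∏ k, (singVal a k ^ 2 + s) := fun s => by
      rw [gramPoly, if_neg hν, det_transpose_mul_self_add]
    rw [h1] at ha ⊢
    rw [Finset.filter_true_of_mem]
    intro k _ hk
    exact ha (Finset.prod_eq_zero (Finset.mem_univ k) (by rw [hk]; ring))

/-! ### Matrices of full rank -/

/-- The determinant is a nonzero polynomial in `t`, as its leading coefficient is one. -/
lemma finite_setOf_det_quadratic_eq_zero {p : ℕ} (P Q : Matrix (Fin p) (Fin p) ℝ) :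
    {t : ℝ | (P + t • Q + t ^ 2 • (1 : Matrix _ _ ℝ)).det = 0}.Finite := by
  set f : Polynomial ℝ := (P.map Polynomial.C + (Polynomial.X : Polynomial ℝ) • Q.map Polynomial.C +
    (Polynomial.X ^ 2 : Polynomial ℝ) • (1 : Matrix _ _ (Polynomial ℝ))).det with hf
  have heval : ∀ t, f.eval t = (P + t • Q + t ^ 2 • (1 : Matrix _ _ ℝ)).det := fun t => by
    rw [hf, ← Polynomial.coe_evalRingHom, RingHom.map_det, RingHom.mapMatrix_apply]
    congr 1
    ext i j
    rcases eq_or_ne i j with rfl | hij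
    · simp
      ring
    · simp [hij]
      ring
  have hf0 : f ≠ 0 := by
    intro h0
    -- the reversed polynomial in `s = 1 / t` does not vanish near `s = 0`
    have hc : Continuous fun s : ℝ => ((1 : Matrix (Fin p) (Fin p) ℝ) + s • Q + s ^ 2 • P).det :=
      Continuous.matrix_det (by fun_prop)
    have h1 : ∀ᶠ s in 𝓝[≠] (0 : ℝ),
        ((1 : Matrix (Fin p) (Fin p) ℝ) + s • Q + s ^ 2 • P).det ≠ 0 := by
      refine ((hc.tendsto 0).mono_left nhdsWithin_le_nhds).eventually_ne ?_
      simp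
    obtain ⟨s, hs, hs0⟩ := (h1.and self_mem_nhdsWithin).exists
    have hs0 : s ≠ 0 := hs0
    have h2 := heval s⁻¹
    rw [h0, Polynomial.eval_zero] at h2
    apply hs
    have h3 : (1 : Matrix (Fin p) (Fin p) ℝ) + s • Q + s ^ 2 • P =
        s ^ 2 • (P + s⁻¹ • Q + s⁻¹ ^ 2 • (1 : Matrix _ _ ℝ)) := by
      rw [smul_add, smul_add, smul_smul, smul_smul, inv_pow, mul_inv_cancel₀ (pow_ne_zero 2 hs0),
        one_smul, show s ^ 2 * s⁻¹ = s by field_simp]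
      abel
    rw [h3, Matrix.det_smul, ← h2, mul_zero]
  refine (Polynomial.finite_setOfPred_isRoot hf0).subset fun t ht => ?_
  show f.eval t = 0
  rw [heval]
  exact ht

lemma continuous_gramPoly {N : ℕ} {ν : ℤ} (t : ℝ) :
    Continuous fun a : RealMat N ν => gramPoly t a := by
  have h1 : Continuous fun a : RealMat N ν => (Matrix.of a : Matrix _ _ ℝ) := continuous_id
  unfold gramPoly
  split_ifs
  · exact Continuous.matrix_det ((h1.matrix_mul h1.matrix_transpose).add continuous_const)
  · exact Continuous.matrix_det ((h1.matrix_transpose.matrix_mul h1).add continuous_const)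

/-- Almost every matrix has full rank: on every line in the direction of a partial isometry the
Gram determinant is a nonzero polynomial. -/
lemma ae_gramPoly_ne_zero {N : ℕ} {ν : ℤ} (h : 0 ≤ (N : ℤ) + ν) :
    ∀ᵐ a : RealMat N ν, gramPoly 0 a ≠ 0 := by
  -- `E` is the partial isometry; the almost everywhere statement is reduced to lines parallel to `E`
  let E : Matrix (Fin N) (Fin (dimR N ν)) ℝ := Matrix.of fun i k => if (i : ℕ) = k then 1 else 0
  let L : ℝ →ₗ[ℝ] RealMat N ν := LinearMap.toSpanSingleton ℝ (RealMat N ν) (Matrix.of.symm E)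
  refine ae_mem_of_ae_add_linearMap_mem L volume volume (s := {a | gramPoly 0 a ≠ 0}) ?_ fun a => ?_
  · exact (isOpen_ne_fun (continuous_gramPoly 0) continuous_const).measurableSet
  have hL : ∀ t, Matrix.of (a + L t) = Matrix.of a + t • E := fun t => rfl
  have hfin : {t : ℝ | gramPoly 0 (a + L t) = 0}.Finite := by
    by_cases hν : 0 ≤ ν
    · have hE : E * Eᵀ = 1 := by
        ext i k
        have hi : (i : ℕ) < dimR N ν := by
          have := i.2
          unfold dimR
          omega
        rw [Matrix.mul_apply, Finset.sum_eq_single ⟨i, hi⟩]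
        · simp [E, Matrix.one_apply, Fin.ext_iff, eq_comm]
        · intro l _ hl
          have : (i : ℕ) ≠ l := fun h => hl (Fin.ext h.symm)
          simp [E, this]
        · exact fun h => absurd (Finset.mem_univ _) h
      refine (finite_setOf_det_quadratic_eq_zero (Matrix.of a * (Matrix.of a)ᵀ)
        (Matrix.of a * Eᵀ + E * (Matrix.of a)ᵀ)).subset fun t ht => ?_
      rw [Set.mem_ofPred_eq, gramPoly, if_pos hν, hL] at ht
      rw [Set.mem_ofPred_eq, ← ht]
      congr 1
      rw [← hE, Matrix.transpose_add, Matrix.transpose_smul, Matrix.add_mul, Matrix.mul_add,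
        Matrix.mul_add, Matrix.smul_mul, Matrix.smul_mul, Matrix.mul_smul, Matrix.mul_smul,
        smul_smul, ← sq, smul_add, zero_smul]
      abel
    · have hE : Eᵀ * E = 1 := by
        ext i k
        have hi : (i : ℕ) < N := by
          have := i.2
          unfold dimR at this
          omega
        rw [Matrix.mul_apply, Finset.sum_eq_single ⟨i, hi⟩]
        · simp [E, Matrix.one_apply, Fin.ext_iff]
        · intro l _ hl
          have : (l : ℕ) ≠ i := fun h => hl (Fin.ext h)
          simp [E, this]
        · exact fun h => absurd (Finset.mem_univ _) h
      refine (finite_setOf_det_quadratic_eq_zero ((Matrix.of a)ᵀ * Matrix.of a)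
        ((Matrix.of a)ᵀ * E + Eᵀ * Matrix.of a)).subset fun t ht => ?_
      rw [Set.mem_ofPred_eq, gramPoly, if_neg hν, hL] at ht
      rw [Set.mem_ofPred_eq, ← ht]
      congr 1
      rw [← hE, Matrix.transpose_add, Matrix.transpose_smul, Matrix.add_mul, Matrix.mul_add,
        Matrix.mul_add, Matrix.smul_mul, Matrix.smul_mul, Matrix.mul_smul, Matrix.mul_smul,
        smul_smul, ← sq, smul_add, zero_smul]
      abel
  exact measure_eq_zero_iff_ae_notMem.mp (hfin.measure_zero volume)

/-! ### The model as an average over the massless ensemble -/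

/-- The eigenvalues of `X† X` are the numbers `|x f|²`, each of multiplicity two. -/
lemma det_one_add_smul_normalForm {n : ℕ} {U : Matrix (Fin (n + n)) (Fin (n + n)) ℂ}
    (hU : U ∈ Matrix.unitaryGroup (Fin (n + n)) ℂ) (x : Fin n → ℂ) (c : ℝ) :
    (1 + (c : ℂ) • ((U * offDiag (Matrix.diagonal x) * Uᵀ)ᴴ *
      (U * offDiag (Matrix.diagonal x) * Uᵀ))).det =
      (((∏ f, (1 + c * ‖x f‖ ^ 2)) ^ 2 : ℝ) : ℂ) := by
  have hUU : Uᴴ * U = 1 := Matrix.mem_unitaryGroup_iff'.mp hU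
  have hUt := transpose_mul_conjTranspose_of_unitary hU
  have hUt' : Uᵀᴴ * Uᵀ = 1 := mul_eq_one_comm.mp hUt
  set O := offDiag (Matrix.diagonal x)
  have h1 : (1 : Matrix (Fin (n + n)) (Fin (n + n)) ℂ) + (c : ℂ) • ((U * O * Uᵀ)ᴴ * (U * O * Uᵀ)) =
      Uᵀᴴ * (1 + (c : ℂ) • (Oᴴ * O)) * Uᵀ := by
    have h2 : (U * O * Uᵀ)ᴴ * (U * O * Uᵀ) = Uᵀᴴ * (Oᴴ * O) * Uᵀ := by
      rw [Matrix.conjTranspose_mul, Matrix.conjTranspose_mul]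
      calc Uᵀᴴ * (Oᴴ * Uᴴ) * (U * O * Uᵀ) = Uᵀᴴ * (Oᴴ * (Uᴴ * U) * O) * Uᵀ := by
            simp only [mul_assoc]
        _ = _ := by rw [hUU, mul_one]
    rw [h2, mul_add, add_mul, mul_one, hUt', Matrix.mul_smul, Matrix.smul_mul]
  have h3 : (1 : Matrix (Fin (n + n)) (Fin (n + n)) ℂ) + (c : ℂ) • (Oᴴ * O) =
      Matrix.reindex finSumFinEquiv finSumFinEquiv
        (Matrix.fromBlocks (Matrix.diagonal fun f => ((1 + c * ‖x f‖ ^ 2 : ℝ) : ℂ)) 0 0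
          (Matrix.diagonal fun f => ((1 + c * ‖x f‖ ^ 2 : ℝ) : ℂ))) := by
    have hx : ∀ f, starRingEnd ℂ (x f) * x f = ((‖x f‖ ^ 2 : ℝ) : ℂ) := fun f => by
      rw [← Complex.normSq_eq_norm_sq, ← Complex.normSq_eq_conj_mul_self]
    have hOO : Oᴴ * O = Matrix.reindex finSumFinEquiv finSumFinEquiv
        (Matrix.fromBlocks (Matrix.diagonal fun f => ((‖x f‖ ^ 2 : ℝ) : ℂ)) 0 0
          (Matrix.diagonal fun f => ((‖x f‖ ^ 2 : ℝ) : ℂ))) := by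
      show (offDiag (Matrix.diagonal x))ᴴ * offDiag (Matrix.diagonal x) = _
      rw [offDiag, Matrix.reindex_apply, Matrix.conjTranspose_submatrix,
        Matrix.submatrix_mul_equiv, Matrix.fromBlocks_conjTranspose, Matrix.fromBlocks_multiply]
      congr 2
      · simp only [Matrix.conjTranspose_zero, Matrix.zero_mul, zero_add,
          Matrix.conjTranspose_neg, Matrix.neg_mul, Matrix.mul_neg, neg_neg, Matrix.diagonal_transpose,
          Matrix.diagonal_conjTranspose, Matrix.diagonal_mul_diagonal]
        congr 1
        funext f
        exact hx f
      · simp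
      · simp
      · simp only [Matrix.conjTranspose_zero, Matrix.zero_mul, add_zero,
          Matrix.diagonal_conjTranspose, Matrix.diagonal_mul_diagonal]
        congr 1
        funext f
        exact hx f
    rw [hOO]
    ext a b
    obtain ⟨p, rfl⟩ := finSumFinEquiv.surjective a
    obtain ⟨q, rfl⟩ := finSumFinEquiv.surjective b
    rw [Matrix.add_apply, Matrix.smul_apply, Matrix.reindex_apply, Matrix.submatrix_apply,
      Matrix.reindex_apply, Matrix.submatrix_apply, Matrix.one_apply, Equiv.symm_apply_apply,
      Equiv.symm_apply_apply]
    simp only [finSumFinEquiv.injective.eq_iff]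
    rcases p with p | p <;> rcases q with q | q
    · rcases eq_or_ne p q with rfl | hpq
      · simp
      · simp [hpq]
    · simp
    · simp
    · rcases eq_or_ne p q with rfl | hpq
      · simp
      · simp [hpq]
  rw [h1, Matrix.det_mul, Matrix.det_mul, mul_comm, ← mul_assoc, ← Matrix.det_mul, hUt,
    Matrix.det_one, one_mul, h3, Matrix.det_reindex_self, Matrix.det_fromBlocks_zero₂₁,
    Matrix.det_diagonal]
  push_cast
  ring

lemma sourceFactor_normalForm {n N : ℕ} {ν : ℤ} {U : Matrix (Fin (n + n)) (Fin (n + n)) ℂ}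
    (hU : U ∈ Matrix.unitaryGroup (Fin (n + n)) ℂ) (x : Fin n → ℂ) (a : RealMat N ν) :
    sourceFactor 1 1 (U * offDiag (Matrix.diagonal x) * Uᵀ) a =
      ∏ k with singVal a k ≠ 0, ∏ f, (1 + ((Real.sqrt 2 * N * singVal a k) ^ 2)⁻¹ * ‖x f‖ ^ 2) := by
  unfold sourceFactor
  refine Finset.prod_congr rfl fun k _ => ?_
  rw [mul_one, div_one, ← Complex.ofReal_inv, det_one_add_smul_normalForm hU, Complex.ofReal_re,
    Real.sqrt_sq]
  exact Finset.prod_nonneg fun f _ => by positivity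

lemma sourceFactor_eq_smul {n N : ℕ} {ν : ℤ} (V₄ Φ : ℝ) (J : Matrix (Fin (n + n)) (Fin (n + n)) ℂ)
    (a : RealMat N ν) :
    sourceFactor V₄ Φ J a = sourceFactor 1 1 (((V₄ * Φ : ℝ) : ℂ) • J) a := by
  unfold sourceFactor
  refine Finset.prod_congr rfl fun k _ => ?_
  congr 4
  rw [Matrix.conjTranspose_smul, Matrix.smul_mul, Matrix.mul_smul, smul_smul, smul_smul,
    Complex.star_def, Complex.conj_ofReal]
  congr 1
  push_cast
  rw [mul_one, div_one, div_pow, inv_div, div_eq_mul_inv, mul_comm]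
  ring

/-- For a matrix of full rank, the massless weight and the source factor combine to the massive
weight: each nonzero singular value `ξ` carries the factor `ξ² (1 + |x f|² / (2 N² ξ²))` per flavour. -/
lemma masslessWeight_mul_sourceFactor {n N : ℕ} {ν : ℤ} (hN : 0 < N) (h : 0 ≤ (N : ℤ) + ν)
    {a : RealMat N ν} (ha : gramPoly 0 a ≠ 0) {U : Matrix (Fin (n + n)) (Fin (n + n)) ℂ}
    (hU : U ∈ Matrix.unitaryGroup (Fin (n + n)) ℂ) (x : Fin n → ℂ) :
    masslessWeight n a * sourceFactor 1 1 (U * offDiag (Matrix.diagonal x) * Uᵀ) a =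
      gaussWeight a * ∏ f, gramPoly (‖x f‖ ^ 2 / (Real.sqrt 2 * N) ^ 2) a := by
  have hN' : (0 : ℝ) < N := by exact_mod_cast hN
  have hs : (0 : ℝ) < Real.sqrt 2 := by positivity
  rw [sourceFactor_normalForm hU, masslessWeight, mul_assoc, ← Finset.prod_mul_distrib]
  congr 1
  rw [Finset.prod_congr rfl fun f _ => gramPoly_eq_prod h ha (by positivity), Finset.prod_comm]
  refine Finset.prod_congr rfl fun k hk => ?_
  have hk' : singVal a k ≠ 0 := (Finset.mem_filter.mp hk).2
  have h1 : singVal a k ^ (n + n) = ∏ _f : Fin n, singVal a k ^ 2 := by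
    rw [Finset.prod_const, Finset.card_univ, Fintype.card_fin, ← pow_mul]
    congr 1
    omega
  rw [h1, ← Finset.prod_mul_distrib]
  refine Finset.prod_congr rfl fun f _ => ?_
  field_simp

lemma smul_normalForm {n : ℕ} (c : ℂ) (U : Matrix (Fin (n + n)) (Fin (n + n)) ℂ) (x : Fin n → ℂ) :
    c • (U * offDiag (Matrix.diagonal x) * Uᵀ) =
      U * offDiag (Matrix.diagonal fun f => c * x f) * Uᵀ := by
  have h : Matrix.diagonal (fun f => c * x f) = c • Matrix.diagonal x := by
    rw [← Matrix.diagonal_smul]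
    rfl
  rw [h, offDiag_smul, Matrix.mul_smul, Matrix.smul_mul]

lemma expBdd_gramDet {N : ℕ} {ν : ℤ} (z : ℂ) : ExpBdd fun a : RealMat N ν => gramDet z a := by
  unfold gramDet
  split_ifs
  · refine ExpBdd.det fun i j => ?_
    simp only [Matrix.add_apply, Matrix.mul_apply, Matrix.transpose_apply]
    exact (ExpBdd.sum _ fun k => (ExpBdd.entry i k).mul (ExpBdd.entry j k)).add (ExpBdd.const _)
  · refine ExpBdd.det fun i j => ?_
    simp only [Matrix.add_apply, Matrix.mul_apply, Matrix.transpose_apply]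
    exact (ExpBdd.sum _ fun k => (ExpBdd.entry k i).mul (ExpBdd.entry k j)).add (ExpBdd.const _)

lemma integrable_gauss_mul_gramPoly {n N : ℕ} {ν : ℤ} (z : Fin n → ℂ) :
    Integrable fun a : RealMat N ν => gaussWeight a * ∏ f, gramPoly (‖z f‖ ^ 2) a := by
  have h := (ExpBdd.prod Finset.univ fun f => expBdd_gramDet (N := N) (ν := ν) (z f)).integrable_gauss
  refine h.re.congr (Eventually.of_forall fun a => ?_)
  simp only [gramDet_eq_ofReal]
  rw [← Complex.ofReal_prod, ← Complex.ofReal_mul]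
  exact Complex.ofReal_re _

lemma norm_smul_sq {N : ℕ} (z : ℂ) :
    ‖((1 / (Real.sqrt 2 * N) : ℝ) : ℂ) * z‖ ^ 2 = ‖z‖ ^ 2 / (Real.sqrt 2 * N) ^ 2 := by
  rw [norm_mul, Complex.norm_real, mul_pow, Real.norm_eq_abs, sq_abs]
  ring

lemma ae_masslessWeight_mul_sourceFactor {n N : ℕ} {ν : ℤ} (hN : 0 < N) (h : 0 ≤ (N : ℤ) + ν)
    {U : Matrix (Fin (n + n)) (Fin (n + n)) ℂ}
    (hU : U ∈ Matrix.unitaryGroup (Fin (n + n)) ℂ) (x : Fin n → ℂ) :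
    (fun a : RealMat N ν =>
      masslessWeight n a * sourceFactor 1 1 (U * offDiag (Matrix.diagonal x) * Uᵀ) a) =ᵐ[volume]
      fun a => gaussWeight a * ∏ f, gramPoly (‖((1 / (Real.sqrt 2 * N) : ℝ) : ℂ) * x f‖ ^ 2) a := by
  filter_upwards [ae_gramPoly_ne_zero h] with a ha
  rw [masslessWeight_mul_sourceFactor hN h ha hU]
  simp only [norm_smul_sq]

lemma integrable_masslessWeight_mul_sourceFactor {n N : ℕ} {ν : ℤ} (hN : 0 < N)
    (h : 0 ≤ (N : ℤ) + ν) {X : Matrix (Fin (n + n)) (Fin (n + n)) ℂ} (hX : IsAntisymm X) :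
    Integrable fun a : RealMat N ν => masslessWeight n a * sourceFactor 1 1 X a := by
  obtain ⟨U, hU, x, rfl⟩ := exists_unitary_normalForm hX
  exact (integrable_gauss_mul_gramPoly _).congr (ae_masslessWeight_mul_sourceFactor hN h hU x).symm

lemma isAntisymm_zero (k : ℕ) : IsAntisymm (0 : Matrix (Fin k) (Fin k) ℂ) := by
  simp [IsAntisymm]

lemma sourceFactor_zero {n N : ℕ} {ν : ℤ} (a : RealMat N ν) :
    sourceFactor 1 1 (0 : Matrix (Fin (n + n)) (Fin (n + n)) ℂ) a = 1 := by
  simp [sourceFactor]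

lemma integrable_masslessWeight {n N : ℕ} {ν : ℤ} (hN : 0 < N) (h : 0 ≤ (N : ℤ) + ν) :
    Integrable fun a : RealMat N ν => masslessWeight n a := by
  simpa only [sourceFactor_zero, mul_one] using
    integrable_masslessWeight_mul_sourceFactor hN h (isAntisymm_zero (n + n))

lemma masslessWeight_pos {n N : ℕ} {ν : ℤ} (a : RealMat N ν) : 0 < masslessWeight n a := by
  refine mul_pos (gaussWeight_pos a) (Finset.prod_pos fun k hk => pow_pos ?_ _)
  exact lt_of_le_of_ne (singVal_nonneg a k) (Finset.mem_filter.mp hk).2.symm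

lemma integral_masslessWeight_pos {n N : ℕ} {ν : ℤ} (hN : 0 < N) (h : 0 ≤ (N : ℤ) + ν) :
    0 < ∫ a : RealMat N ν, masslessWeight n a := by
  refine (integral_pos_iff_support_of_nonneg (fun a => (masslessWeight_pos a).le)
    (integrable_masslessWeight hN h)).mpr ?_
  have : (Function.support fun a : RealMat N ν => masslessWeight n a) = Set.univ :=
    Set.eq_univ_of_forall fun a => (masslessWeight_pos a).ne'
  rw [this]
  exact Measure.measure_univ_pos.mpr (NeZero.ne _)

lemma stdSign_eq_ofReal (m : ℕ) : stdSign m = (((-1) ^ (m * (m - 1) / 2) : ℝ) : ℂ) := by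
  simp [stdSign]

/-- The ratio of the random matrix model to the average over the massless ensemble. -/
def massConst (n : ℕ) (ν : ℤ) (N : ℕ) : ℝ :=
  orderSignReal n N ν * ((-1) ^ (n * (n - 1) / 2) * (1 / (Real.sqrt 2 * N)) ^ n) ^ ν.natAbs *
    ∫ a : RealMat N ν, masslessWeight n a

/-- The model factorizes into a power of the Pfaffian of the source and an average over the massless
ensemble. -/
theorem gRMT_eq_rmtAverage {n N : ℕ} {ν : ℤ} (hN : 0 < N) (h : 0 ≤ (N : ℤ) + ν)
    {X : Matrix (Fin (n + n)) (Fin (n + n)) ℂ} (hX : IsAntisymm X) :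
    gRMT n N ν (((1 / (Real.sqrt 2 * N) : ℝ) : ℂ) • X) =
      massConst n ν N * chiralPow ν (pfaffian X) *
        (rmtAverage n N ν (sourceFactor 1 1 X) : ℂ) := by
  have hI := integral_masslessWeight_pos (n := n) hN h
  obtain ⟨U, hU, x, rfl⟩ := exists_unitary_normalForm hX
  set s : ℝ := 1 / (Real.sqrt 2 * N) with hs
  have h1 : gProduct n N ν (fun f => (s : ℂ) * x f) =
      (∏ f, chiralPow ν ((s : ℂ) * x f)) *
        ((∫ a : RealMat N ν, masslessWeight n a *
          sourceFactor 1 1 (U * offDiag (Matrix.diagonal x) * Uᵀ) a : ℝ) : ℂ) := by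
    rw [integral_congr_ae (ae_masslessWeight_mul_sourceFactor hN h hU x), ← hs, gProduct,
      ← integral_complex_ofReal, ← integral_const_mul]
    refine integral_congr_ae (Eventually.of_forall fun a => ?_)
    simp only [gramDet_eq_ofReal, Finset.prod_mul_distrib]
    push_cast
    ring
  have h2 : (∫ a : RealMat N ν, masslessWeight n a *
      sourceFactor 1 1 (U * offDiag (Matrix.diagonal x) * Uᵀ) a) =
      (∫ a : RealMat N ν, masslessWeight n a) *
        rmtAverage n N ν (sourceFactor 1 1 (U * offDiag (Matrix.diagonal x) * Uᵀ)) := by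
    rw [rmtAverage]
    field_simp
  have h3 : chiralPow ν U.det * ∏ f, chiralPow ν ((s : ℂ) * x f) =
      (((-1) ^ (n * (n - 1) / 2) * s ^ n : ℝ) : ℂ) ^ ν.natAbs *
        chiralPow ν (pfaffian (U * offDiag (Matrix.diagonal x) * Uᵀ)) := by
    rw [← chiralPow_ofReal, ← chiralPow_mul, ← chiralPow_prod, ← chiralPow_mul,
      pfaffian_normalForm, Complex.ofReal_mul, ← stdSign_eq_ofReal, Finset.prod_mul_distrib,
      Finset.prod_const, Finset.card_univ, Fintype.card_fin]
    congr 1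
    push_cast
    linear_combination (-(U.det * (s : ℂ) ^ n * ∏ f, x f)) * stdSign_mul_self n
  rw [smul_normalForm, gRMT_normalForm h hU, h1, h2, massConst, ← hs, orderSign_eq_ofReal]
  push_cast at h3 ⊢
  linear_combination ((orderSignReal n N ν : ℂ) *
    ((∫ a : RealMat N ν, masslessWeight n a : ℝ) : ℂ) *
    (rmtAverage n N ν (sourceFactor 1 1 (U * offDiag (Matrix.diagonal x) * Uᵀ)) : ℂ)) * h3

/-! ### Small sources -/

lemma prod_one_add_mul_bounds {ι : Type*} (s : Finset ι) {t : ι → ℝ} (ht : ∀ i, 0 ≤ t i) {y : ℝ}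
    (hy0 : 0 ≤ y) (hy1 : y ≤ 1) :
    1 ≤ ∏ i ∈ s, (1 + y * t i) ∧ ∏ i ∈ s, (1 + y * t i) ≤ 1 + y * (∏ i ∈ s, (1 + t i) - 1) := by
  classical
  induction s using Finset.induction_on with
  | empty => simp
  | insert a s ha ih =>
    rw [Finset.prod_insert ha, Finset.prod_insert ha]
    obtain ⟨h1, h2⟩ := ih
    have h0 := ht a
    have hyt : 0 ≤ y * t a := mul_nonneg hy0 h0
    set P := ∏ i ∈ s, (1 + y * t i)
    set Q := ∏ i ∈ s, (1 + t i)
    have hQ : 0 ≤ y * (Q - 1) := by linarith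
    constructor
    · nlinarith
    · have h3 : (1 + y * t a) * P ≤ (1 + y * t a) * (1 + y * (Q - 1)) :=
        mul_le_mul_of_nonneg_left h2 (by linarith)
      nlinarith [mul_nonneg h0 hQ]

/-- A product of factors `1 + x² t`, `t ≥ 0`, is convex in `x²`, and so lies below its chord. -/
lemma sourceFactor_smul_bounds {n N : ℕ} {ν : ℤ} {X : Matrix (Fin (n + n)) (Fin (n + n)) ℂ}
    (hX : IsAntisymm X) {x : ℝ} (hx0 : 0 ≤ x) (hx1 : x ≤ 1) (a : RealMat N ν) :
    1 ≤ sourceFactor 1 1 ((x : ℂ) • X) a ∧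
      sourceFactor 1 1 ((x : ℂ) • X) a ≤ 1 + x ^ 2 * (sourceFactor 1 1 X a - 1) := by
  obtain ⟨U, hU, j, rfl⟩ := exists_unitary_normalForm hX
  rw [smul_normalForm, sourceFactor_normalForm hU, sourceFactor_normalForm hU,
    ← Finset.prod_product', ← Finset.prod_product']
  have h := prod_one_add_mul_bounds ((Finset.univ.filter fun k => singVal a k ≠ 0) ×ˢ
    (Finset.univ : Finset (Fin n)))
    (t := fun p => ((Real.sqrt 2 * N * singVal a p.1) ^ 2)⁻¹ * ‖j p.2‖ ^ 2)
    (fun p => by positivity) (sq_nonneg x) (by nlinarith)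
  have e : ∀ p : Fin (dimR N ν) × Fin n,
      1 + ((Real.sqrt 2 * N * singVal a p.1) ^ 2)⁻¹ * ‖(x : ℂ) * j p.2‖ ^ 2 =
      1 + x ^ 2 * (((Real.sqrt 2 * N * singVal a p.1) ^ 2)⁻¹ * ‖j p.2‖ ^ 2) := fun p => by
    rw [norm_mul, Complex.norm_real, Real.norm_eq_abs, mul_pow |x|, sq_abs]
    ring
  simp only [e]
  exact h

lemma rmtAverage_smul_bounds {n N : ℕ} {ν : ℤ} (hN : 0 < N) (h : 0 ≤ (N : ℤ) + ν)
    {X : Matrix (Fin (n + n)) (Fin (n + n)) ℂ}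
    (hX : IsAntisymm X) {x : ℝ} (hx0 : 0 ≤ x) (hx1 : x ≤ 1) :
    1 ≤ rmtAverage n N ν (sourceFactor 1 1 ((x : ℂ) • X)) ∧
      rmtAverage n N ν (sourceFactor 1 1 ((x : ℂ) • X)) ≤
        1 + x ^ 2 * rmtAverage n N ν (sourceFactor 1 1 X) := by
  have hI := integral_masslessWeight_pos (n := n) hN h
  have h0 := integrable_masslessWeight (n := n) hN h
  have h1 := integrable_masslessWeight_mul_sourceFactor hN h hX
  have h2 := integrable_masslessWeight_mul_sourceFactor hN h (hX.smul (x : ℂ))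
  unfold rmtAverage
  constructor
  · rw [le_div_iff₀ hI, one_mul]
    refine integral_mono h0 h2 fun a => ?_
    exact le_mul_of_one_le_right (masslessWeight_pos a).le (sourceFactor_smul_bounds hX hx0 hx1 a).1
  · rw [div_le_iff₀ hI, add_mul, one_mul, mul_assoc, div_mul_cancel₀ _ hI.ne',
      ← integral_const_mul, ← integral_add h0 (h1.const_mul _)]
    refine integral_mono h2 (h0.add (h1.const_mul _)) fun a => ?_
    have h3 := mul_le_mul_of_nonneg_left (sourceFactor_smul_bounds hX hx0 hx1 a).2
      (masslessWeight_pos (n := n) a).le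
    have h4 : 0 ≤ x ^ 2 * masslessWeight n a :=
      mul_nonneg (sq_nonneg x) (masslessWeight_pos a).le
    simp only
    linarith

/-! ### The normalization of the average -/

/-- The ratio of the rescaled model to the average over the massless ensemble. -/
def averageScale (n : ℕ) (ν : ℤ) (N : ℕ) : ℝ := rmtScale n ν N * massConst n ν N

lemma averageScale_mul_eq {n N : ℕ} {ν : ℤ} (hN : (-ν).toNat < N)
    {X : Matrix (Fin (n + n)) (Fin (n + n)) ℂ} (hX : IsAntisymm X) :
    (averageScale n ν N : ℂ) * chiralPow ν (pfaffian X) *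
        (rmtAverage n N ν (sourceFactor 1 1 X) : ℂ) =
      (rmtScale n ν N : ℂ) * gRMT n N ν (((1 / (Real.sqrt 2 * N) : ℝ) : ℂ) • X) := by
  rw [gRMT_eq_rmtAverage (by omega) (by omega) hX, averageScale]
  push_cast
  ring

lemma tendsto_averageScale_mul {n : ℕ} (ν : ℤ) {X : Matrix (Fin (n + n)) (Fin (n + n)) ℂ}
    (hX : IsAntisymm X) :
    Tendsto (fun N : ℕ => (averageScale n ν N : ℂ) * chiralPow ν (pfaffian X) *
      (rmtAverage n N ν (sourceFactor 1 1 X) : ℂ)) atTop (𝓝 (gFin n ν X)) := by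
  refine (tendsto_rmtScale_mul_gRMT ν hX).congr' ?_
  filter_upwards [eventually_gt_atTop (-ν).toNat] with N hN
  exact (averageScale_mul_eq hN hX).symm

lemma abs_averageScale_sub_le {n N : ℕ} {ν : ℤ} (hN : (-ν).toNat < N)
    {X : Matrix (Fin (n + n)) (Fin (n + n)) ℂ} (hX : IsAntisymm X) {x : ℝ} (hx0 : 0 ≤ x)
    (hx1 : x ≤ 1) :
    |averageScale n ν N * rmtAverage n N ν (sourceFactor 1 1 ((x : ℂ) • X)) - averageScale n ν N| ≤
      x ^ 2 * |averageScale n ν N * rmtAverage n N ν (sourceFactor 1 1 X)| := by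
  obtain ⟨h1, h2⟩ := rmtAverage_smul_bounds (by omega) (by omega : 0 ≤ (N : ℤ) + ν) hX hx0 hx1
  have h3 : 1 ≤ rmtAverage n N ν (sourceFactor 1 1 X) := by
    simpa using (rmtAverage_smul_bounds (by omega) (by omega : 0 ≤ (N : ℤ) + ν) hX zero_le_one
      le_rfl).1
  have h4 : averageScale n ν N * rmtAverage n N ν (sourceFactor 1 1 ((x : ℂ) • X)) -
      averageScale n ν N = averageScale n ν N *
        (rmtAverage n N ν (sourceFactor 1 1 ((x : ℂ) • X)) - 1) := by ring
  rw [h4, abs_mul, abs_mul, abs_of_nonneg (by linarith : 0 ≤ rmtAverage n N ν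
    (sourceFactor 1 1 ((x : ℂ) • X)) - 1), abs_of_nonneg (by linarith : 0 ≤ rmtAverage n N ν
    (sourceFactor 1 1 X)), mul_left_comm]
  exact mul_le_mul_of_nonneg_left (by linarith) (abs_nonneg _)

lemma chiralPow_pfaffian_smul {n : ℕ} (ν : ℤ) (X : Matrix (Fin (n + n)) (Fin (n + n)) ℂ) (x : ℝ) :
    chiralPow ν (pfaffian ((x : ℂ) • X)) =
      ((x ^ (n * ν.natAbs) : ℝ) : ℂ) * chiralPow ν (pfaffian X) := by
  rw [pfaffian_smul, show (n + n) / 2 = n by omega, chiralPow_mul, ← Complex.ofReal_pow,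
    chiralPow_ofReal, ← Complex.ofReal_pow, ← pow_mul]

lemma chiralPow_pfaffian_symplecticI_ne_zero (n : ℕ) (ν : ℤ) :
    chiralPow ν (pfaffian (symplecticI n)) ≠ 0 := by
  rw [← norm_ne_zero_iff, norm_chiralPow, pfaffian_symplecticI, norm_mul, norm_stdSign, norm_pow]
  simp

/-- The normalization of the average converges. -/
theorem exists_tendsto_averageScale (n : ℕ) (ν : ℤ) :
    ∃ d : ℝ, Tendsto (averageScale n ν) atTop (𝓝 d) := by
  have hX : IsAntisymm (symplecticI n) := isAntisymm_offDiag _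
  have hp := chiralPow_pfaffian_symplecticI_ne_zero n ν
  set p := chiralPow ν (pfaffian (symplecticI n))
  -- the rescaled averages converge for every positive multiple of `I`
  have hconv : ∀ x : ℝ, 0 < x → ∃ l : ℝ, Tendsto (fun N => averageScale n ν N *
      rmtAverage n N ν (sourceFactor 1 1 ((x : ℂ) • symplecticI n))) atTop (𝓝 l) := by
    intro x hx
    have hxp : chiralPow ν (pfaffian ((x : ℂ) • symplecticI n)) ≠ 0 := by
      rw [chiralPow_pfaffian_smul]
      refine mul_ne_zero ?_ hp
      exact_mod_cast (pow_pos hx _).ne'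
    have h1 := (tendsto_averageScale_mul ν (hX.smul (x : ℂ))).mul_const
      (chiralPow ν (pfaffian ((x : ℂ) • symplecticI n)))⁻¹
    refine ⟨_, ((Complex.continuous_re.tendsto _).comp h1).congr fun N => ?_⟩
    have h2 : (averageScale n ν N : ℂ) * chiralPow ν (pfaffian ((x : ℂ) • symplecticI n)) *
        (rmtAverage n N ν (sourceFactor 1 1 ((x : ℂ) • symplecticI n)) : ℂ) *
        (chiralPow ν (pfaffian ((x : ℂ) • symplecticI n)))⁻¹ =
        ((averageScale n ν N *
          rmtAverage n N ν (sourceFactor 1 1 ((x : ℂ) • symplecticI n)) : ℝ) : ℂ) := by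
      push_cast
      field_simp
    rw [Function.comp_apply, h2, Complex.ofReal_re]
  obtain ⟨l₁, hl₁⟩ := hconv 1 one_pos
  simp only [Complex.ofReal_one, one_smul] at hl₁
  set K := |l₁| + 1 with hK
  have hK0 : 0 < K := by positivity
  have hbdd : ∀ᶠ N in atTop,
      |averageScale n ν N * rmtAverage n N ν (sourceFactor 1 1 (symplecticI n))| < K :=
    hl₁.abs.eventually_lt_const (by linarith)
  refine cauchySeq_tendsto_of_complete (Metric.cauchySeq_iff.mpr fun ε hε => ?_)
  -- for small `x` the rescaled average at `x I` is close to its normalization, uniformly in large `N`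
  obtain ⟨x, hx0, hx1, hxε⟩ : ∃ x : ℝ, 0 < x ∧ x ≤ 1 ∧ x ^ 2 * K < ε / 4 := by
    refine ⟨min 1 (ε / (8 * K)), by positivity, min_le_left _ _, ?_⟩
    have h1 : min 1 (ε / (8 * K)) ≤ 1 := min_le_left _ _
    have h2 : min 1 (ε / (8 * K)) ≤ ε / (8 * K) := min_le_right _ _
    have h0 : 0 < min 1 (ε / (8 * K)) := by positivity
    calc min 1 (ε / (8 * K)) ^ 2 * K ≤ ε / (8 * K) * K := by
          refine mul_le_mul_of_nonneg_right ?_ hK0.le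
          nlinarith
      _ = ε / 8 := by field_simp
      _ < ε / 4 := by linarith
  obtain ⟨l, hl⟩ := hconv x hx0
  have hnear : ∀ᶠ N in atTop, |averageScale n ν N - l| < ε / 2 := by
    have h1 := (Metric.tendsto_nhds.mp hl) (ε / 4) (by linarith)
    filter_upwards [h1, hbdd, eventually_gt_atTop (-ν).toNat] with N hN1 hN2 hN3
    have h2 := abs_averageScale_sub_le hN3 hX hx0.le hx1
    rw [Real.dist_eq] at hN1
    have h3 : x ^ 2 * |averageScale n ν N * rmtAverage n N ν (sourceFactor 1 1 (symplecticI n))| ≤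
        x ^ 2 * K := mul_le_mul_of_nonneg_left hN2.le (sq_nonneg x)
    rw [abs_sub_comm] at h2
    calc |averageScale n ν N - l| ≤ _ := abs_sub_le _ (averageScale n ν N *
          rmtAverage n N ν (sourceFactor 1 1 ((x : ℂ) • symplecticI n))) _
      _ < ε / 2 := by linarith
  obtain ⟨N₀, hN₀⟩ := eventually_atTop.mp hnear
  refine ⟨N₀, fun p hp q hq => ?_⟩
  rw [Real.dist_eq]
  have h1 := hN₀ p hp
  have h2 := hN₀ q hq
  rw [abs_sub_comm] at h2
  linarith [abs_sub_le (averageScale n ν p) l (averageScale n ν q)]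

/-- If the normalization of the average tends to zero, the group integral vanishes at zero source to
a higher order than the Pfaffian of the source. -/
lemma norm_gFin_smul_le {n : ℕ} {ν : ℤ} (hd : Tendsto (averageScale n ν) atTop (𝓝 0))
    {X : Matrix (Fin (n + n)) (Fin (n + n)) ℂ} (hX : IsAntisymm X) {x : ℝ} (hx0 : 0 ≤ x)
    (hx1 : x ≤ 1) :
    ‖gFin n ν ((x : ℂ) • X)‖ ≤ x ^ (n * ν.natAbs) * (x ^ 2 * (‖gFin n ν X‖ + 1)) := by
  have h1 := (tendsto_averageScale_mul ν (hX.smul (x : ℂ))).norm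
  have h2 := (tendsto_averageScale_mul ν hX).norm
  have h3 : Tendsto (fun N => x ^ (n * ν.natAbs) *
      (‖chiralPow ν (pfaffian X)‖ * |averageScale n ν N| + x ^ 2 * (‖gFin n ν X‖ + 1))) atTop
      (𝓝 (x ^ (n * ν.natAbs) * (x ^ 2 * (‖gFin n ν X‖ + 1)))) := by
    have := ((hd.abs.const_mul ‖chiralPow ν (pfaffian X)‖).add_const
      (x ^ 2 * (‖gFin n ν X‖ + 1))).const_mul (x ^ (n * ν.natAbs))
    simpa using this
  refine le_of_tendsto_of_tendsto h1 h3 ?_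
  filter_upwards [h2.eventually_lt_const (lt_add_one _), eventually_gt_atTop (-ν).toNat]
    with N hN1 hN2
  have h4 := abs_averageScale_sub_le hN2 hX hx0 hx1
  rw [chiralPow_pfaffian_smul]
  set p := chiralPow ν (pfaffian X)
  set d := averageScale n ν N
  set R := rmtAverage n N ν (sourceFactor 1 1 X)
  set Rx := rmtAverage n N ν (sourceFactor 1 1 ((x : ℂ) • X))
  have e1 : ‖(d : ℂ) * (((x ^ (n * ν.natAbs) : ℝ) : ℂ) * p) * (Rx : ℂ)‖ =
      x ^ (n * ν.natAbs) * (‖p‖ * |d * Rx|) := by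
    rw [norm_mul, norm_mul, norm_mul, Complex.norm_real, Complex.norm_real, Complex.norm_real,
      Real.norm_of_nonneg (pow_nonneg hx0 _), Real.norm_eq_abs, Real.norm_eq_abs, abs_mul]
    ring
  have e2 : ‖(d : ℂ) * p * (R : ℂ)‖ = ‖p‖ * |d * R| := by
    rw [norm_mul, norm_mul, Complex.norm_real, Complex.norm_real, Real.norm_eq_abs,
      Real.norm_eq_abs, abs_mul]
    ring
  rw [e1]
  rw [e2] at hN1
  refine mul_le_mul_of_nonneg_left ?_ (pow_nonneg hx0 _)
  have h5 : |d * Rx| ≤ |d| + x ^ 2 * |d * R| := by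
    have h6 : d * Rx = (d * Rx - d) + d := by ring
    rw [h6]
    linarith [abs_add_le (d * Rx - d) d]
  have h7 := mul_le_mul_of_nonneg_left h5 (norm_nonneg p)
  have h8 := mul_le_mul_of_nonneg_left hN1.le (sq_nonneg x)
  linarith

/-! ### The leading coefficient of the group integral -/

/-- The point `U I Uᵀ` of the orbit of `I`. -/
def orbitPoint {n : ℕ} (U : Matrix.unitaryGroup (Fin (n + n)) ℂ) : MatSpace (n + n) :=
  congrMap (U : Matrix (Fin (n + n)) (Fin (n + n)) ℂ) (Matrix.of.symm (symplecticI n))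

lemma gFin_eq {n : ℕ} (ν : ℤ) (X : Matrix (Fin (n + n)) (Fin (n + n)) ℂ) :
    gFin n ν X = ∫ U : Matrix.unitaryGroup (Fin (n + n)) ℂ,
      chiralPow ν (U : Matrix (Fin (n + n)) (Fin (n + n)) ℂ).det *
        (Real.exp (rePair X (orbitPoint U)) : ℂ) ∂(haarU (n + n)) := by
  refine integral_congr_ae (Eventually.of_forall fun U => ?_)
  simp only
  rw [chiralPow_det_unitary ν U.2, rePair, orbitPoint, of_congrMap, Equiv.apply_symm_apply,
    ← mul_assoc, ← mul_assoc]

lemma continuous_orbitPoint (n : ℕ) : Continuous (orbitPoint (n := n)) := by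
  have h1 : Continuous fun U : Matrix.unitaryGroup (Fin (n + n)) ℂ =>
      (U : Matrix (Fin (n + n)) (Fin (n + n)) ℂ) := continuous_subtype_val
  exact (h1.matrix_mul continuous_const).matrix_mul h1.matrix_transpose

lemma continuous_rePair {k : ℕ} (X : Matrix (Fin k) (Fin k) ℂ) : Continuous (rePair X) := by
  simp only [funext (rePair_eq X)]
  fun_prop

lemma continuous_chiralPow_det (n : ℕ) (ν : ℤ) :
    Continuous fun U : Matrix.unitaryGroup (Fin (n + n)) ℂ =>
      chiralPow ν (U : Matrix (Fin (n + n)) (Fin (n + n)) ℂ).det :=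
  (continuous_chiralPow ν).comp (Continuous.matrix_det continuous_subtype_val)

lemma integrable_haarU {k : ℕ} {E : Type*} [NormedAddCommGroup E]
    [SecondCountableTopologyEither (Matrix.unitaryGroup (Fin k) ℂ) E]
    {f : Matrix.unitaryGroup (Fin k) ℂ → E} (hf : Continuous f) : Integrable f (haarU k) :=
  hf.integrable_of_hasCompactSupport (HasCompactSupport.of_compactSpace f)

lemma rePair_sum_left {k : ℕ} {ι : Type*} (s : Finset ι) (X : ι → Matrix (Fin k) (Fin k) ℂ)
    (B : MatSpace k) : rePair (∑ i ∈ s, X i) B = ∑ i ∈ s, rePair (X i) B := by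
  simp only [rePair]
  rw [Matrix.conjTranspose_sum, Finset.sum_mul, Matrix.trace_sum, Complex.re_sum]

lemma rePair_smul_left {k : ℕ} (x : ℝ) (X : Matrix (Fin k) (Fin k) ℂ) (B : MatSpace k) :
    rePair ((x : ℂ) • X) B = x * rePair X B := by
  rw [rePair, rePair, Matrix.conjTranspose_smul, Matrix.smul_mul, Matrix.trace_smul,
    Complex.star_def, Complex.conj_ofReal, smul_eq_mul, Complex.re_ofReal_mul]

lemma IsAntisymm.sum {k : ℕ} {ι : Type*} (s : Finset ι) {X : ι → Matrix (Fin k) (Fin k) ℂ}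
    (hX : ∀ i, IsAntisymm (X i)) : IsAntisymm (∑ i ∈ s, X i) := by
  rw [IsAntisymm, Matrix.transpose_sum, ← Finset.sum_neg_distrib]
  exact Finset.sum_congr rfl fun i _ => hX i

lemma abs_exp_sub_one_le (y : ℝ) : |Real.exp y - 1| ≤ |y| * Real.exp |y| := by
  rcases le_total 0 y with hy | hy
  · have h1 : 1 ≤ Real.exp y := Real.one_le_exp hy
    have h2 := Real.add_one_le_exp (-y)
    rw [abs_of_nonneg (by linarith), abs_of_nonneg hy]
    have h3 : Real.exp (-y) * Real.exp y = 1 := by rw [← Real.exp_add]; simp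
    nlinarith [Real.exp_pos y]
  · have h1 : Real.exp y ≤ 1 := Real.exp_le_one_iff.mpr hy
    have h2 := Real.add_one_le_exp y
    have h3 : 1 ≤ Real.exp |y| := Real.one_le_exp (abs_nonneg y)
    rw [abs_of_nonpos (by linarith)]
    have h4 : -y = |y| := (abs_of_nonpos hy).symm
    nlinarith [abs_nonneg y]

/-- Polarization: a group integral that vanishes at zero source to order greater than `k` has no
moments of order `k`. -/
theorem integral_prod_rePair_eq_zero {n : ℕ} {ν : ℤ} {ι : Type*} [Fintype ι]
    (H : ∀ X : Matrix (Fin (n + n)) (Fin (n + n)) ℂ, IsAntisymm X →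
      Tendsto (fun x : ℝ => gFin n ν ((x : ℂ) • X) / (x : ℂ) ^ Fintype.card ι) (𝓝[>] 0) (𝓝 0))
    {X : ι → Matrix (Fin (n + n)) (Fin (n + n)) ℂ} (hX : ∀ i, IsAntisymm (X i)) :
    ∫ U : Matrix.unitaryGroup (Fin (n + n)) ℂ,
      chiralPow ν (U : Matrix (Fin (n + n)) (Fin (n + n)) ℂ).det *
        ∏ i, (rePair (X i) (orbitPoint U) : ℂ) ∂(haarU (n + n)) = 0 := by
  classical
  have hr : ∀ i, Continuous fun U : Matrix.unitaryGroup (Fin (n + n)) ℂ =>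
      rePair (X i) (orbitPoint U) := fun i => (continuous_rePair _).comp (continuous_orbitPoint n)
  have hc := continuous_chiralPow_det n ν
  -- inclusion and exclusion
  have hexp : ∀ x : ℝ, ∑ T ∈ (Finset.univ : Finset ι).powerset,
      (∏ _i ∈ Finset.univ \ T, (-1 : ℂ)) * gFin n ν ((x : ℂ) • ∑ i ∈ T, X i) =
      ∫ U : Matrix.unitaryGroup (Fin (n + n)) ℂ,
        chiralPow ν (U : Matrix (Fin (n + n)) (Fin (n + n)) ℂ).det *
          ∏ i, ((Real.exp (x * rePair (X i) (orbitPoint U)) : ℂ) - 1) ∂(haarU (n + n)) := by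
    intro x
    have h1 : ∀ U : Matrix.unitaryGroup (Fin (n + n)) ℂ,
        chiralPow ν (U : Matrix (Fin (n + n)) (Fin (n + n)) ℂ).det *
          ∏ i, ((Real.exp (x * rePair (X i) (orbitPoint U)) : ℂ) - 1) =
        ∑ T ∈ (Finset.univ : Finset ι).powerset, (∏ _i ∈ Finset.univ \ T, (-1 : ℂ)) *
          (chiralPow ν (U : Matrix (Fin (n + n)) (Fin (n + n)) ℂ).det *
            (Real.exp (rePair ((x : ℂ) • ∑ i ∈ T, X i) (orbitPoint U)) : ℂ)) := fun U => by
      simp only [sub_eq_add_neg]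
      rw [Finset.prod_add, Finset.mul_sum]
      refine Finset.sum_congr rfl fun T _ => ?_
      rw [rePair_smul_left, rePair_sum_left, Finset.mul_sum, Real.exp_sum, Complex.ofReal_prod]
      ring
    simp only [h1]
    rw [integral_finsetSum _ fun T _ => ?_]
    · simp only [integral_const_mul, gFin_eq]
    · refine (integrable_haarU ?_).const_mul _
      have := (continuous_rePair ((x : ℂ) • ∑ i ∈ T, X i)).comp (continuous_orbitPoint n)
      exact hc.mul (Complex.continuous_ofReal.comp (Real.continuous_exp.comp this))
  -- by assumption the left side is of higher order than the number of factors; divided by that power of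
  -- `x`, the right side tends to the moment
  have l1 : Tendsto (fun x : ℝ => ∑ T ∈ (Finset.univ : Finset ι).powerset,
      (∏ _i ∈ Finset.univ \ T, (-1 : ℂ)) *
        (gFin n ν ((x : ℂ) • ∑ i ∈ T, X i) / (x : ℂ) ^ Fintype.card ι)) (𝓝[>] 0) (𝓝 0) := by
    have := tendsto_finsetSum (Finset.univ : Finset ι).powerset fun T _ =>
      (H (∑ i ∈ T, X i) (IsAntisymm.sum T hX)).const_mul (∏ _i ∈ Finset.univ \ T, (-1 : ℂ))
    simpa using this
  have l2 : Tendsto (fun x : ℝ => ∫ U : Matrix.unitaryGroup (Fin (n + n)) ℂ,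
      chiralPow ν (U : Matrix (Fin (n + n)) (Fin (n + n)) ℂ).det *
        ∏ i, (((Real.exp (x * rePair (X i) (orbitPoint U)) - 1) / x : ℝ) : ℂ) ∂(haarU (n + n)))
      (𝓝[>] 0) (𝓝 (∫ U : Matrix.unitaryGroup (Fin (n + n)) ℂ,
      chiralPow ν (U : Matrix (Fin (n + n)) (Fin (n + n)) ℂ).det *
        ∏ i, (rePair (X i) (orbitPoint U) : ℂ) ∂(haarU (n + n)))) := by
    refine tendsto_integral_filter_of_dominated_convergence
      (fun U => ∏ i, (|rePair (X i) (orbitPoint U)| * Real.exp |rePair (X i) (orbitPoint U)|))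
      ?_ ?_ ?_ ?_
    · refine Eventually.of_forall fun x => (Continuous.aestronglyMeasurable ?_)
      refine hc.mul (continuous_finsetProd _ fun i _ => Complex.continuous_ofReal.comp ?_)
      have := hr i
      fun_prop
    · have hx1 : ∀ᶠ x : ℝ in 𝓝[>] 0, x < 1 :=
        nhdsWithin_le_nhds (eventually_lt_nhds one_pos)
      filter_upwards [hx1, self_mem_nhdsWithin] with x hx1 hx0
      have hx0 : 0 < x := hx0
      refine Eventually.of_forall fun U => ?_
      rw [norm_mul, norm_chiralPow, norm_det_of_unitary U.2, one_pow, one_mul, norm_prod]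
      refine Finset.prod_le_prod (fun i _ => norm_nonneg _) fun i _ => ?_
      rw [Complex.norm_real, norm_div, Real.norm_eq_abs, Real.norm_eq_abs, abs_of_pos hx0,
        div_le_iff₀ hx0]
      refine (abs_exp_sub_one_le _).trans ?_
      rw [abs_mul, abs_of_pos hx0]
      have h1 : Real.exp (x * |rePair (X i) (orbitPoint U)|) ≤
          Real.exp |rePair (X i) (orbitPoint U)| :=
        Real.exp_le_exp.mpr (by nlinarith [abs_nonneg (rePair (X i) (orbitPoint U))])
      have h2 : 0 ≤ x * |rePair (X i) (orbitPoint U)| := by positivity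
      nlinarith
    · refine integrable_haarU (continuous_finsetProd _ fun i _ => ?_)
      have := hr i
      fun_prop
    · refine Eventually.of_forall fun U => ?_
      refine (tendsto_finsetProd _ fun i _ => ?_).const_mul _
      refine (Complex.continuous_ofReal.tendsto _).comp ?_
      have hd : HasDerivAt (fun x : ℝ => Real.exp (x * rePair (X i) (orbitPoint U)))
          (rePair (X i) (orbitPoint U)) 0 := by
        have := ((hasDerivAt_id (0 : ℝ)).mul_const (rePair (X i) (orbitPoint U))).exp
        simpa using this
      have h1 := (hasDerivAt_iff_tendsto_slope_zero.mp hd).mono_left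
        (nhdsWithin_mono 0 fun x (hx : 0 < x) => hx.ne')
      refine h1.congr fun x => ?_
      rw [zero_add, zero_mul, Real.exp_zero, smul_eq_mul]
      ring
  refine tendsto_nhds_unique l2 (l1.congr' ?_)
  filter_upwards [self_mem_nhdsWithin] with x hx
  have h1 : ∀ U : Matrix.unitaryGroup (Fin (n + n)) ℂ,
      chiralPow ν (U : Matrix (Fin (n + n)) (Fin (n + n)) ℂ).det *
        ∏ i, (((Real.exp (x * rePair (X i) (orbitPoint U)) - 1) / x : ℝ) : ℂ) =
      ((x : ℂ) ^ Fintype.card ι)⁻¹ *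
        (chiralPow ν (U : Matrix (Fin (n + n)) (Fin (n + n)) ℂ).det *
          ∏ i, ((Real.exp (x * rePair (X i) (orbitPoint U)) : ℂ) - 1)) := fun U => by
    simp only [Complex.ofReal_div, Finset.prod_div_distrib, Finset.prod_const, Finset.card_univ,
      Complex.ofReal_sub, Complex.ofReal_one]
    rw [div_eq_mul_inv]
    ring
  simp only [h1]
  rw [integral_const_mul, ← hexp, Finset.mul_sum]
  refine Finset.sum_congr rfl fun T _ => ?_
  rw [div_eq_mul_inv]
  ring

/-- The vanishing of the moments extends to complex combinations of the linear forms. -/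
lemma integral_prod_rePair_add_eq_zero {n : ℕ} {ν : ℤ} {ι : Type*} [Fintype ι]
    (H : ∀ X : Matrix (Fin (n + n)) (Fin (n + n)) ℂ, IsAntisymm X →
      Tendsto (fun x : ℝ => gFin n ν ((x : ℂ) • X) / (x : ℂ) ^ Fintype.card ι) (𝓝[>] 0) (𝓝 0))
    {X Z : ι → Matrix (Fin (n + n)) (Fin (n + n)) ℂ} (hX : ∀ i, IsAntisymm (X i))
    (hZ : ∀ i, IsAntisymm (Z i)) (c : ℂ) :
    ∫ U : Matrix.unitaryGroup (Fin (n + n)) ℂ,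
      chiralPow ν (U : Matrix (Fin (n + n)) (Fin (n + n)) ℂ).det *
        ∏ i, ((rePair (X i) (orbitPoint U) : ℂ) + c * (rePair (Z i) (orbitPoint U) : ℂ))
        ∂(haarU (n + n)) = 0 := by
  classical
  have h1 : ∀ U : Matrix.unitaryGroup (Fin (n + n)) ℂ,
      chiralPow ν (U : Matrix (Fin (n + n)) (Fin (n + n)) ℂ).det *
        ∏ i, ((rePair (X i) (orbitPoint U) : ℂ) + c * (rePair (Z i) (orbitPoint U) : ℂ)) =
      ∑ T ∈ (Finset.univ : Finset ι).powerset, (∏ _i ∈ Finset.univ \ T, c) *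
        (chiralPow ν (U : Matrix (Fin (n + n)) (Fin (n + n)) ℂ).det *
          ∏ i, (rePair (T.piecewise X Z i) (orbitPoint U) : ℂ)) := fun U => by
    rw [Finset.prod_add, Finset.mul_sum]
    refine Finset.sum_congr rfl fun T _ => ?_
    have h2 : ∏ i, (rePair (T.piecewise X Z i) (orbitPoint U) : ℂ) =
        (∏ i ∈ T, (rePair (X i) (orbitPoint U) : ℂ)) *
          ∏ i ∈ Finset.univ \ T, (rePair (Z i) (orbitPoint U) : ℂ) := by
      have h3 : ∀ i, (rePair (T.piecewise X Z i) (orbitPoint U) : ℂ) =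
          T.piecewise (fun i => (rePair (X i) (orbitPoint U) : ℂ))
            (fun i => (rePair (Z i) (orbitPoint U) : ℂ)) i := fun i => by
        by_cases hi : i ∈ T <;> simp [hi]
      simp only [h3]
      rw [Finset.prod_piecewise, Finset.univ_inter]
    rw [h2, Finset.prod_mul_distrib]
    ring
  have hPZ : ∀ (T : Finset ι) i, IsAntisymm (T.piecewise X Z i) := fun T i => by
    by_cases hi : i ∈ T
    · simpa [hi] using hX i
    · simpa [hi] using hZ i
  simp only [h1]
  rw [integral_finsetSum _ fun T _ => ?_]
  · refine Finset.sum_eq_zero fun T _ => ?_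
    rw [integral_const_mul, integral_prod_rePair_eq_zero H (hPZ T), mul_zero]
  · refine (integrable_haarU ((continuous_chiralPow_det n ν).mul
      (continuous_finsetProd _ fun i _ => ?_))).const_mul _
    exact Complex.continuous_ofReal.comp ((continuous_rePair _).comp (continuous_orbitPoint n))

/-- The antisymmetric elementary matrix, which reads off an entry. -/
def antisymSingle {k : ℕ} (a b : Fin k) (c : ℂ) : Matrix (Fin k) (Fin k) ℂ :=
  Matrix.single a b (c / 2) - Matrix.single b a (c / 2)

lemma isAntisymm_antisymSingle {k : ℕ} (a b : Fin k) (c : ℂ) :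
    IsAntisymm (antisymSingle a b c) := by
  rw [IsAntisymm, antisymSingle, Matrix.transpose_sub, Matrix.transpose_single,
    Matrix.transpose_single, neg_sub]

lemma rePair_antisymSingle {k : ℕ} (a b : Fin k) (c : ℂ) {B : MatSpace k} (hB : B b a = -B a b) :
    rePair (antisymSingle a b c) B = (starRingEnd ℂ c * B a b).re := by
  have h : ∀ (p q : Fin k) (z : ℂ), ((Matrix.single p q z)ᴴ * Matrix.of B).trace =
      starRingEnd ℂ z * B p q := fun p q z => by
    rw [Matrix.conjTranspose_single, Matrix.trace_single_mul]
    rfl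
  rw [rePair, antisymSingle, Matrix.conjTranspose_sub, Matrix.sub_mul, Matrix.trace_sub, h, h, hB]
  congr 1
  rw [map_div₀, map_ofNat]
  ring

lemma orbitPoint_swap {n : ℕ} (U : Matrix.unitaryGroup (Fin (n + n)) ℂ) (a b : Fin (n + n)) :
    orbitPoint U b a = -orbitPoint U a b := by
  have h : (Matrix.of (orbitPoint U))ᵀ = -Matrix.of (orbitPoint U) := by
    have hI : (symplecticI n)ᵀ = -symplecticI n := isAntisymm_offDiag _
    rw [orbitPoint, of_congrMap, Equiv.apply_symm_apply, Matrix.transpose_mul,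
      Matrix.transpose_mul, Matrix.transpose_transpose, hI, Matrix.neg_mul, Matrix.mul_neg,
      mul_assoc]
  exact congrFun (congrFun h a) b

/-- The group integral does not vanish to an order higher than that of `Pf(X)^ν`: it would have no
overlap with the conjugate of `Pf(U I Uᵀ)^ν`, which is the character `(det U)^ν` up to a sign. -/
theorem not_forall_gFin_isLittleO {n : ℕ} {ν : ℤ} :
    ¬ ∀ X : Matrix (Fin (n + n)) (Fin (n + n)) ℂ, IsAntisymm X →
      Tendsto (fun x : ℝ => gFin n ν ((x : ℂ) • X) / (x : ℂ) ^ (n * ν.natAbs)) (𝓝[>] 0) (𝓝 0) := by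
  intro H
  have hcard : Fintype.card (Fin ν.natAbs × Fin ((n + n) / 2)) = n * ν.natAbs := by
    rw [Fintype.card_prod, Fintype.card_fin, Fintype.card_fin, mul_comm]
    congr 1
    omega
  rw [← hcard] at H
  -- the entries of the orbit point, conjugated for `ν ≥ 0`
  set η : ℂ := if 0 ≤ ν then -Complex.I else Complex.I with hη
  set Y : Matrix.unitaryGroup (Fin (n + n)) ℂ → Matrix (Fin (n + n)) (Fin (n + n)) ℂ :=
    fun U => Matrix.of fun a b => (rePair (antisymSingle a b 1) (orbitPoint U) : ℂ) +
      η * (rePair (antisymSingle a b Complex.I) (orbitPoint U) : ℂ) with hY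
  have hre : ∀ (U : Matrix.unitaryGroup (Fin (n + n)) ℂ) (a b : Fin (n + n)),
      (rePair (antisymSingle a b 1) (orbitPoint U) : ℂ) = ((orbitPoint U a b).re : ℂ) :=
    fun U a b => by
      rw [rePair_antisymSingle a b 1 (orbitPoint_swap U a b), map_one, one_mul]
  have him : ∀ (U : Matrix.unitaryGroup (Fin (n + n)) ℂ) (a b : Fin (n + n)),
      (rePair (antisymSingle a b Complex.I) (orbitPoint U) : ℂ) = ((orbitPoint U a b).im : ℂ) :=
    fun U a b => by
      rw [rePair_antisymSingle a b Complex.I (orbitPoint_swap U a b)]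
      simp
  have hpf : ∀ U : Matrix.unitaryGroup (Fin (n + n)) ℂ, pfaffian (Y U) ^ ν.natAbs =
      starRingEnd ℂ (chiralPow ν (pfaffian (Matrix.of (orbitPoint U)))) := fun U => by
    by_cases hν : 0 ≤ ν
    · have h1 : Y U = (Matrix.of (orbitPoint U)).map (starRingEnd ℂ) := by
        ext a b
        simp only [hY, Matrix.of_apply, Matrix.map_apply, hre, him, hη, if_pos hν]
        apply Complex.ext <;> simp
      rw [h1, pfaffian_star, chiralPow, if_pos hν, map_pow]
    · have h1 : Y U = Matrix.of (orbitPoint U) := by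
        ext a b
        simp only [hY, Matrix.of_apply, hre, him, hη, if_neg hν]
        apply Complex.ext <;> simp
      rw [h1, chiralPow, if_neg hν, map_pow, Complex.conj_conj]
  -- the overlap vanishes
  have hzero : ∫ U : Matrix.unitaryGroup (Fin (n + n)) ℂ,
      chiralPow ν (U : Matrix (Fin (n + n)) (Fin (n + n)) ℂ).det * pfaffian (Y U) ^ ν.natAbs
        ∂(haarU (n + n)) = 0 := by
    set C : ℂ := 1 / ((2 : ℂ) ^ ((n + n) / 2) * (((n + n) / 2)! : ℂ)) with hC
    let u : Equiv.Perm (Fin (n + n)) → Fin ((n + n) / 2) → Fin (n + n) := fun σ i =>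
      σ ⟨2 * (i : ℕ), by have := i.isLt; omega⟩
    let v : Equiv.Perm (Fin (n + n)) → Fin ((n + n) / 2) → Fin (n + n) := fun σ i =>
      σ ⟨2 * (i : ℕ) + 1, by have := i.isLt; omega⟩
    have h1 : ∀ U : Matrix.unitaryGroup (Fin (n + n)) ℂ,
        chiralPow ν (U : Matrix (Fin (n + n)) (Fin (n + n)) ℂ).det * pfaffian (Y U) ^ ν.natAbs =
        ∑ p : Fin ν.natAbs → Equiv.Perm (Fin (n + n)),
          (C ^ ν.natAbs * ∏ l, ((Equiv.Perm.sign (p l) : ℤ) : ℂ)) *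
          (chiralPow ν (U : Matrix (Fin (n + n)) (Fin (n + n)) ℂ).det *
            ∏ q : Fin ν.natAbs × Fin ((n + n) / 2),
              ((rePair (antisymSingle (u (p q.1) q.2) (v (p q.1) q.2) 1) (orbitPoint U) : ℂ) +
              η * (rePair (antisymSingle (u (p q.1) q.2) (v (p q.1) q.2) Complex.I)
                (orbitPoint U) : ℂ))) := fun U => by
      have h2 : pfaffian (Y U) = C * ∑ σ : Equiv.Perm (Fin (n + n)),
          ((Equiv.Perm.sign σ : ℤ) : ℂ) * ∏ i, Y U (u σ i) (v σ i) := rfl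
      rw [h2, mul_pow, Fintype.sum_pow, Finset.mul_sum, Finset.mul_sum]
      refine Finset.sum_congr rfl fun p _ => ?_
      rw [Finset.prod_mul_distrib, Fintype.prod_prod_type]
      simp only [hY, Matrix.of_apply]
      ring
    simp only [h1]
    rw [integral_finsetSum _ fun p _ => ?_]
    · refine Finset.sum_eq_zero fun p _ => ?_
      rw [integral_const_mul, integral_prod_rePair_add_eq_zero H
        (fun q => isAntisymm_antisymSingle _ _ _) (fun q => isAntisymm_antisymSingle _ _ _),
        mul_zero]
    · refine (integrable_haarU ((continuous_chiralPow_det n ν).mul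
        (continuous_finsetProd _ fun q _ => ?_))).const_mul _
      exact (Complex.continuous_ofReal.comp ((continuous_rePair _).comp
        (continuous_orbitPoint n))).add (continuous_const.mul (Complex.continuous_ofReal.comp
          ((continuous_rePair _).comp (continuous_orbitPoint n))))
  -- the overlap is a phase
  have hone : ∀ U : Matrix.unitaryGroup (Fin (n + n)) ℂ,
      chiralPow ν (U : Matrix (Fin (n + n)) (Fin (n + n)) ℂ).det * pfaffian (Y U) ^ ν.natAbs =
        starRingEnd ℂ (chiralPow ν (pfaffian (symplecticI n))) := fun U => by
    rw [hpf, orbitPoint, of_congrMap, Equiv.apply_symm_apply, pfaffian_congr (Even.add_self n),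
      chiralPow_mul, map_mul, ← mul_assoc, Complex.mul_conj, Complex.normSq_eq_norm_sq,
      norm_chiralPow, norm_det_of_unitary U.2]
    simp
  simp only [hone] at hzero
  rw [integral_const, probReal_univ, one_smul, map_eq_zero] at hzero
  exact chiralPow_pfaffian_symplecticI_ne_zero n ν hzero

/-- The normalization of the average over the massless ensemble has a nonzero limit. -/
theorem exists_tendsto_averageScale_ne_zero (n : ℕ) (ν : ℤ) :
    ∃ d : ℝ, d ≠ 0 ∧ Tendsto (averageScale n ν) atTop (𝓝 d) := by
  obtain ⟨d, hd⟩ := exists_tendsto_averageScale n ν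
  refine ⟨d, ?_, hd⟩
  -- a vanishing limit would make the group integral vanish to too high an order at zero source
  rintro rfl
  refine not_forall_gFin_isLittleO (n := n) (ν := ν) fun X hX => ?_
  have h1 : Tendsto (fun x : ℝ => x ^ 2 * (‖gFin n ν X‖ + 1)) (𝓝[>] 0) (𝓝 0) := by
    have hc : Continuous fun x : ℝ => x ^ 2 * (‖gFin n ν X‖ + 1) := by fun_prop
    have := (hc.tendsto 0).mono_left (nhdsWithin_le_nhds (s := Set.Ioi 0))
    simpa using this
  refine squeeze_zero_norm' ?_ h1
  have hx1 : ∀ᶠ x : ℝ in 𝓝[>] 0, x < 1 := nhdsWithin_le_nhds (eventually_lt_nhds one_pos)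
  filter_upwards [hx1, self_mem_nhdsWithin] with x hx1 hx0
  have hx0 : 0 < x := hx0
  rw [norm_div, norm_pow, Complex.norm_real, Real.norm_of_nonneg hx0.le,
    div_le_iff₀ (pow_pos hx0 _), mul_comm (x ^ 2 * _)]
  exact norm_gFin_smul_le hd hX hx0.le hx1.le

/-- The scaling limit of the average over the massless ensemble, with a normalization independent of
`N` and of the source. -/
theorem exists_tendsto_rmtAverage (n : ℕ) (ν : ℤ) :
    ∃ κ : ℝ, κ ≠ 0 ∧ ∀ V₄ Φ : ℝ, ∀ J : Matrix (Fin (n + n)) (Fin (n + n)) ℂ, IsAntisymm J →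
      Tendsto (fun N : ℕ => (κ : ℂ) * chiralPow ν (pfaffian (((V₄ * Φ : ℝ) : ℂ) • J)) *
        (rmtAverage n N ν (sourceFactor V₄ Φ J) : ℂ))
        atTop (𝓝 (gFin n ν (((V₄ * Φ : ℝ) : ℂ) • J))) := by
  obtain ⟨d, hd0, hd⟩ := exists_tendsto_averageScale_ne_zero n ν
  refine ⟨d, hd0, fun V₄ Φ J hJ => ?_⟩
  have hd0' : (d : ℂ) ≠ 0 := by exact_mod_cast hd0
  have h1 : Tendsto (fun N => (d : ℂ) / (averageScale n ν N : ℂ)) atTop (𝓝 1) := by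
    have := (tendsto_const_nhds (x := (d : ℂ))).div
      ((Complex.continuous_ofReal.tendsto d).comp hd) hd0'
    rwa [div_self hd0'] at this
  have h2 := h1.mul (tendsto_averageScale_mul ν (hJ.smul ((V₄ * Φ : ℝ) : ℂ)))
  rw [one_mul] at h2
  refine h2.congr' ?_
  filter_upwards [hd.eventually_ne hd0] with N hN
  have hN' : (averageScale n ν N : ℂ) ≠ 0 := by exact_mod_cast hN
  have h3 : (sourceFactor V₄ Φ J : RealMat N ν → ℝ) =
      sourceFactor 1 1 (((V₄ * Φ : ℝ) : ℂ) • J) := funext fun a => sourceFactor_eq_smul V₄ Φ J a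
  rw [h3]
  field_simp

end ChiralRMT

end

theorem mainTheorem7 (n : ℕ) (hn : 0 < n) (ν : ℤ) :
    -- the two forms of the model and its relation to the massive model at zero chemical potential
    (∀ N : ℕ, 0 ≤ (N : ℤ) + ν →
      (∀ J : Matrix (Fin (n + n)) (Fin (n + n)) ℂ, ChiralRMT.IsAntisymm J →
        Integrable (ChiralRMT.rmtIntegrand n N ν J) ∧
        (∃ U ∈ Matrix.specialUnitaryGroup (Fin (n + n)) ℂ, ∃ j : Fin n → ℂ,
          J = U * ChiralRMT.offDiag (Matrix.diagonal j) * Uᵀ) ∧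
        (∀ U ∈ Matrix.unitaryGroup (Fin (n + n)) ℂ, ∀ j : Fin n → ℂ,
          J = U * ChiralRMT.offDiag (Matrix.diagonal j) * Uᵀ →
          ChiralRMT.gRMT n N ν J =
            ChiralRMT.orderSign n N ν * ChiralRMT.chiralPow ν U.det *
              ChiralRMT.gProduct n N ν j)) ∧
      (∀ j : Fin n → ℂ,
        ChiralRMT.gProduct n N ν j = ChiralRMT.zMassMuZero n N ν (Matrix.diagonal j)) ∧
      (∀ M : Matrix (Fin n) (Fin n) ℂ,
        ChiralRMT.gRMT n N ν (ChiralRMT.offDiag M) =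
          ChiralRMT.orderSign n N ν * ChiralRMT.zMassMuZero n N ν M)) ∧
    -- the limit of large `N`, up to a normalization that does not depend on the sources
    (∃ c : ℕ → ℝ, (∀ N, c N ≠ 0) ∧
      (∀ X : Matrix (Fin (n + n)) (Fin (n + n)) ℂ, ChiralRMT.IsAntisymm X →
        Tendsto
          (fun N : ℕ => (c N : ℂ) *
            ChiralRMT.gRMT n N ν (((1 / (Real.sqrt 2 * N) : ℝ) : ℂ) • X))
          atTop (𝓝 (ChiralRMT.gFin n ν X))) ∧
      (∀ V₄ Φ : ℝ, 0 < V₄ → 0 < Φ →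
        ∀ JL JR : Matrix (Fin (n + n)) (Fin (n + n)) ℂ,
          ChiralRMT.IsAntisymm JL → ChiralRMT.IsAntisymm JR →
          Tendsto
            (fun N : ℕ => (c N : ℂ) ^ 2 *
              ChiralRMT.zRMT n N ν (((V₄ * Φ / (Real.sqrt 2 * N) : ℝ) : ℂ) • JL)
                (((V₄ * Φ / (Real.sqrt 2 * N) : ℝ) : ℂ) • JR))
            atTop (𝓝 (ChiralRMT.zEff n ν V₄ Φ JL JR)))) ∧
    -- the scaling of the singular values
    (∃ κ : ℝ, κ ≠ 0 ∧
      ∀ V₄ Φ : ℝ, 0 < V₄ → 0 < Φ →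
        ∀ J : Matrix (Fin (n + n)) (Fin (n + n)) ℂ, ChiralRMT.IsAntisymm J →
          Tendsto
            (fun N : ℕ => (κ : ℂ) *
              ChiralRMT.chiralPow ν (ChiralRMT.pfaffian (((V₄ * Φ : ℝ) : ℂ) • J)) *
              (ChiralRMT.rmtAverage n N ν (ChiralRMT.sourceFactor V₄ Φ J) : ℂ))
            atTop (𝓝 (ChiralRMT.gFin n ν (((V₄ * Φ : ℝ) : ℂ) • J)))) := by
  refine ⟨fun N h => ⟨fun J hJ => ⟨ChiralRMT.integrable_rmtIntegrand n N ν J,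
      ChiralRMT.exists_specialUnitary_normalForm hn hJ, ?_⟩,
      ChiralRMT.gProduct_eq_zMassMuZero h, ChiralRMT.gRMT_offDiag⟩,
    ⟨ChiralRMT.rmtScale n ν, ChiralRMT.rmtScale_ne_zero n ν,
      fun X hX => ChiralRMT.tendsto_rmtScale_mul_gRMT ν hX,
      fun V₄ Φ _ _ JL JR hL hR => ChiralRMT.tendsto_rmtScale_sq_mul_zRMT ν V₄ Φ hL hR⟩, ?_⟩
  · rintro U hU j rfl
    exact ChiralRMT.gRMT_normalForm h hU j
  · obtain ⟨κ, hκ, h⟩ := ChiralRMT.exists_tendsto_rmtAverage n ν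
    exact ⟨κ, hκ, fun V₄ Φ _ _ J hJ => h V₄ Φ J hJ⟩
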